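/- All vector spaces are over $\mathbb{Q}$ and graded over $\mathbb{Z}$. An $L_\infty$ algebra $L$ has graded skew-symmetric brackets $\ell_k\colon L^{\otimes k}\to L$ of degree $k-2$ ($k\ge 1$) satisfying the generalized Jacobi identities. Let $(sL)_i=L_{i-1}$, let $\Lambda sL$ be the free graded-commutative algebra on $sL$ with the coproduct for which $sL$ is primitive, put $h_k=(-1)^{k(k-1)/2}\,s\circ\ell_k\circ(s^{-1})^{\otimes k}\colon\Lambda^k sL\to sL$, let $\delta_k$ be the coderivation of $\Lambda sL$ extending $h_k$, and $\delta=\sum_{k\ge1}\delta_k$. Then $(\Lambda sL,\delta)$ is a complex, filtered by $F_p=\mathbb{Q}\cdot 1\oplus\ker\Delta^p$ $(=\Lambda^{\le p}sL)$ for $p\ge 0$ and $F_p=0$ for $p<0$, where $\Delta^p$ is the $p$-th iterated reduced diagonal on the coaugmentation kernel. Its spectral sequence, the Quillen spectral sequence of $L$, has the pages $$E^r_p=\frac{Z^r_p}{Z^{r-1}_{p-1}+D^{r-1}_p},\qquad Z^r_p=F_p\cap\delta^{-1}(F_{p-r}),\quad D^r_p=F_p\cap\delta(F_{p+r}),$$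 with $d^r\colon E^r_p\to E^r_{p-r}$ induced by $\delta$; it collapses at $E^2$ if $d^r=0$ for all $r\ge2$. An $L_\infty$ morphism $L\to L'$ is a morphism of coaugmented differential graded coalgebras $(\Lambda sL,\delta)\to(\Lambda sL',\delta')$; it is a quasi-isomorphism if its linear part $(L,\ell_1)\to(L',\ell_1')$ is one, and two $L_\infty$ algebras are weakly equivalent if they are joined by a zig-zag of quasi-isomorphisms. $L$ is formal if it is weakly equivalent to its homology $H_*(L,\ell_1)$ endowed with an $L_\infty$ structure all of whose brackets vanish except possibly $\ell_2$, which is the one induced by the bracket $\ell_2$ of $L$. **Proposition.** (1) If $L=L_{\ge0}$ is a formal $L_\infty$ algebra, then its Quillen spectral sequence collapses at $E^2$. (2) Let $k\ge1$ and let $L$ be any $L_\infty$ algebra with $\ell_j=0$ for all $j<k$. Then the pages satisfy $E^0=\cdots=E^{k-1}$ (equal as subquotients of $\Lambda sL$, with $d^r=0$ for $0\le r<k-1$); for every $p$ the map $x\mapsto[x]$ is an isomorphism $\Lambda^p sL\cong E^{k-1}_p$, and under these isomorphisms $d^{k-1}$ is identified with $\delta_k\colon\Lambda^p sL\to\Lambda^{p-k+1}sL$.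 -/

import Mathlib

open scoped DirectSum TensorProduct

universe u

namespace Quillen

/-- A `ℤ`-graded rational vector space `V = ⨁ₙ Vₙ`. -/
structure GradedSpace where
  carrier : Type u
  [addCommGroup : AddCommGroup carrier]
  [module : Module ℚ carrier]
  gr : ℤ → Submodule ℚ carrier
  isInternal : DirectSum.IsInternal gr

namespace GradedSpace

attribute [instance] addCommGroup module

instance : CoeSort GradedSpace.{u} (Type u) := ⟨carrier⟩

variable (V : GradedSpace.{u})

noncomputable instance : DirectSum.Decomposition V.gr := V.isInternal.chooseDecomposition

/-- The suspension `sV`: `(sV)ᵢ = Vᵢ₋₁`. -/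
def susp : GradedSpace.{u} where
  carrier := V.carrier
  gr i := V.gr (i - 1)
  isInternal := by
    have h := V.isInternal
    rw [DirectSum.isInternal_submodule_iff_iSupIndep_and_iSup_eq_top] at h ⊢
    refine ⟨h.1.comp (Equiv.subRight (1 : ℤ)).injective, ?_⟩
    rw [← h.2]
    exact (Equiv.subRight (1 : ℤ)).iSup_comp (g := V.gr)

/-- The degree `+1` identification `s : V → sV`. -/
def s : V ≃ₗ[ℚ] V.susp := LinearEquiv.refl ℚ V.carrier

/-- The grading involution `v ↦ (-1)^|v| v`. -/
noncomputable def signOp : V →ₗ[ℚ] V :=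
  DirectSum.coeLinearMap V.gr ∘ₗ
    DirectSum.lmap (fun i : ℤ => (-1 : ℚ) ^ i • (LinearMap.id : V.gr i →ₗ[ℚ] V.gr i)) ∘ₗ
    (DirectSum.decomposeLinearEquiv V.gr).toLinearMap

theorem signOp_of_mem {i : ℤ} {v : V} (hv : v ∈ V.gr i) : V.signOp v = (-1 : ℚ) ^ i • v := by
  lift v to V.gr i using hv
  simp only [signOp, LinearMap.comp_apply, LinearEquiv.coe_coe, DirectSum.decomposeLinearEquiv_apply,
    DirectSum.decompose_coe]
  rw [← DirectSum.lof_eq_of ℚ, DirectSum.lmap_lof]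
  simp

/-- The projection of `V` onto its degree `n` part. -/
noncomputable def proj (n : ℤ) : V →ₗ[ℚ] V :=
  (V.gr n).subtype ∘ₗ DirectSum.component ℚ ℤ (fun i => V.gr i) n ∘ₗ
    (DirectSum.decomposeLinearEquiv V.gr).toLinearMap

theorem proj_apply (n : ℤ) (x : V) : V.proj n x = (DirectSum.decompose V.gr x n : V) := rfl

theorem proj_of_mem {n : ℤ} {x : V} (hx : x ∈ V.gr n) : V.proj n x = x :=
  DirectSum.decompose_of_mem_same V.gr hx

theorem proj_of_mem_ne {n m : ℤ} {x : V} (hx : x ∈ V.gr n) (h : n ≠ m) : V.proj m x = 0 :=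
  DirectSum.decompose_of_mem_ne V.gr hx h

theorem proj_mem (n : ℤ) (x : V) : V.proj n x ∈ V.gr n := (DirectSum.decompose V.gr x n).2

theorem proj_comm {d : V →ₗ[ℚ] V} (hd : ∀ n, ∀ x ∈ V.gr n, d x ∈ V.gr (n - 1)) (n : ℤ) (x : V) :
    d (V.proj n x) = V.proj (n - 1) (d x) := by
  induction x using DirectSum.Decomposition.inductionOn V.gr with
  | zero => simp
  | add a b ha hb => simp [ha, hb]
  | @homogeneous i a =>
    by_cases h : i = n
    · subst h
      rw [proj_of_mem V a.2, proj_of_mem V (hd _ _ a.2)]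
    · rw [proj_of_mem_ne V a.2 h, proj_of_mem_ne V (hd _ _ a.2) (by omega), map_zero]

/-- Homology of a graded space with respect to a linear map `d` of degree `-1`
(`ker d / im d`, graded by the degrees of representing cycles). -/
def homology (d : V →ₗ[ℚ] V) (hd : ∀ n, ∀ x ∈ V.gr n, d x ∈ V.gr (n - 1)) : GradedSpace.{u} where
  carrier := LinearMap.ker d ⧸ (LinearMap.range d).submoduleOf (LinearMap.ker d)
  gr n := ((V.gr n).submoduleOf (LinearMap.ker d)).map
    ((LinearMap.range d).submoduleOf (LinearMap.ker d)).mkQ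
  isInternal := by
    classical
    have hk (n : ℤ) : ∀ x ∈ LinearMap.ker d, V.proj n x ∈ LinearMap.ker d := fun x hx => by
      rw [LinearMap.mem_ker] at hx ⊢
      rw [proj_comm V hd, hx, map_zero]
    let P (n : ℤ) := (V.proj n).restrict (hk n)
    have hP (n : ℤ) : (LinearMap.range d).submoduleOf (LinearMap.ker d) ≤
        ((LinearMap.range d).submoduleOf (LinearMap.ker d)).comap (P n) := by
      rintro x ⟨y, hy⟩
      refine ⟨V.proj (n + 1) y, ?_⟩
      rw [proj_comm V hd, hy, add_sub_cancel_right]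
      rfl
    let Q (n : ℤ) := Submodule.mapQ _ _ (P n) (hP n)
    rw [DirectSum.isInternal_submodule_iff_iSupIndep_and_iSup_eq_top]
    constructor
    · rw [iSupIndep_def]
      intro n
      rw [Submodule.disjoint_def]
      intro x hx hx'
      have h1 : Q n x = x := by
        obtain ⟨y, hy, rfl⟩ := hx
        refine congrArg (Submodule.Quotient.mk) (Subtype.ext ?_)
        exact proj_of_mem V hy
      have h2 : (⨆ j, ⨆ (_ : j ≠ n), ((V.gr j).submoduleOf (LinearMap.ker d)).map
          ((LinearMap.range d).submoduleOf (LinearMap.ker d)).mkQ) ≤ LinearMap.ker (Q n) := by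
        refine iSup₂_le fun j hj => ?_
        rintro _ ⟨y, hy, rfl⟩
        have : P n y = 0 := Subtype.ext (proj_of_mem_ne V hy hj)
        rw [LinearMap.mem_ker]
        change Submodule.Quotient.mk (P n y) = _
        rw [this, Submodule.Quotient.mk_zero]
      rw [← h1]
      exact h2 hx'
    · rw [eq_top_iff]
      rintro x -
      obtain ⟨y, rfl⟩ := Submodule.mkQ_surjective _ x
      have hy : y = ∑ n ∈ (DirectSum.decompose V.gr (y : V)).support, P n y := by
        refine Subtype.ext ?_
        rw [AddSubmonoidClass.coe_finsetSum]
        exact (DirectSum.sum_support_decompose V.gr (y : V)).symm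
      rw [hy, map_sum]
      refine Submodule.sum_mem _ fun n _ => Submodule.mem_iSup_of_mem n ?_
      exact ⟨P n y, V.proj_mem n y, rfl⟩

end GradedSpace

/-! ### The free graded-commutative algebra and its coproduct -/

section Lam

variable (V : GradedSpace.{u})

/-- The two-sided ideal of the tensor algebra generated by `v ⊗ w - (-1)^(|v||w|) w ⊗ v`. -/
noncomputable def relIdeal : Ideal (TensorAlgebra ℚ V) :=
  (TwoSidedIdeal.span {z : TensorAlgebra ℚ V | ∃ i j : ℤ, ∃ v ∈ V.gr i, ∃ w ∈ V.gr j,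
    z = TensorAlgebra.ι ℚ v * TensorAlgebra.ι ℚ w
      - (-1 : ℚ) ^ (i * j) • (TensorAlgebra.ι ℚ w * TensorAlgebra.ι ℚ v)}).asIdeal

instance : (relIdeal V).IsTwoSided := by
  unfold relIdeal; infer_instance

/-- `ΛV = T(V) / (v ⊗ w - (-1)^(|v||w|) w ⊗ v)`. -/
def Lam : Type u := TensorAlgebra ℚ V ⧸ relIdeal V

noncomputable instance : Ring (Lam V) := inferInstanceAs (Ring (TensorAlgebra ℚ V ⧸ relIdeal V))

noncomputable instance : Algebra ℚ (Lam V) :=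
  inferInstanceAs (Algebra ℚ (TensorAlgebra ℚ V ⧸ relIdeal V))

namespace Lam

/-- The quotient map `T(V) → ΛV`. -/
noncomputable def mk : TensorAlgebra ℚ V →ₐ[ℚ] Lam V := Ideal.Quotient.mkₐ ℚ (relIdeal V)

theorem mk_surjective : Function.Surjective (mk V) := Ideal.Quotient.mkₐ_surjective ℚ _

/-- The inclusion `V → ΛV` of words of length one. -/
noncomputable def ι : V →ₗ[ℚ] Lam V := (mk V).toLinearMap ∘ₗ TensorAlgebra.ι ℚ

variable {V}

theorem mk_eq_zero {x : TensorAlgebra ℚ V} (hx : x ∈ relIdeal V) : mk V x = 0 :=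
  Ideal.Quotient.eq_zero_iff_mem.2 hx

theorem ι_mul_ι {i j : ℤ} {v w : V} (hv : v ∈ V.gr i) (hw : w ∈ V.gr j) :
    ι V v * ι V w = (-1 : ℚ) ^ (i * j) • (ι V w * ι V v) := by
  rw [← sub_eq_zero]
  have := mk_eq_zero (V := V) (TwoSidedIdeal.subset_span ⟨i, j, v, hv, w, hw, rfl⟩)
  simpa [ι] using this

/-- Algebra morphisms out of `ΛV` are linear maps with graded-commuting values. -/
noncomputable def lift {A : Type*} [Ring A] [Algebra ℚ A] (f : V →ₗ[ℚ] A)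
    (hf : ∀ i j : ℤ, ∀ v ∈ V.gr i, ∀ w ∈ V.gr j,
      f v * f w = (-1 : ℚ) ^ (i * j) • (f w * f v)) : Lam V →ₐ[ℚ] A :=
  Ideal.Quotient.liftₐ (relIdeal V) (TensorAlgebra.lift ℚ f) (by
    intro a ha
    induction ha using TwoSidedIdeal.span_induction with
    | mem x h =>
      obtain ⟨i, j, v, hv, w, hw, rfl⟩ := h
      simp [hf i j v hv w hw]
    | zero => simp
    | add x y _ _ hx hy => simp [hx, hy]
    | neg x _ hx => simp [hx]
    | left_absorb a x _ hx => simp [hx]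
    | right_absorb a x _ hx => simp [hx])

@[simp] theorem lift_ι {A : Type*} [Ring A] [Algebra ℚ A] (f : V →ₗ[ℚ] A) (hf) (v : V) :
    lift f hf (ι V v) = f v :=
  TensorAlgebra.lift_ι_apply f v

theorem algHom_ext {A : Type*} [Ring A] [Algebra ℚ A] {f g : Lam V →ₐ[ℚ] A}
    (h : f.toLinearMap ∘ₗ ι V = g.toLinearMap ∘ₗ ι V) : f = g := by
  refine Ideal.Quotient.algHom_ext (R₁ := ℚ) (TensorAlgebra.hom_ext ?_)
  exact h

variable (V)

/-- The degree `n` part of `ΛV`: the span of the words `v₁ ∧ ⋯ ∧ vₖ` in homogeneous elements with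
`|v₁| + ⋯ + |vₖ| = n`. -/
noncomputable def gr (n : ℤ) : Submodule ℚ (Lam V) :=
  Submodule.span ℚ {x | ∃ l : List (Σ i : ℤ, V.gr i),
    (l.map Sigma.fst).sum = n ∧ x = (l.map fun a => ι V (a.2 : V)).prod}

variable {V} in
theorem ι_mem_gr {i : ℤ} {v : V} (hv : v ∈ V.gr i) : ι V v ∈ gr V i :=
  Submodule.subset_span ⟨[⟨i, v, hv⟩], by simp, by simp⟩

instance : SetLike.GradedMonoid (gr V) where
  one_mem := Submodule.subset_span ⟨[], by simp, by simp⟩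
  mul_mem := by
    intro i j a b ha hb
    have := Submodule.mul_mem_mul ha hb
    rw [gr, gr, Submodule.span_mul_span] at this
    refine Submodule.span_mono ?_ this
    rintro _ ⟨_, ⟨l, hl, rfl⟩, _, ⟨m, hm, rfl⟩, rfl⟩
    exact ⟨l ++ m, by simp [hl, hm], by simp⟩

/-- Auxiliary: `v ↦ ∑ᵢ vᵢ`, with `vᵢ` placed in degree `i`. -/
noncomputable def gradedι : V →ₗ[ℚ] ⨁ i, gr V i :=
  DirectSum.lmap (fun i : ℤ => ((ι V).restrict (p := V.gr i) (q := gr V i)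
    fun _ h => ι_mem_gr h)) ∘ₗ (DirectSum.decomposeLinearEquiv V.gr).toLinearMap

theorem gradedι_of_mem {i : ℤ} {v : V} (hv : v ∈ V.gr i) :
    gradedι V v = DirectSum.of (fun i => gr V i) i ⟨ι V v, ι_mem_gr hv⟩ := by
  lift v to V.gr i using hv
  simp only [gradedι, LinearMap.comp_apply, LinearEquiv.coe_coe,
    DirectSum.decomposeLinearEquiv_apply, DirectSum.decompose_coe]
  rw [← DirectSum.lof_eq_of ℚ, DirectSum.lmap_lof]
  rfl

theorem gradedι_comm (i j : ℤ) (v : V) (hv : v ∈ V.gr i) (w : V) (hw : w ∈ V.gr j) :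
    gradedι V v * gradedι V w = (-1 : ℚ) ^ (i * j) • (gradedι V w * gradedι V v) := by
  rw [gradedι_of_mem V hv, gradedι_of_mem V hw, DirectSum.of_mul_of, DirectSum.of_mul_of,
    ← DirectSum.lof_eq_of ℚ, ← DirectSum.lof_eq_of ℚ, ← map_smul, DirectSum.lof_eq_of,
    DirectSum.lof_eq_of]
  refine DirectSum.of_eq_of_gradedMonoid_eq (Sigma.subtype_ext (add_comm _ _) ?_)
  exact ι_mul_ι hv hw

/-- Auxiliary: the decomposition of `ΛV` into its degrees. -/
noncomputable def toGraded : Lam V →ₐ[ℚ] ⨁ i, gr V i :=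
  lift (A := ⨁ i, gr V i) (gradedι V) (gradedι_comm V)

theorem toGraded_of_mem {i : ℤ} (x : gr V i) :
    toGraded V x = DirectSum.of (fun i => gr V i) i x := by
  obtain ⟨x, hx⟩ := x
  dsimp only
  induction hx using Submodule.span_induction with
  | zero => rw [map_zero]; exact (map_zero _).symm
  | add a b ha hb iha ihb => rw [map_add, iha, ihb, ← map_add]; rfl
  | smul c a ha iha =>
    rw [map_smul, iha, ← DirectSum.lof_eq_of ℚ, ← map_smul]; rfl
  | mem x h =>
    obtain ⟨l, hl, rfl⟩ := h
    induction l generalizing i with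
    | nil =>
      obtain rfl : 0 = i := by simpa using hl
      simp only [List.map_nil, List.prod_nil, map_one]
      rfl
    | cons a l ih =>
      subst hl
      simp only [List.map_cons, List.prod_cons, map_mul]
      rw [ih rfl, toGraded, lift_ι, gradedι_of_mem V a.2.2, DirectSum.of_mul_of]
      refine DirectSum.of_eq_of_gradedMonoid_eq (Sigma.subtype_ext ?_ rfl)
      change a.1 + (l.map Sigma.fst).sum = ((a :: l).map Sigma.fst).sum
      simp

noncomputable instance : GradedAlgebra (gr V) :=
  GradedAlgebra.ofAlgHom _ (toGraded V)
    (by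
      apply algHom_ext
      ext v
      induction v using DirectSum.Decomposition.inductionOn V.gr with
      | zero => simp
      | add a b ha hb => rw [map_add, ha, hb, map_add]
      | @homogeneous i a =>
        simp [toGraded, gradedι_of_mem V a.2, DirectSum.coeAlgHom_of])
    (fun i x => toGraded_of_mem V x)

/-- Auxiliary: `v ↦ v ⊗ 1 + 1 ⊗ v`. -/
noncomputable def primitive : V →ₗ[ℚ] gr V ᵍ⊗[ℚ] gr V :=
  (GradedTensorProduct.includeLeft (gr V) (gr V)).toLinearMap ∘ₗ ι V +
    (GradedTensorProduct.includeRight (gr V) (gr V)).toLinearMap ∘ₗ ι V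

theorem units_smul_eq {M : Type*} [AddCommGroup M] [Module ℚ M] (n : ℤ) (x : M) :
    (-1 : ℤˣ) ^ n • x = (-1 : ℚ) ^ n • x := by
  rcases Int.even_or_odd n with h | h
  · rw [h.neg_one_zpow, h.neg_one_zpow, one_smul, one_smul]
  · rw [h.neg_one_zpow, h.neg_one_zpow, Units.neg_smul, one_smul, neg_smul, one_smul]

theorem primitive_mul (i j : ℤ) (v : V) (hv : v ∈ V.gr i) (w : V) (hw : w ∈ V.gr j) :
    primitive V v * primitive V w =
      (((ι V v * ι V w) ᵍ⊗ₜ[ℚ] (1 : Lam V) : gr V ᵍ⊗[ℚ] gr V)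
        + (-1 : ℚ) ^ (i * j) • (ι V w ᵍ⊗ₜ[ℚ] ι V v : gr V ᵍ⊗[ℚ] gr V))
        + ((ι V v ᵍ⊗ₜ[ℚ] ι V w : gr V ᵍ⊗[ℚ] gr V)
        + ((1 : Lam V) ᵍ⊗ₜ[ℚ] (ι V v * ι V w) : gr V ᵍ⊗[ℚ] gr V)) := by
  have h1 := GradedTensorProduct.tmul_one_mul_coe_tmul (R := ℚ) (gr V) (gr V) (ι V v)
    ⟨ι V w, ι_mem_gr hw⟩ 1
  have h2 := GradedTensorProduct.tmul_one_mul_one_tmul (R := ℚ) (gr V) (gr V) (ι V v) (ι V w)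
  have h3 := GradedTensorProduct.tmul_coe_mul_coe_tmul (R := ℚ) (gr V) (gr V) 1
    ⟨ι V v, ι_mem_gr hv⟩ ⟨ι V w, ι_mem_gr hw⟩ 1
  have h4 := GradedTensorProduct.tmul_coe_mul_one_tmul (R := ℚ) (gr V) (gr V) 1
    ⟨ι V v, ι_mem_gr hv⟩ (ι V w)
  rw [one_mul, mul_one] at h3
  have h3' := h3.trans (units_smul_eq (i * j) _)
  have hp : ∀ x : V, primitive V x = (ι V x ᵍ⊗ₜ[ℚ] (1 : Lam V) : gr V ᵍ⊗[ℚ] gr V) +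
    ((1 : Lam V) ᵍ⊗ₜ[ℚ] ι V x : gr V ᵍ⊗[ℚ] gr V) := fun _ => rfl
  rw [hp, hp, mul_add, add_mul, add_mul]
  exact congrArg₂ (· + ·) (congrArg₂ (· + ·) h1 h3') (congrArg₂ (· + ·) h2 h4)

theorem primitive_comm (i j : ℤ) (v : V) (hv : v ∈ V.gr i) (w : V) (hw : w ∈ V.gr j) :
    primitive V v * primitive V w = (-1 : ℚ) ^ (i * j) • (primitive V w * primitive V v) := by
  have h : (-1 : ℚ) ^ (i * j) * (-1 : ℚ) ^ (i * j) = 1 := by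
    rw [← mul_zpow]; simp
  have hl : ∀ (c : ℚ) (x y : Lam V), ((c • x) ᵍ⊗ₜ[ℚ] y : gr V ᵍ⊗[ℚ] gr V) =
      c • (x ᵍ⊗ₜ[ℚ] y : gr V ᵍ⊗[ℚ] gr V) := fun c x y => rfl
  have hr : ∀ (c : ℚ) (x y : Lam V), (x ᵍ⊗ₜ[ℚ] (c • y) : gr V ᵍ⊗[ℚ] gr V) =
      c • (x ᵍ⊗ₜ[ℚ] y : gr V ᵍ⊗[ℚ] gr V) := fun c x y => TensorProduct.tmul_smul c x y
  rw [primitive_mul V i j v hv w hw, primitive_mul V j i w hw v hv, ι_mul_ι hv hw, mul_comm j i,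
    hl, hr]
  generalize (-1 : ℚ) ^ (i * j) = c at h ⊢
  simp only [smul_add, smul_smul, h, one_smul]
  ac_rfl

/-- The coproduct `Δ : ΛV → ΛV ⊗ ΛV` : the unique morphism of graded algebras (with the Koszul
sign rule on the target) for which the elements of `V` are primitive. -/
noncomputable def comulAlgHom : Lam V →ₐ[ℚ] gr V ᵍ⊗[ℚ] gr V :=
  lift (primitive V) (primitive_comm V)

/-- The coproduct of `ΛV`, as a linear map. -/
noncomputable def comul : Lam V →ₗ[ℚ] Lam V ⊗[ℚ] Lam V :=
  (GradedTensorProduct.of ℚ (gr V) (gr V)).symm.toLinearMap ∘ₗ (comulAlgHom V).toLinearMap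

/-- The counit (augmentation) `ΛV → ℚ`, which kills words of positive length. -/
noncomputable def counit : Lam V →ₐ[ℚ] ℚ := lift 0 (by simp)

end Lam

end Lam

/-! ### Linear maps out of `ΛV` given by graded-symmetric multilinear maps -/

section Descend

variable (V : GradedSpace.{u})

theorem span_words : (⊤ : Submodule ℚ (TensorAlgebra ℚ V)) ≤
    Submodule.span ℚ {x | ∃ l : List (Σ i : ℤ, V.gr i),
      x = (l.map fun a => TensorAlgebra.ι ℚ (a.2 : V)).prod} := by
  rintro x -
  induction x using TensorAlgebra.induction with
  | algebraMap r =>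
    rw [Algebra.algebraMap_eq_smul_one]
    exact Submodule.smul_mem _ _ (Submodule.subset_span ⟨[], by simp⟩)
  | ι v =>
    induction v using DirectSum.Decomposition.inductionOn V.gr with
    | zero => simp
    | add a b ha hb => rw [map_add]; exact Submodule.add_mem _ ha hb
    | @homogeneous i a => exact Submodule.subset_span ⟨[⟨i, a⟩], by simp⟩
  | add a b ha hb => exact Submodule.add_mem _ ha hb
  | mul a b ha hb =>
    have := Submodule.mul_mem_mul ha hb
    rw [Submodule.span_mul_span] at this
    refine Submodule.span_mono ?_ this
    rintro _ ⟨_, ⟨l, rfl⟩, _, ⟨m, rfl⟩, rfl⟩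
    exact ⟨l ++ m, by simp⟩

variable {V} {W : Type*} [AddCommGroup W] [Module ℚ W]

/-- Graded symmetry of a `k`-linear map, on adjacent transpositions of homogeneous arguments:
`m(…, x_b, x_a, …) = (-1)^(|x_a||x_b|) m(…, x_a, x_b, …)` for `b = a + 1`. -/
def GradedSymm {k : ℕ} (m : MultilinearMap ℚ (fun _ : Fin k => V) W) : Prop :=
  ∀ (d : Fin k → ℤ) (x : Fin k → V), (∀ i, x i ∈ V.gr (d i)) →
    ∀ a b : Fin k, (a : ℕ) + 1 = b →
      m (fun i => x (Equiv.swap a b i)) = (-1 : ℚ) ^ (d a * d b) • m x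

/-- The linear map `T(V) → W` given by a family of multilinear maps. -/
noncomputable def evalTensor (m : ∀ k : ℕ, MultilinearMap ℚ (fun _ : Fin k => V) W) :
    TensorAlgebra ℚ V →ₗ[ℚ] W :=
  DirectSum.toModule ℚ ℕ W (fun k => PiTensorProduct.lift (m k)) ∘ₗ
    TensorAlgebra.toDirectSum.toLinearMap

theorem evalTensor_prod (m : ∀ k : ℕ, MultilinearMap ℚ (fun _ : Fin k => V) W) {k : ℕ}
    (x : Fin k → V) :
    evalTensor m (List.ofFn fun i => TensorAlgebra.ι ℚ (x i)).prod = m k x := by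
  rw [← TensorAlgebra.tprod_apply, evalTensor, LinearMap.comp_apply, AlgHom.toLinearMap_apply,
    TensorAlgebra.toDirectSum_tensorPower_tprod, ← DirectSum.lof_eq_of ℚ, DirectSum.toModule_lof,
    PiTensorProduct.lift.tprod]

theorem ofFn_swap {α : Type*} (l₁ l₂ : List α) (v w : α)
    (a b : Fin (l₁ ++ v :: w :: l₂).length) (ha : (a : ℕ) = l₁.length)
    (hb : (b : ℕ) = l₁.length + 1) :
    List.ofFn (fun i => (l₁ ++ v :: w :: l₂).get (Equiv.swap a b i)) = l₁ ++ w :: v :: l₂ := by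
  apply List.ext_getElem
  · simp; omega
  · intro n h1 h2
    rw [List.getElem_ofFn, List.get_eq_getElem, Equiv.swap_apply_def]
    by_cases e1 : n = l₁.length
    · rw [if_pos (Fin.ext (by simp [e1, ha]))]
      simp [hb, e1]
    · rw [if_neg (fun h => e1 (by rw [← ha, ← h]))]
      by_cases e2 : n = l₁.length + 1
      · rw [if_pos (Fin.ext (by simp [e2, hb]))]
        simp [ha, e2]
      · rw [if_neg (fun h => e2 (by rw [← hb, ← h]))]
        by_cases e3 : n < l₁.length
        · simp [List.getElem_append_left, e3]
        · obtain ⟨k, rfl⟩ : ∃ k, n = l₁.length + (k + 2) := ⟨n - l₁.length - 2, by omega⟩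
          simp

theorem evalTensor_relation (m : ∀ k : ℕ, MultilinearMap ℚ (fun _ : Fin k => V) W)
    (hm : ∀ k, GradedSymm (m k)) (l₁ l₂ : List (Σ i : ℤ, V.gr i)) (v w : Σ i : ℤ, V.gr i) :
    evalTensor m ((l₁ ++ w :: v :: l₂).map fun a => TensorAlgebra.ι ℚ (a.2 : V)).prod =
    (-1 : ℚ) ^ (v.1 * w.1) •
      evalTensor m ((l₁ ++ v :: w :: l₂).map fun a => TensorAlgebra.ι ℚ (a.2 : V)).prod := by
  let l := l₁ ++ v :: w :: l₂
  have hl : l.length = l₁.length + (l₂.length + 2) := by simp [l]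
  let a : Fin l.length := ⟨l₁.length, by omega⟩
  let b : Fin l.length := ⟨l₁.length + 1, by omega⟩
  have h := hm l.length (fun i => (l.get i).1) (fun i => ((l.get i).2 : V))
    (fun i => (l.get i).2.2) a b rfl
  have e1 : l = List.ofFn l.get := (List.ofFn_get l).symm
  have ha : l.get a = v := by simp [l, a]
  have hb : l.get b = w := by simp [l, b]
  rw [ha, hb] at h
  rw [← ofFn_swap l₁ l₂ v w a b rfl rfl]
  change _ = _ • evalTensor m ((l.map _).prod)
  conv_rhs => rw [e1]
  rw [List.map_ofFn, List.map_ofFn]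
  exact (evalTensor_prod m _).trans (h.trans (congrArg _ (evalTensor_prod m _).symm))

theorem evalTensor_relIdeal (m : ∀ k : ℕ, MultilinearMap ℚ (fun _ : Fin k => V) W)
    (hm : ∀ k, GradedSymm (m k)) (x : TensorAlgebra ℚ V) (hx : x ∈ relIdeal V) :
    evalTensor m x = 0 := by
  have key : ∀ i j : ℤ, ∀ v ∈ V.gr i, ∀ w ∈ V.gr j, ∀ p q : TensorAlgebra ℚ V,
      evalTensor m (p * (TensorAlgebra.ι ℚ v * TensorAlgebra.ι ℚ w
        - (-1 : ℚ) ^ (i * j) • (TensorAlgebra.ι ℚ w * TensorAlgebra.ι ℚ v)) * q) = 0 := by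
    intro i j v hv w hw p q
    have hp := span_words V (Submodule.mem_top (x := p))
    have hq := span_words V (Submodule.mem_top (x := q))
    induction hp using Submodule.span_induction with
    | zero => simp
    | add p p' _ _ h h' => rw [add_mul, add_mul, map_add, h, h', add_zero]
    | smul c p _ h => rw [smul_mul_assoc, smul_mul_assoc, map_smul, h, smul_zero]
    | mem p hp =>
      induction hq using Submodule.span_induction with
      | zero => simp
      | add q q' _ _ h h' => rw [mul_add, map_add, h, h', add_zero]
      | smul c q _ h => rw [mul_smul_comm, map_smul, h, smul_zero]
      | mem q hq =>
        obtain ⟨l₁, rfl⟩ := hp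
        obtain ⟨l₂, rfl⟩ := hq
        have h := evalTensor_relation m hm l₁ l₂ ⟨j, w, hw⟩ ⟨i, v, hv⟩
        simp only [List.map_append, List.map_cons, List.prod_append, List.prod_cons] at h
        simp only [mul_sub, sub_mul, map_sub, mul_smul_comm, smul_mul_assoc, map_smul, mul_assoc]
        rw [h, mul_comm j i, sub_self]
  have hx' := TwoSidedIdeal.mem_span_iff_mem_addSubgroup_closure.1 (TwoSidedIdeal.mem_asIdeal.1 hx)
  clear hx
  induction hx' using AddSubgroup.closure_induction with
  | zero => simp
  | add x y _ _ hx hy => rw [map_add, hx, hy, add_zero]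
  | neg x _ hx => rw [map_neg, hx, neg_zero]
  | mem x h =>
    obtain ⟨_, ⟨p, -, _, ⟨i, j, v, hv, w, hw, rfl⟩, rfl⟩, q, -, rfl⟩ := h
    exact key i j v hv w hw p q

/-- The linear map `ΛV → W` given on words by a family of graded-symmetric multilinear maps:
`v₁ ∧ ⋯ ∧ vₖ ↦ mₖ(v₁, …, vₖ)`. -/
noncomputable def Lam.descend (m : ∀ k : ℕ, MultilinearMap ℚ (fun _ : Fin k => V) W)
    (hm : ∀ k, GradedSymm (m k)) : Lam V →ₗ[ℚ] W :=
  Submodule.liftQ ((relIdeal V).restrictScalars ℚ) (evalTensor m) (evalTensor_relIdeal m hm)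

theorem Lam.descend_prod (m : ∀ k : ℕ, MultilinearMap ℚ (fun _ : Fin k => V) W)
    (hm : ∀ k, GradedSymm (m k)) {k : ℕ} (x : Fin k → V) :
    Lam.descend m hm (List.ofFn fun i => Lam.ι V (x i)).prod = m k x := by
  have : (List.ofFn fun i => Lam.ι V (x i)).prod =
      Lam.mk V (List.ofFn fun i => TensorAlgebra.ι ℚ (x i)).prod := by
    rw [map_list_prod, List.map_ofFn]; rfl
  rw [this, ← evalTensor_prod m x]
  rfl

end Descend

/-! ### `L∞` algebras -/

/-- The Koszul sign `ε(σ)` of a permutation of homogeneous elements of degrees `d`, determined by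
`x₁ ∧ ⋯ ∧ xₙ = ε(σ) x_{σ(1)} ∧ ⋯ ∧ x_{σ(n)}` in the free graded-commutative algebra: each inversion
contributes `(-1)^(product of the degrees)`. -/
def koszulSign {n : ℕ} (d : Fin n → ℤ) (σ : Equiv.Perm (Fin n)) : ℚ :=
  ∏ a : Fin n, ∏ b : Fin n, if a < b ∧ σ b < σ a then (-1 : ℚ) ^ (d (σ a) * d (σ b)) else 1

/-- The signature of a permutation, as a rational number. -/
def sgn {n : ℕ} (σ : Equiv.Perm (Fin n)) : ℚ := ((Equiv.Perm.sign σ : ℤ) : ℚ)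

/-- `σ ∈ S(i, n - i)`: `σ` is increasing on the first `i` and on the last `n - i` positions. -/
def IsShuffle {n : ℕ} (i : ℕ) (σ : Equiv.Perm (Fin n)) : Prop :=
  ∀ a b : Fin n, a < b → ((b : ℕ) < i ∨ i ≤ (a : ℕ)) → σ a < σ b

instance {n : ℕ} (i : ℕ) : DecidablePred (IsShuffle (n := n) i) := fun σ =>
  inferInstanceAs (Decidable (∀ a b : Fin n, a < b → ((b : ℕ) < i ∨ i ≤ (a : ℕ)) → σ a < σ b))

/-- An `L∞` structure on the graded vector space `V`: brackets `ℓₖ`, `k ≥ 1`, of degree `k - 2`,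
skew-symmetric in the graded sense and satisfying the generalized Jacobi identities. There is no
bracket with zero inputs; this is encoded by `ℓ 0 = 0`. -/
structure LInfinityStructure (V : GradedSpace.{u}) where
  ℓ : ∀ k : ℕ, MultilinearMap ℚ (fun _ : Fin k => V) V
  ℓ_zero : ℓ 0 = 0
  degree : ∀ (k : ℕ) (d : Fin k → ℤ) (x : Fin k → V), (∀ a, x a ∈ V.gr (d a)) →
    ℓ k x ∈ V.gr (∑ a, d a + k - 2)
  skew : ∀ (k : ℕ) (d : Fin k → ℤ) (x : Fin k → V), (∀ a, x a ∈ V.gr (d a)) →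
    ∀ σ : Equiv.Perm (Fin k), ℓ k (fun a => x (σ a)) = (koszulSign d σ * sgn σ) • ℓ k x
  /-- Here the inner bracket has `i + 1` inputs (`i = 0, …, n - 1`) and the outer one
  `(n - (i + 1)) + 1` inputs. -/
  jacobi : ∀ (n : ℕ), 1 ≤ n → ∀ (d : Fin n → ℤ) (x : Fin n → V), (∀ a, x a ∈ V.gr (d a)) →
    ∑ i : Fin n, ∑ σ : Equiv.Perm (Fin n) with IsShuffle (i + 1) σ,
      (koszulSign d σ * sgn σ * (-1 : ℚ) ^ (((i : ℕ) + 1) * (n - ((i : ℕ) + 1)))) •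
        ℓ (n - ((i : ℕ) + 1) + 1)
          (Fin.cons (ℓ ((i : ℕ) + 1) fun a => x (σ (Fin.castLE i.isLt a)))
            (fun b : Fin (n - ((i : ℕ) + 1)) => x (σ ⟨(i : ℕ) + 1 + b, by omega⟩)) :
              Fin (n - ((i : ℕ) + 1) + 1) → V) = 0

namespace LInfinityStructure

variable {V : GradedSpace.{u}} (L : LInfinityStructure V)

/-- The differential `∂ = ℓ₁`. -/
noncomputable def diff : V →ₗ[ℚ] V := (MultilinearMap.ofSubsingleton ℚ V V (0 : Fin 1)).symm (L.ℓ 1)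

theorem diff_apply (x : V) : L.diff x = L.ℓ 1 (fun _ => x) := rfl

theorem diff_mem (n : ℤ) (x : V) (hx : x ∈ V.gr n) : L.diff x ∈ V.gr (n - 1) := by
  have h := L.degree 1 (fun _ => n) (fun _ => x) (fun _ => hx)
  rw [diff_apply]
  convert h using 2
  simp
  ring

/-- The homology `H_*(L) = H_*(L, ℓ₁)`. -/
noncomputable def homology : GradedSpace.{u} := V.homology L.diff L.diff_mem

/-- The class in `H_*(L)` of a cycle. -/
noncomputable def homologyClass : LinearMap.ker L.diff →ₗ[ℚ] L.homology :=
  ((LinearMap.range L.diff).submoduleOf (LinearMap.ker L.diff)).mkQ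

/-- `hₖ = (-1)^(k(k-1)/2) s ∘ ℓₖ ∘ (s⁻¹)^{⊗k}`. By the Koszul rule `(s⁻¹)^{⊗k}` sends
`y₁ ⊗ ⋯ ⊗ yₖ` to `∏ᵢ (-1)^((k - i)|yᵢ|)` times `s⁻¹y₁ ⊗ ⋯ ⊗ s⁻¹yₖ`, because the `k - i` copies of `s⁻¹`
to the right of the `i`-th one move past `yᵢ`. -/
noncomputable def h (k : ℕ) : MultilinearMap ℚ (fun _ : Fin k => V.susp) V.susp :=
  (-1 : ℚ) ^ (k * (k - 1) / 2) • V.s.toLinearMap.compMultilinearMap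
    ((L.ℓ k).compLinearMap fun i : Fin k => V.s.symm.toLinearMap ∘ₗ V.susp.signOp ^ (k - 1 - (i : ℕ)))

theorem koszulSign_swap {k : ℕ} (d : Fin k → ℤ) (a b : Fin k) (hab : (a : ℕ) + 1 = b) :
    koszulSign d (Equiv.swap a b) = (-1 : ℚ) ^ (d a * d b) := by
  have hlt : a < b := by rw [Fin.lt_def]; omega
  have key : ∀ i j : Fin k, (i < j ∧ Equiv.swap a b j < Equiv.swap a b i) ↔ (i = a ∧ j = b) := by
    intro i j
    constructor
    · rintro ⟨h1, h2⟩
      rw [Equiv.swap_apply_def, Equiv.swap_apply_def] at h2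
      split_ifs at h2 <;> simp only [Fin.lt_def, Fin.ext_iff] at * <;> omega
    · rintro ⟨rfl, rfl⟩
      rw [Equiv.swap_apply_left, Equiv.swap_apply_right]
      exact ⟨hlt, hlt⟩
  unfold koszulSign
  simp only [key]
  rw [Finset.prod_eq_single a, Finset.prod_eq_single b]
  · simp [mul_comm]
  · intro j _ hj; simp [hj]
  · simp
  · intro i _ hi; simp [hi]
  · simp

theorem signOp_pow_of_mem {i : ℤ} {v : V} (hv : v ∈ V.gr i) (n : ℕ) :
    (V.signOp ^ n) v = ((-1 : ℚ) ^ i) ^ n • v := by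
  induction n with
  | zero => simp
  | succ n ih =>
    rw [pow_succ', Module.End.mul_apply, ih, map_smul, V.signOp_of_mem hv, smul_smul, pow_succ]

theorem h_apply {k : ℕ} (d : Fin k → ℤ) (x : Fin k → V.susp) (hx : ∀ i, x i ∈ V.susp.gr (d i)) :
    L.h k x = (-1 : ℚ) ^ (k * (k - 1) / 2) • (∏ i, ((-1 : ℚ) ^ d i) ^ (k - 1 - (i : ℕ))) •
      V.s (L.ℓ k fun i => V.s.symm (x i)) := by
  have h1 : ∀ i : Fin k, (V.s.symm.toLinearMap ∘ₗ V.susp.signOp ^ (k - 1 - (i : ℕ))) (x i) =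
      ((-1 : ℚ) ^ d i) ^ (k - 1 - (i : ℕ)) • V.s.symm (x i) := fun i => by
    rw [LinearMap.comp_apply, signOp_pow_of_mem (hx i), map_smul]; rfl
  unfold h
  rw [smul_apply, LinearMap.compMultilinearMap_apply,
    MultilinearMap.compLinearMap_apply]
  simp only [h1]
  rw [MultilinearMap.map_smul_univ, map_smul]
  rfl

theorem h_gradedSymm (k : ℕ) : GradedSymm (L.h k) := by
  intro d x hx a b hab
  have hne : a ≠ b := by intro h; rw [h] at hab; omega
  rw [L.h_apply d x hx, L.h_apply (fun i => d (Equiv.swap a b i)) _ (fun i => hx _),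
    L.skew k (fun i => d i - 1) (fun i => V.s.symm (x i)) hx (Equiv.swap a b),
    koszulSign_swap _ a b hab]
  have hs : sgn (Equiv.swap a b) = -1 := by simp [sgn, Equiv.Perm.sign_swap hne]
  have hu : ∀ i, (-1 : ℚ) ^ d i * (-1 : ℚ) ^ d i = 1 := fun i => by rw [← mul_zpow]; simp
  have hprod : ∏ i, ((-1 : ℚ) ^ d (Equiv.swap a b i)) ^ (k - 1 - (i : ℕ)) =
      (-1 : ℚ) ^ d a * (-1 : ℚ) ^ d b * ∏ i, ((-1 : ℚ) ^ d i) ^ (k - 1 - (i : ℕ)) := by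
    rw [← Equiv.prod_comp (Equiv.swap a b)]
    simp only [Equiv.swap_apply_self]
    have hg : (-1 : ℚ) ^ d a * (-1 : ℚ) ^ d b =
        ∏ i, ((if i = a then (-1 : ℚ) ^ d a else 1) * (if i = b then (-1 : ℚ) ^ d b else 1)) := by
      rw [Finset.prod_mul_distrib]; simp
    rw [hg, ← Finset.prod_mul_distrib]
    refine Finset.prod_congr rfl fun i _ => ?_
    have hb := b.2
    by_cases hia : i = a
    · subst hia
      rw [Equiv.swap_apply_left, if_pos rfl, if_neg hne, mul_one,
        show k - 1 - (i : ℕ) = (k - 1 - (b : ℕ)) + 1 by omega, pow_succ', ← mul_assoc, hu, one_mul]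
    · by_cases hib : i = b
      · subst hib
        rw [Equiv.swap_apply_right, if_neg hia, if_pos rfl, one_mul,
          show k - 1 - (a : ℕ) = (k - 1 - (i : ℕ)) + 1 by omega, pow_succ']
      · rw [Equiv.swap_apply_of_ne_of_ne hia hib, if_neg hia, if_neg hib, one_mul, one_mul]
  have hsign : (-1 : ℚ) ^ d a * (-1 : ℚ) ^ d b * ((-1 : ℚ) ^ ((d a - 1) * (d b - 1)) * -1) =
      (-1 : ℚ) ^ (d a * d b) := by
    have h1 : (d a - 1) * (d b - 1) = d a * d b - d a - d b + 1 := by ring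
    have hz : (-1 : ℚ) ≠ 0 := by norm_num
    rw [h1, zpow_add₀ hz, zpow_sub₀ hz, zpow_sub₀ hz]
    have := hu a
    have := hu b
    field_simp
  rw [hs, hprod, map_smul, ← hsign]
  simp only [smul_smul]
  congr 1
  ring

end LInfinityStructure

/-! ### The Quillen chains -/

namespace Lam

variable {V : GradedSpace.{u}}

theorem gradedSymm_single (m : ∀ k : ℕ, MultilinearMap ℚ (fun _ : Fin k => V) V)
    (hm : ∀ k, GradedSymm (m k)) (k j : ℕ) : GradedSymm (if j = k then m j else 0) := by
  split_ifs
  · exact hm j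
  · intro d x _ a b _
    simp

/-- The extension of a linear map `f : ΛV → V` to `ΛV → ΛV`, `x ↦ ∑ f(x₍₁₎) ∧ x₍₂₎`. On words,
`v₁ ∧ ⋯ ∧ vₚ ↦ ∑ ε f(v_{i₁} ∧ ⋯ ∧ v_{iₖ}) ∧ v₁ ∧ ⋯ v̂_{i₁} ⋯ v̂_{iₖ} ⋯ ∧ vₚ`, the sum being over all
subsets of the letters; this is the extension of `f` as a coderivation when `f` is homogeneous. -/
noncomputable def coderivation (f : Lam V →ₗ[ℚ] V) : Lam V →ₗ[ℚ] Lam V :=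
  LinearMap.mul' ℚ (Lam V) ∘ₗ TensorProduct.map (ι V ∘ₗ f) LinearMap.id ∘ₗ comul V

variable (V)

/-- The family of multilinear maps with the identity of `V` for `k = 1` and `0` for `k ≠ 1`. -/
noncomputable def idFamily : ∀ k : ℕ, MultilinearMap ℚ (fun _ : Fin k => V) V
  | 1 => MultilinearMap.ofSubsingleton ℚ V V (0 : Fin 1) LinearMap.id
  | _ => 0

theorem idFamily_gradedSymm : ∀ k, GradedSymm (idFamily V k)
  | 0 => fun _ _ _ a => a.elim0
  | 1 => fun _ _ _ a b h => by omega
  | _ + 2 => fun _ _ _ _ _ _ => by simp [idFamily]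

/-- The projection `π : ΛV → V` onto the words of length one. -/
noncomputable def proj : Lam V →ₗ[ℚ] V := descend (idFamily V) (idFamily_gradedSymm V)

/-- `ΛᵖV`, the span of the words of length `p` (zero for negative `p`). -/
noncomputable def word (p : ℤ) : Submodule ℚ (Lam V) :=
  if 0 ≤ p then LinearMap.range (ι V) ^ p.toNat else ⊥

/-- The projection of `ΛV` onto the coaugmentation kernel, `x ↦ x - ε(x) 1`. -/
noncomputable def toCoaugKer : Lam V →ₗ[ℚ] Lam V :=
  LinearMap.id - (Algebra.linearMap ℚ (Lam V)) ∘ₗ (counit V).toLinearMap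

/-- The reduced diagonal, `x ↦ Δ x - (1 ⊗ x + x ⊗ 1)` for `x` in the coaugmentation kernel,
extended by `0` on `1`. -/
noncomputable def reducedComul : Lam V →ₗ[ℚ] Lam V ⊗[ℚ] Lam V :=
  (comul V - (TensorProduct.mk ℚ (Lam V) (Lam V) 1 + (TensorProduct.mk ℚ (Lam V) (Lam V)).flip 1))
    ∘ₗ toCoaugKer V

/-- The iterated reduced diagonals `Δⁿ : C → C^{⊗(n+1)}` of `C = ΛV`: `Δ⁰` is the identity of the
coaugmentation kernel (extended by `0` on `1`), and `Δⁿ⁺¹ = (Δⁿ ⊗ id) ∘ Δ̄`. The tensor power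
`C^{⊗(n+1)}` is the component of degree `n + 1` of the tensor algebra `T(C)`. -/
noncomputable def iterComul : ℕ → Lam V →ₗ[ℚ] TensorAlgebra ℚ (Lam V)
  | 0 => TensorAlgebra.ι ℚ ∘ₗ toCoaugKer V
  | n + 1 => LinearMap.mul' ℚ _ ∘ₗ
      TensorProduct.map (iterComul n) (TensorAlgebra.ι ℚ) ∘ₗ reducedComul V

/-- The increasing filtration `F_p = ℚ·1 ⊕ ker Δᵖ = Λ^{≤p}V` (zero for negative `p`). -/
noncomputable def filtration (p : ℤ) : Submodule ℚ (Lam V) :=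
  if 0 ≤ p then LinearMap.ker (iterComul V p.toNat) else ⊥

end Lam

namespace LInfinityStructure

variable {V : GradedSpace.{u}} (L : LInfinityStructure V)

/-- The differential `δ` of the Quillen chains `𝒞(L) = (ΛsL, δ)`, the coderivation extending all
the `hₖ` simultaneously. -/
noncomputable def δ : Lam V.susp →ₗ[ℚ] Lam V.susp :=
  Lam.coderivation (Lam.descend L.h L.h_gradedSymm)

/-- The summand `δₖ` of `δ`: the coderivation extending `hₖ`. -/
noncomputable def δPart (k : ℕ) : Lam V.susp →ₗ[ℚ] Lam V.susp :=
  Lam.coderivation (Lam.descend (fun j => if j = k then L.h j else 0)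
    (Lam.gradedSymm_single L.h L.h_gradedSymm k))

end LInfinityStructure

/-! ### The spectral sequence of a filtered complex -/

section SpectralSequence

variable {C : Type u} [AddCommGroup C] [Module ℚ C] (δ : C →ₗ[ℚ] C) (F : ℤ → Submodule ℚ C)

/-- `(C, δ)` is a differential module with increasing filtration `F` by differential submodules. -/
structure IsFilteredComplex : Prop where
  sq_zero : δ ∘ₗ δ = 0
  mono : Monotone F
  map_le : ∀ p, (F p).map δ ≤ F p

/-- `Zʳ_p = F_p ∩ δ⁻¹(F_{p-r})`. -/
def cyc (r p : ℤ) : Submodule ℚ C := F p ⊓ (F (p - r)).comap δ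

/-- `Dʳ_p = F_p ∩ δ(F_{p+r})`. -/
def bdry (r p : ℤ) : Submodule ℚ C := F p ⊓ (F (p + r)).map δ

/-- The denominator `Zʳ⁻¹_{p-1} + Dʳ⁻¹_p` of the page `Eʳ_p`. -/
def den (r p : ℤ) : Submodule ℚ C := cyc δ F (r - 1) (p - 1) ⊔ bdry δ F (r - 1) p

/-- `Eʳ_p = Zʳ_p / (Zʳ⁻¹_{p-1} + Dʳ⁻¹_p)`. -/
abbrev Page (r p : ℤ) : Type u := cyc δ F r p ⧸ (den δ F r p).submoduleOf (cyc δ F r p)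

/-- The class in `Eʳ_p` of an element of `Zʳ_p`. -/
def pageMk (r p : ℤ) : cyc δ F r p →ₗ[ℚ] Page δ F r p :=
  ((den δ F r p).submoduleOf (cyc δ F r p)).mkQ

variable {δ F}

theorem map_cyc (hδ : IsFilteredComplex δ F) (r p : ℤ) :
    ∀ x ∈ cyc δ F r p, δ x ∈ cyc δ F r (p - r) := by
  rintro x ⟨-, h⟩
  refine ⟨h, ?_⟩
  have : δ (δ x) = 0 := LinearMap.congr_fun hδ.sq_zero x
  change δ (δ x) ∈ F (p - r - r)
  rw [this]
  exact Submodule.zero_mem _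

theorem map_den (hδ : IsFilteredComplex δ F) (r p : ℤ) :
    ∀ x ∈ den δ F r p, δ x ∈ den δ F r (p - r) := by
  intro x hx
  obtain ⟨y, ⟨hy1, hy2⟩, z, ⟨-, w, -, rfl⟩, rfl⟩ := Submodule.mem_sup.1 hx
  have : δ (δ w) = 0 := LinearMap.congr_fun hδ.sq_zero w
  rw [map_add, this, add_zero]
  refine Submodule.mem_sup_right ⟨?_, y, ?_, rfl⟩
  · have h : δ y ∈ F (p - 1 - (r - 1)) := hy2
    rwa [show p - 1 - (r - 1) = p - r by ring] at h
  · rw [show p - r + (r - 1) = p - 1 by ring]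
    exact hy1

/-- The differential `dʳ : Eʳ_p → Eʳ_{p-r}`, induced by `δ : Zʳ_p → Zʳ_{p-r}`. -/
def pageD (hδ : IsFilteredComplex δ F) (r p : ℤ) : Page δ F r p →ₗ[ℚ] Page δ F r (p - r) :=
  Submodule.mapQ _ _ (δ.restrict (map_cyc hδ r p)) fun x hx => map_den hδ r p x hx

/-- The spectral sequence collapses at `E^n`: all `dʳ` with `r ≥ n` vanish. -/
def CollapsesAt (hδ : IsFilteredComplex δ F) (n : ℤ) : Prop :=
  ∀ r : ℤ, n ≤ r → ∀ p : ℤ, pageD hδ r p = 0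

end SpectralSequence

/-! ### Formality -/

/-- An `L∞` algebra: a graded vector space with an `L∞` structure. -/
structure LInfinityAlgebra where
  space : GradedSpace.{u}
  str : LInfinityStructure space

namespace LInfinityAlgebra

/-- The underlying graded coalgebra `ΛsL` of the Quillen chains on `L`. -/
abbrev Chains (L : LInfinityAlgebra.{u}) : Type u := Lam L.space.susp

/-- The differential of the Quillen chains on `L`. -/
noncomputable abbrev δ (L : LInfinityAlgebra.{u}) : L.Chains →ₗ[ℚ] L.Chains := L.str.δ

/-- The filtration of the Quillen chains on `L`. -/
noncomputable abbrev F (L : LInfinityAlgebra.{u}) : ℤ → Submodule ℚ L.Chains :=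
  Lam.filtration L.space.susp

/-- `L = L_{≥0}`. -/
def Nonneg (L : LInfinityAlgebra.{u}) : Prop := ∀ n : ℤ, n < 0 → L.space.gr n = ⊥

/-- An `L∞` morphism `L → L'`, as a morphism of (coaugmented) differential graded coalgebras
`(ΛsL, δ) → (ΛsL', δ')`. -/
structure Hom (L L' : LInfinityAlgebra.{u}) where
  toLinearMap : L.Chains →ₗ[ℚ] L'.Chains
  map_gr : ∀ n, ∀ x ∈ Lam.gr L.space.susp n, toLinearMap x ∈ Lam.gr L'.space.susp n
  map_one : toLinearMap 1 = 1
  counit_comp : (Lam.counit L'.space.susp).toLinearMap ∘ₗ toLinearMap =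
    (Lam.counit L.space.susp).toLinearMap
  comul_comp : Lam.comul L'.space.susp ∘ₗ toLinearMap =
    TensorProduct.map toLinearMap toLinearMap ∘ₗ Lam.comul L.space.susp
  δ_comp : L'.δ ∘ₗ toLinearMap = toLinearMap ∘ₗ L.δ

namespace Hom

variable {L L' : LInfinityAlgebra.{u}} (f : Hom L L')

/-- The linear part `f₁ = s⁻¹ ∘ π f ∘ s : L → L'`. -/
noncomputable def linearPart : L.space →ₗ[ℚ] L'.space :=
  L'.space.s.symm.toLinearMap ∘ₗ Lam.proj L'.space.susp ∘ₗ f.toLinearMap ∘ₗ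
    Lam.ι L.space.susp ∘ₗ L.space.s.toLinearMap

/-- `f` is an `L∞` quasi-isomorphism: `f₁ : (L, ℓ₁) → (L', ℓ₁')` is a chain map which is injective
and surjective on homology. -/
def IsQuasiIso : Prop :=
  (∀ x, L'.str.diff (f.linearPart x) = f.linearPart (L.str.diff x)) ∧
  (∀ x, L.str.diff x = 0 → (∃ y', L'.str.diff y' = f.linearPart x) → ∃ y, L.str.diff y = x) ∧
  (∀ x', L'.str.diff x' = 0 →
    ∃ x, L.str.diff x = 0 ∧ ∃ y', f.linearPart x - x' = L'.str.diff y')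

end Hom

/-- Weak equivalence: the existence of a zig-zag of `L∞` quasi-isomorphisms. -/
def WeaklyEquivalent : LInfinityAlgebra.{u} → LInfinityAlgebra.{u} → Prop :=
  Relation.EqvGen fun L L' => ∃ f : Hom L L', f.IsQuasiIso

/-- `L` is formal: it is weakly equivalent to its homology, endowed with the `L∞` structure whose
only possibly nonzero bracket is the `ℓ₂` induced by the one of `L`, `ℓ₂([x], [y]) = [ℓ₂(x, y)]`. -/
def IsFormal (L : LInfinityAlgebra.{u}) : Prop :=
  ∃ M : LInfinityStructure L.str.homology,
    (∀ k : ℕ, k ≠ 2 → M.ℓ k = 0) ∧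
    (∀ x y : LinearMap.ker L.str.diff, ∃ z : LinearMap.ker L.str.diff,
      (z : L.space) = L.str.ℓ 2 ![(x : L.space), (y : L.space)] ∧
      M.ℓ 2 ![L.str.homologyClass x, L.str.homologyClass y] = L.str.homologyClass z) ∧
    WeaklyEquivalent L ⟨L.str.homology, M⟩

end LInfinityAlgebra

end Quillen

namespace Quillen

/-! ### Signs -/

/-! Everything rests on word length. Multiplying out the m-th iterated reduced diagonal scales words
of length n by the number of surjections onto a set with m + 1 elements, which is positive for n >
m. Hence F_p, defined through the coproduct, consists of the elements with no component of length
greater than p (`mem_filtration`), and Λ^p is a complement of F_{p-1} in F_p. A coderivation whose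
corestriction vanishes on words with fewer than m letters lowers the filtration by m - 1. If ℓ_j = 0
for j < k, then δ lowers it by k - 1 with leading part δ_k, so the pages up to E^{k-1} are the
associated graded of F, which is ΛsL, and d^{k-1} is δ_k (`exists_page_equiv`). This is part (2).

That δ² = 0 also has to be proved. The square of an odd coderivation is again a coderivation, so it
suffices that its corestriction hδ vanishes (`coderivation_sq`). Expanding δ on a word as a sum over
shuffles (`coderivation_ofFn`) turns hδ into the left side of the Jacobi identity times one global
sign (`hTotal_shuffleTerm`); the comparison of signs is the décalage formula `koszulSign_suspend`.

For part (1), an L∞ morphism preserves F because it preserves the coproduct, and on F_p/F_{p-1} =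
Λ^p it is Λ of its linear part, while δ acts there as δ₁. Over ℚ, Λ of a quasi-isomorphism is a
quasi-isomorphism (`map_quasiIso`): the homotopy extended as a derivation contracts everything
outside the homology after division by a letter count. So an L∞ quasi-isomorphism is an isomorphism
on E¹, and a five-lemma argument on the quotients F_p/F_q shows that it preserves and reflects the
vanishing of d^r for r ≥ 1 (`extendsCycles_iff`). A zig-zag therefore reduces the claim to an
algebra whose only bracket is ℓ₂. There δ lowers length by exactly one, so a word whose differential
drops by two or more is a cycle (`extendsCycles_of_binary`). -/

theorem negOne_zpow_mul_self (n : ℤ) : (-1 : ℚ) ^ n * (-1 : ℚ) ^ n = 1 := by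
  rw [← mul_zpow]; simp

theorem negOne_zpow_add (m n : ℤ) : (-1 : ℚ) ^ (m + n) = (-1 : ℚ) ^ m * (-1 : ℚ) ^ n :=
  zpow_add₀ (by norm_num) m n

/-- Induction on homogeneous elements of a graded space. -/
theorem GradedSpace.hom_induction (V : GradedSpace.{u}) {P : V → Prop} (zero : P 0)
    (add : ∀ x y, P x → P y → P (x + y)) (hom : ∀ i, ∀ x ∈ V.gr i, P x) (x : V) : P x := by
  induction x using DirectSum.Decomposition.inductionOn V.gr with
  | zero => exact zero
  | add a b ha hb => exact add _ _ ha hb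
  | @homogeneous i a => exact hom i a a.2

/-- The operator `v ↦ (-1)^(i|v|) v`. -/
noncomputable def GradedSpace.twist (V : GradedSpace.{u}) (i : ℤ) : V →ₗ[ℚ] V :=
  if Even i then LinearMap.id else V.signOp

theorem GradedSpace.twist_of_mem (V : GradedSpace.{u}) (i : ℤ) {n : ℤ} {v : V} (hv : v ∈ V.gr n) :
    V.twist i v = (-1 : ℚ) ^ (i * n) • v := by
  unfold GradedSpace.twist
  split_ifs with h
  · rw [zpow_mul, h.neg_one_zpow, one_zpow, one_smul]; rfl
  · rw [zpow_mul, (Int.not_even_iff_odd.1 h).neg_one_zpow, V.signOp_of_mem hv]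

namespace Lam

variable {V W : GradedSpace.{u}}

/-! ### Induction principles -/

/-- Induction on words. -/
theorem word_induction {P : Lam V → Prop} (add : ∀ x y, P x → P y → P (x + y))
    (smul : ∀ (c : ℚ) x, P x → P (c • x)) (one : P 1)
    (mul : ∀ i, ∀ v ∈ V.gr i, ∀ x, P x → P (ι V v * x)) (x : Lam V) : P x := by
  obtain ⟨x, rfl⟩ := mk_surjective V x
  have hx := span_words V (Submodule.mem_top (x := x))
  induction hx using Submodule.span_induction with
  | zero => simpa using smul 0 1 one
  | add x y _ _ hx hy => rw [map_add]; exact add _ _ hx hy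
  | smul c x _ hx => rw [map_smul]; exact smul _ _ hx
  | mem x hx =>
    obtain ⟨l, rfl⟩ := hx
    induction l with
    | nil => simpa using one
    | cons a l ih =>
      rw [List.map_cons, List.prod_cons, map_mul]
      exact mul a.1 a.2 a.2.2 _ ih

/-- Induction on words, keeping track of the degree. -/
theorem gr_induction {P : ℤ → Lam V → Prop} (zero : ∀ n, P n 0)
    (add : ∀ n x y, P n x → P n y → P n (x + y))
    (smul : ∀ n (c : ℚ) x, P n x → P n (c • x)) (one : P 0 1)
    (mul : ∀ i, ∀ v ∈ V.gr i, ∀ n, ∀ x ∈ gr V n, P n x → P (i + n) (ι V v * x))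
    {n : ℤ} {x : Lam V} (hx : x ∈ gr V n) : P n x := by
  have key : ∀ l : List (Σ i : ℤ, V.gr i),
      (l.map fun a => ι V (a.2 : V)).prod ∈ gr V (l.map Sigma.fst).sum ∧
      P (l.map Sigma.fst).sum (l.map fun a => ι V (a.2 : V)).prod := by
    intro l
    refine ⟨Submodule.subset_span ⟨l, rfl, rfl⟩, ?_⟩
    induction l with
    | nil => simpa using one
    | cons a l ih =>
      simp only [List.map_cons, List.prod_cons, List.sum_cons]
      exact mul _ _ a.2.2 _ _ (Submodule.subset_span ⟨l, rfl, rfl⟩) ih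
  induction hx using Submodule.span_induction with
  | zero => exact zero _
  | add x y _ _ hx hy => exact add _ _ _ hx hy
  | smul c x _ hx => exact smul _ _ _ hx
  | mem x hx =>
    obtain ⟨l, rfl, rfl⟩ := hx
    exact (key l).2

variable (V) in
/-- The span of the words of length `n`. -/
noncomputable def wordLen (n : ℕ) : Submodule ℚ (Lam V) := LinearMap.range (ι V) ^ n

theorem word_natCast (n : ℕ) : word V n = wordLen V n := by
  simp [word, wordLen]

theorem word_of_neg {p : ℤ} (hp : p < 0) : word V p = ⊥ := by
  simp [word, hp]

theorem one_mem_wordLen : (1 : Lam V) ∈ wordLen V 0 := by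
  rw [wordLen, pow_zero]; exact Submodule.one_le.1 le_rfl

theorem ι_mul_mem_wordLen (v : V) {n : ℕ} {x : Lam V} (hx : x ∈ wordLen V n) :
    ι V v * x ∈ wordLen V (n + 1) := by
  rw [wordLen, pow_succ']
  exact Submodule.mul_mem_mul ⟨v, rfl⟩ hx

theorem ι_mem_wordLen (v : V) : ι V v ∈ wordLen V 1 := by
  simpa using ι_mul_mem_wordLen v one_mem_wordLen

/-- Induction on words, keeping track of the length. -/
theorem wordLen_induction {P : ℕ → Lam V → Prop} (add : ∀ n x y, P n x → P n y → P n (x + y))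
    (smul : ∀ n (c : ℚ) x, P n x → P n (c • x)) (one : P 0 1)
    (mul : ∀ i, ∀ v ∈ V.gr i, ∀ n, ∀ x ∈ wordLen V n, P n x → P (n + 1) (ι V v * x))
    {n : ℕ} {x : Lam V} (hx : x ∈ wordLen V n) : P n x := by
  induction hx using Submodule.pow_induction_on_left' with
  | algebraMap r => rw [Algebra.algebraMap_eq_smul_one]; exact smul _ _ _ one
  | add x y i _ _ hx hy => exact add _ _ _ hx hy
  | mem_mul m hm i x hx ih =>
    obtain ⟨v, rfl⟩ := hm
    induction v using V.hom_induction with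
    | zero =>
      rw [map_zero, zero_mul]
      simpa using smul _ 0 _ (mul 0 0 (Submodule.zero_mem _) i x hx ih)
    | add a b ha hb => rw [map_add, add_mul]; exact add _ _ _ ha hb
    | hom j v hv => exact mul j v hv i x hx ih

theorem linearMap_ext {M : Type*} [AddCommGroup M] [Module ℚ M] {f g : Lam V →ₗ[ℚ] M}
    (one : f 1 = g 1)
    (mul : ∀ i, ∀ v ∈ V.gr i, ∀ x, f x = g x → f (ι V v * x) = g (ι V v * x)) : f = g := by
  ext x
  induction x using word_induction with
  | add x y hx hy => rw [map_add, map_add, hx, hy]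
  | smul c x hx => rw [map_smul, map_smul, hx]
  | one => exact one
  | mul i v hv x hx => exact mul i v hv x hx

/-! ### Functoriality -/

/-- The algebra map `ΛV → ΛW` induced by a linear map of degree `0`. -/
noncomputable def map (φ : V →ₗ[ℚ] W) (hφ : ∀ n, ∀ v ∈ V.gr n, φ v ∈ W.gr n) : Lam V →ₐ[ℚ] Lam W :=
  lift (ι W ∘ₗ φ) fun i j v hv w hw => ι_mul_ι (hφ i v hv) (hφ j w hw)

theorem map_ι (φ : V →ₗ[ℚ] W) (hφ) (v : V) : map φ hφ (ι V v) = ι W (φ v) := lift_ι _ _ v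

theorem map_comp_apply {U : GradedSpace.{u}} (φ : V →ₗ[ℚ] W) (hφ) (ψ : U →ₗ[ℚ] V) (hψ) (hφψ)
    (x : Lam U) : map φ hφ (map ψ hψ x) = map (φ ∘ₗ ψ) hφψ x := by
  have : (map φ hφ).comp (map ψ hψ) = map (φ ∘ₗ ψ) hφψ := by
    apply algHom_ext
    ext v
    simp [map_ι]
  exact DFunLike.congr_fun this x

theorem map_mem_wordLen (φ : V →ₗ[ℚ] W) (hφ) {n : ℕ} {x : Lam V} (hx : x ∈ wordLen V n) :
    map φ hφ x ∈ wordLen W n := by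
  refine wordLen_induction (P := fun n x => map φ hφ x ∈ wordLen W n) (fun n x y hx hy => ?_)
    (fun n c x hx => ?_) ?_ (fun i v hv n x _ hx => ?_) hx
  · rw [map_add]; exact Submodule.add_mem _ hx hy
  · rw [map_smul]; exact Submodule.smul_mem _ _ hx
  · rw [map_one]; exact one_mem_wordLen
  · rw [map_mul, map_ι]; exact ι_mul_mem_wordLen _ hx

theorem twist_mem_gr (i : ℤ) (n : ℤ) (v : V) (hv : v ∈ V.gr n) : V.twist i v ∈ V.gr n := by
  rw [V.twist_of_mem i hv]; exact Submodule.smul_mem _ _ hv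

variable (V) in
/-- The operator `x ↦ (-1)^(i|x|) x` of `ΛV`. -/
noncomputable def twist (i : ℤ) : Lam V →ₐ[ℚ] Lam V := map (V.twist i) (twist_mem_gr i)

theorem ι_mul_mem_gr {i n : ℤ} {v : V} (hv : v ∈ V.gr i) {x : Lam V} (hx : x ∈ gr V n) :
    ι V v * x ∈ gr V (i + n) :=
  SetLike.GradedMul.mul_mem (ι_mem_gr hv) hx

theorem twist_of_mem (i : ℤ) {n : ℤ} {x : Lam V} (hx : x ∈ gr V n) :
    twist V i x = (-1 : ℚ) ^ (i * n) • x := by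
  refine gr_induction (P := fun n x => twist V i x = (-1 : ℚ) ^ (i * n) • x) (fun n => by simp)
    (fun n x y hx hy => ?_) (fun n c x hx => ?_) (by simp) (fun j v hv n x _ hx => ?_) hx
  · rw [map_add, hx, hy, smul_add]
  · rw [map_smul, hx, smul_comm]
  · rw [map_mul, hx, twist, map_ι, V.twist_of_mem i hv, map_smul, mul_add, negOne_zpow_add]
    simp [smul_smul, mul_comm]

theorem hom_induction {P : Lam V → Prop} (add : ∀ x y, P x → P y → P (x + y))
    (hom : ∀ n, ∀ x ∈ gr V n, P x) (x : Lam V) : P x := by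
  induction x using DirectSum.Decomposition.inductionOn (gr V) with
  | zero => exact hom 0 0 (Submodule.zero_mem _)
  | add a b ha hb => exact add _ _ ha hb
  | @homogeneous i a => exact hom i a a.2

/-- Moving v leftwards past x costs the Koszul sign that `twist` supplies. Packing the sign into an
operator keeps later identities valid for inhomogeneous x. -/
theorem twist_mul_ι (i : ℤ) (v : V) (hv : v ∈ V.gr i) (x : Lam V) :
    twist V i x * ι V v = ι V v * x := by
  induction x using word_induction with
  | add x y hx hy => rw [map_add, add_mul, mul_add, hx, hy]
  | smul c x hx => rw [map_smul, smul_mul_assoc, mul_smul_comm, hx]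
  | one => simp
  | mul j w hw x hx =>
    rw [map_mul, mul_assoc, hx, twist, map_ι, V.twist_of_mem i hw, map_smul, smul_mul_assoc,
      ← mul_assoc, ← mul_assoc, ι_mul_ι hv hw, smul_mul_assoc]

/-! ### The coproduct on words -/

theorem comul_one : comul V 1 = 1 ⊗ₜ 1 := by
  simp only [comul, LinearMap.comp_apply, AlgHom.toLinearMap_apply, map_one]
  rfl

/-- Δ is multiplicative and v is primitive: v multiplies either the left tensor factor, or the right
one after passing the left one, which is the sign in `twist`. This recursion drives all inductions
on the coproduct. -/
theorem comul_ι_mul {i : ℤ} {v : V} (hv : v ∈ V.gr i) (x : Lam V) :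
    comul V (ι V v * x) =
      TensorProduct.map (LinearMap.mulLeft ℚ (ι V v)) LinearMap.id (comul V x) +
      TensorProduct.map (twist V i).toLinearMap (LinearMap.mulLeft ℚ (ι V v)) (comul V x) := by
  have key : ∀ y : Lam V ⊗[ℚ] Lam V,
      (GradedTensorProduct.of ℚ (gr V) (gr V)).symm
        (primitive V v * GradedTensorProduct.of ℚ (gr V) (gr V) y) =
      TensorProduct.map (LinearMap.mulLeft ℚ (ι V v)) LinearMap.id y +
      TensorProduct.map (twist V i).toLinearMap (LinearMap.mulLeft ℚ (ι V v)) y := by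
    intro y
    induction y using TensorProduct.induction_on with
    | zero => simp
    | add a b ha hb => simp only [map_add, mul_add, ha, hb]; abel
    | tmul a b =>
      induction a using hom_induction with
      | add a a' ha ha' =>
        simp only [TensorProduct.add_tmul, map_add, mul_add, ha, ha']; abel
      | hom n a ha =>
        have h1 := GradedTensorProduct.tmul_one_mul_coe_tmul (R := ℚ) (gr V) (gr V) (ι V v)
          ⟨a, ha⟩ b
        have h2 := GradedTensorProduct.tmul_coe_mul_coe_tmul (R := ℚ) (gr V) (gr V) 1
          ⟨ι V v, ι_mem_gr hv⟩ ⟨a, ha⟩ b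
        rw [one_mul] at h2
        have h2' := h2.trans (units_smul_eq (i * n) _)
        have hp : primitive V v = (ι V v ᵍ⊗ₜ[ℚ] (1 : Lam V) : gr V ᵍ⊗[ℚ] gr V) +
          ((1 : Lam V) ᵍ⊗ₜ[ℚ] ι V v : gr V ᵍ⊗[ℚ] gr V) := rfl
        rw [hp, add_mul, map_add]
        refine congrArg₂ (· + ·) h1 (h2'.trans ?_)
        rw [TensorProduct.map_tmul, AlgHom.toLinearMap_apply, twist_of_mem i ha]
        rfl
  have h := key (comul V x)
  simp only [comul, LinearMap.comp_apply, AlgHom.toLinearMap_apply, map_mul] at h ⊢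
  refine Eq.trans ?_ h
  rw [show comulAlgHom V (ι V v) = primitive V v from lift_ι _ _ v]
  rfl

theorem counit_ι_mul (v : V) (x : Lam V) : counit V (ι V v * x) = 0 := by
  simp [counit]

theorem counit_twist (i : ℤ) (x : Lam V) : counit V (twist V i x) = counit V x := by
  have : (counit V).comp (twist V i) = counit V := by
    apply algHom_ext
    ext v
    simp [counit, twist, map_ι]
  exact DFunLike.congr_fun this x

theorem counit_comul_left (x : Lam V) :
    TensorProduct.map (counit V).toLinearMap LinearMap.id (comul V x) = 1 ⊗ₜ x := by
  induction x using word_induction with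
  | add x y hx hy => simp only [map_add, hx, hy, TensorProduct.tmul_add]
  | smul c x hx => simp only [map_smul, hx, TensorProduct.tmul_smul]
  | one => simp [comul_one]
  | mul i v hv x hx =>
    have h1 : (counit V).toLinearMap ∘ₗ LinearMap.mulLeft ℚ (ι V v) = 0 := by
      ext x; simp [counit_ι_mul]
    have h2 : (counit V).toLinearMap ∘ₗ (twist V i).toLinearMap = (counit V).toLinearMap := by
      ext x; simp [counit_twist]
    have h3 : TensorProduct.map (counit V).toLinearMap (LinearMap.mulLeft ℚ (ι V v)) =
        TensorProduct.map LinearMap.id (LinearMap.mulLeft ℚ (ι V v)) ∘ₗ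
          TensorProduct.map (counit V).toLinearMap LinearMap.id := by
      rw [← TensorProduct.map_comp]; rfl
    rw [comul_ι_mul hv, map_add, TensorProduct.map_map, TensorProduct.map_map, h1, h2, LinearMap.id_comp,
      LinearMap.id_comp, h3,
      LinearMap.comp_apply, hx]
    simp

theorem counit_comul_right (x : Lam V) :
    TensorProduct.map LinearMap.id (counit V).toLinearMap (comul V x) = x ⊗ₜ 1 := by
  induction x using word_induction with
  | add x y hx hy => simp only [map_add, hx, hy, TensorProduct.add_tmul]
  | smul c x hx => simp only [map_smul, hx, TensorProduct.smul_tmul']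
  | one => simp [comul_one]
  | mul i v hv x hx =>
    have h1 : (counit V).toLinearMap ∘ₗ LinearMap.mulLeft ℚ (ι V v) = 0 := by
      ext x; simp [counit_ι_mul]
    have h3 : TensorProduct.map (LinearMap.mulLeft ℚ (ι V v)) (counit V).toLinearMap =
        TensorProduct.map (LinearMap.mulLeft ℚ (ι V v)) LinearMap.id ∘ₗ
          TensorProduct.map LinearMap.id (counit V).toLinearMap := by
      rw [← TensorProduct.map_comp]; rfl
    rw [comul_ι_mul hv, map_add, TensorProduct.map_map, TensorProduct.map_map, h1, LinearMap.id_comp,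
      LinearMap.comp_id, h3, LinearMap.comp_apply, hx]
    simp

theorem toCoaugKer_apply (x : Lam V) : toCoaugKer V x = x - counit V x • 1 := by
  simp [toCoaugKer, Algebra.algebraMap_eq_smul_one]

theorem toCoaugKer_one : toCoaugKer V 1 = 0 := by simp [toCoaugKer_apply]

theorem toCoaugKer_ι_mul (v : V) (x : Lam V) : toCoaugKer V (ι V v * x) = ι V v * x := by
  rw [toCoaugKer_apply, counit_ι_mul, zero_smul, sub_zero]

theorem toCoaugKer_idem (x : Lam V) : toCoaugKer V (toCoaugKer V x) = toCoaugKer V x := by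
  rw [toCoaugKer_apply (toCoaugKer V x)]
  simp [toCoaugKer_apply]

/-- By the counit identities, the subtracted terms 1 ⊗ x and x ⊗ 1 are what projecting both factors
to the coaugmentation kernel removes. In this form the diagonal can be evaluated tensor by tensor.
-/
theorem reducedComul_eq :
    reducedComul V = TensorProduct.map (toCoaugKer V) (toCoaugKer V) ∘ₗ comul V := by
  -- Inclusion–exclusion for (1 - ηε) ⊗ (1 - ηε), η being the unit map. Each correction is routed
  -- through ε ⊗ id or id ⊗ ε so that the counit identities evaluate it on a coproduct.
  have key : ∀ y : Lam V ⊗[ℚ] Lam V, TensorProduct.map (toCoaugKer V) (toCoaugKer V) y =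
      y - TensorProduct.map (Algebra.linearMap ℚ (Lam V)) LinearMap.id
            (TensorProduct.map (counit V).toLinearMap LinearMap.id y) -
        TensorProduct.map LinearMap.id (Algebra.linearMap ℚ (Lam V))
            (TensorProduct.map LinearMap.id (counit V).toLinearMap y) +
        TensorProduct.map (Algebra.linearMap ℚ (Lam V))
          (Algebra.linearMap ℚ (Lam V) ∘ₗ (counit V).toLinearMap)
          (TensorProduct.map (counit V).toLinearMap LinearMap.id y) := by
    intro y
    induction y using TensorProduct.induction_on with
    | zero => simp
    | add a b ha hb => simp only [map_add, ha, hb]; abel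
    | tmul a b =>
      simp only [TensorProduct.map_tmul, toCoaugKer, TensorProduct.sub_tmul, LinearMap.sub_apply,
        TensorProduct.tmul_sub, LinearMap.id_apply, LinearMap.comp_apply]
      abel
  ext x
  rw [LinearMap.comp_apply, key, counit_comul_left, counit_comul_right]
  simp only [reducedComul, LinearMap.comp_apply, toCoaugKer_apply, map_sub, map_smul,
    LinearMap.sub_apply, LinearMap.add_apply, comul_one, TensorProduct.map_tmul,
    LinearMap.flip_apply, TensorProduct.mk_apply, Algebra.linearMap_apply, map_one,
    LinearMap.id_apply, AlgHom.toLinearMap_apply, Algebra.algebraMap_eq_smul_one,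
    TensorProduct.tmul_smul]
  module

end Lam
namespace Lam
variable {V W : GradedSpace.{u}}

/-! ### The decomposition by word length -/

variable (V) in
/-- The algebra map `ΛV → ΛV[X]`, `v ↦ vX`, recording the length of words. -/
noncomputable def lengthPoly : Lam V →ₐ[ℚ] Polynomial (Lam V) :=
  lift
    { toFun := fun v => Polynomial.monomial 1 (ι V v)
      map_add' := fun v w => by rw [map_add, map_add]
      map_smul' := fun c v => by rw [map_smul, ← Polynomial.smul_monomial]; rfl }
    fun i j v hv w hw => by
      change Polynomial.monomial 1 (ι V v) * Polynomial.monomial 1 (ι V w) =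
        _ • (Polynomial.monomial 1 (ι V w) * Polynomial.monomial 1 (ι V v))
      rw [Polynomial.monomial_mul_monomial, Polynomial.monomial_mul_monomial, ι_mul_ι hv hw,
        ← Polynomial.smul_monomial]

theorem lengthPoly_ι (v : V) : lengthPoly V (ι V v) = Polynomial.monomial 1 (ι V v) := lift_ι _ _ v

theorem lengthPoly_of_mem {n : ℕ} {x : Lam V} (hx : x ∈ wordLen V n) :
    lengthPoly V x = Polynomial.monomial n x := by
  refine wordLen_induction (P := fun n x => lengthPoly V x = Polynomial.monomial n x)
    (fun n x y hx hy => ?_) (fun n c x hx => ?_) ?_ (fun i v hv n x _ hx => ?_) hx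
  · rw [map_add, hx, hy, map_add]
  · rw [map_smul, hx, Polynomial.smul_monomial]
  · rw [map_one]; rfl
  · rw [map_mul, hx, lengthPoly_ι, Polynomial.monomial_mul_monomial, add_comm]

variable (V) in
/-- The operator which multiplies words of length `n` by `α n`. -/
noncomputable def scale (α : ℕ → ℚ) : Lam V →ₗ[ℚ] Lam V where
  toFun x := (lengthPoly V x).sum fun n c => α n • c
  map_add' x y := by
    rw [map_add, Polynomial.sum_add_index _ _ _ (fun n => smul_zero _) fun n a b => smul_add _ a b]
  map_smul' c x := by
    rw [map_smul, Polynomial.sum_smul_index' _ _ _ (fun n => smul_zero _), RingHom.id_apply,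
      Polynomial.sum_def, Polynomial.sum_def, Finset.smul_sum]
    exact Finset.sum_congr rfl fun n _ => smul_comm _ _ _

theorem scale_of_mem (α : ℕ → ℚ) {n : ℕ} {x : Lam V} (hx : x ∈ wordLen V n) :
    scale V α x = α n • x := by
  change (lengthPoly V x).sum _ = _
  rw [lengthPoly_of_mem hx]
  exact Polynomial.sum_monomial_index (f := fun n (c : Lam V) => α n • c) _ (smul_zero _)

variable (V) in
/-- The projection onto the span of the words of length `n`. -/
noncomputable def lenProj (n : ℕ) : Lam V →ₗ[ℚ] Lam V := scale V (Pi.single n 1)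

theorem lenProj_of_mem {n : ℕ} {x : Lam V} (hx : x ∈ wordLen V n) : lenProj V n x = x := by
  rw [lenProj, scale_of_mem _ hx, Pi.single_eq_same, one_smul]

theorem lenProj_of_mem_ne {m n : ℕ} (h : m ≠ n) {x : Lam V} (hx : x ∈ wordLen V m) :
    lenProj V n x = 0 := by
  rw [lenProj, scale_of_mem _ hx, Pi.single_eq_of_ne h, zero_smul]

/-- Induction on elements of pure word length. -/
theorem wordLen_span {P : Lam V → Prop} (add : ∀ x y, P x → P y → P (x + y))
    (hom : ∀ n, ∀ x ∈ wordLen V n, P x) (x : Lam V) : P x := by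
  have h : ∃ s : Finset ℕ, ∃ f : ℕ → Lam V, (∀ n, f n ∈ wordLen V n) ∧ x = ∑ n ∈ s, f n := by
    have hx : x ∈ ⨆ n, wordLen V n := by
      induction x using word_induction with
      | add x y hx hy => exact Submodule.add_mem _ hx hy
      | smul c x hx => exact Submodule.smul_mem _ _ hx
      | one => exact Submodule.mem_iSup_of_mem 0 one_mem_wordLen
      | mul i v hv x hx =>
        have : ⨆ n, wordLen V n ≤ (⨆ n, wordLen V n).comap (LinearMap.mulLeft ℚ (ι V v)) :=
          iSup_le fun n y hy => Submodule.mem_iSup_of_mem (n + 1) (ι_mul_mem_wordLen v hy)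
        exact this hx
    rw [Submodule.mem_iSup_iff_exists_finsupp] at hx
    obtain ⟨f, hf, rfl⟩ := hx
    exact ⟨f.support, f, hf, rfl⟩
  obtain ⟨s, f, hf, rfl⟩ := h
  classical
  induction s using Finset.induction_on with
  | empty => rw [Finset.sum_empty]; exact hom 0 0 (Submodule.zero_mem _)
  | insert a s ha ih => rw [Finset.sum_insert ha]; exact add _ _ (hom a _ (hf a)) ih

theorem lenProj_mem (n : ℕ) (x : Lam V) : lenProj V n x ∈ wordLen V n := by
  induction x using wordLen_span with
  | add x y hx hy => rw [map_add]; exact Submodule.add_mem _ hx hy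
  | hom m x hx =>
    by_cases h : m = n
    · subst h; rw [lenProj_of_mem hx]; exact hx
    · rw [lenProj_of_mem_ne h hx]; exact Submodule.zero_mem _

theorem lenProj_scale (α : ℕ → ℚ) (n : ℕ) (x : Lam V) :
    lenProj V n (scale V α x) = α n • lenProj V n x := by
  induction x using wordLen_span with
  | add x y hx hy => rw [map_add, map_add, map_add, hx, hy, smul_add]
  | hom m x hx =>
    rw [scale_of_mem α hx, map_smul]
    by_cases h : m = n
    · rw [h]
    · rw [lenProj_of_mem_ne h hx, smul_zero, smul_zero]

theorem exists_sum_lenProj (x : Lam V) :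
    ∃ N : ℕ, ∀ M, N ≤ M → x = ∑ n ∈ Finset.range M, lenProj V n x := by
  induction x using wordLen_span with
  | add x y hx hy =>
    obtain ⟨N, hN⟩ := hx
    obtain ⟨N', hN'⟩ := hy
    refine ⟨max N N', fun M hM => ?_⟩
    simp only [map_add, Finset.sum_add_distrib]
    rw [← hN M (le_trans (le_max_left _ _) hM), ← hN' M (le_trans (le_max_right _ _) hM)]
  | hom m x hx =>
    refine ⟨m + 1, fun M hM => ?_⟩
    rw [Finset.sum_eq_single_of_mem m (Finset.mem_range.2 hM)
      fun n _ h => lenProj_of_mem_ne h.symm hx, lenProj_of_mem hx]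

theorem scale_ι_mul (α : ℕ → ℚ) (v : V) (x : Lam V) :
    scale V α (ι V v * x) = ι V v * scale V (fun n => α (n + 1)) x := by
  induction x using wordLen_span with
  | add x y hx hy => rw [mul_add, map_add, map_add, mul_add, hx, hy]
  | hom m x hx =>
    rw [scale_of_mem _ hx, scale_of_mem _ (ι_mul_mem_wordLen v hx), mul_smul_comm]

theorem scale_add (α β : ℕ → ℚ) (x : Lam V) :
    scale V (fun n => α n + β n) x = scale V α x + scale V β x := by
  induction x using wordLen_span with
  | add x y hx hy => simp only [map_add, hx, hy]; abel
  | hom m x hx => simp only [scale_of_mem _ hx, add_smul]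

theorem scale_twist (α : ℕ → ℚ) (i : ℤ) (x : Lam V) :
    scale V α (twist V i x) = twist V i (scale V α x) := by
  induction x using wordLen_span with
  | add x y hx hy => simp only [map_add, hx, hy]
  | hom m x hx =>
    rw [scale_of_mem _ hx, twist, scale_of_mem _ (map_mem_wordLen _ _ hx), map_smul]

/-- Places the projection among the length scalings, whose convolutions are computable. -/
theorem toCoaugKer_eq_scale : toCoaugKer V = scale V (fun n => if n = 0 then 0 else 1) := by
  apply linearMap_ext
  · rw [toCoaugKer_one, scale_of_mem _ one_mem_wordLen]; simp
  · intro i v hv x hx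
    clear hx
    have : scale V (fun n => if n + 1 = 0 then 0 else 1) x = x := by
      induction x using wordLen_span with
      | add x y hx hy => rw [map_add, hx, hy]
      | hom m x hx => rw [scale_of_mem _ hx]; simp
    rw [toCoaugKer_ι_mul, scale_ι_mul, this]

/-! ### Convolution of scalings -/

/-- The convolution product of linear endomorphisms of `ΛV`. -/
noncomputable def conv (A B : Lam V →ₗ[ℚ] Lam V) : Lam V →ₗ[ℚ] Lam V :=
  LinearMap.mul' ℚ (Lam V) ∘ₗ TensorProduct.map A B ∘ₗ comul V

/-- The binomial convolution `n ↦ ∑ (n choose a) α(a) β(n - a)`. -/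
def binomConv (α β : ℕ → ℚ) : ℕ → ℚ
  | 0 => α 0 * β 0
  | n + 1 => binomConv (fun a => α (a + 1)) β n + binomConv α (fun b => β (b + 1)) n

theorem binomConv_nonneg {α β : ℕ → ℚ} (hα : ∀ n, 0 ≤ α n) (hβ : ∀ n, 0 ≤ β n) (n : ℕ) :
    0 ≤ binomConv α β n := by
  induction n generalizing α β with
  | zero => exact mul_nonneg (hα 0) (hβ 0)
  | succ n ih => exact add_nonneg (ih (fun _ => hα _) hβ) (ih hα fun _ => hβ _)

theorem binomConv_pos {α β : ℕ → ℚ} (hα : ∀ n, 0 ≤ α n) (hβ : ∀ n, 0 ≤ β n) (a b : ℕ)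
    (ha : 0 < α a) (hb : 0 < β b) : 0 < binomConv α β (a + b) := by
  induction a generalizing α with
  | zero =>
    rw [Nat.zero_add]
    induction b generalizing β with
    | zero => exact mul_pos ha hb
    | succ b ih =>
      exact add_pos_of_nonneg_of_pos (binomConv_nonneg (fun _ => hα _) hβ b)
        (ih (fun _ => hβ _) hb)
  | succ a ih =>
    rw [Nat.succ_add]
    exact add_pos_of_pos_of_nonneg (ih (fun _ => hα _) ha)
      (binomConv_nonneg hα (fun _ => hβ _) _)

theorem mul'_map_ι_left (A B : Lam V →ₗ[ℚ] Lam V) (v : V) (y : Lam V ⊗[ℚ] Lam V) :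
    LinearMap.mul' ℚ (Lam V) (TensorProduct.map (LinearMap.mulLeft ℚ (ι V v) ∘ₗ A) B y) =
      ι V v * LinearMap.mul' ℚ (Lam V) (TensorProduct.map A B y) := by
  induction y using TensorProduct.induction_on with
  | zero => simp
  | add a b ha hb => simp only [map_add, mul_add, ha, hb]
  | tmul a b => simp [mul_assoc]

theorem mul'_map_ι_right (A B : Lam V →ₗ[ℚ] Lam V) {i : ℤ} {v : V} (hv : v ∈ V.gr i)
    (y : Lam V ⊗[ℚ] Lam V) :
    LinearMap.mul' ℚ (Lam V) (TensorProduct.map ((twist V i).toLinearMap ∘ₗ A)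
      (LinearMap.mulLeft ℚ (ι V v) ∘ₗ B) y) =
      ι V v * LinearMap.mul' ℚ (Lam V) (TensorProduct.map A B y) := by
  induction y using TensorProduct.induction_on with
  | zero => simp
  | add a b ha hb => simp only [map_add, mul_add, ha, hb]
  | tmul a b => simp [← mul_assoc, twist_mul_ι i v hv]

/-- Each way of splitting a word into two subwords multiplies back to the same word, the shuffle
sign cancelling, so only the number of splittings remains. The first letter goes left or right,
which is the Pascal recursion defining `binomConv`. -/
theorem conv_scale (α β : ℕ → ℚ) : conv (scale V α) (scale V β) = scale V (binomConv α β) := by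
  ext x
  induction x using word_induction generalizing α β with
  | add x y hx hy => rw [map_add, map_add, hx, hy]
  | smul c x hx => rw [map_smul, map_smul, hx]
  | one =>
    simp only [conv, LinearMap.comp_apply, comul_one, TensorProduct.map_tmul,
      scale_of_mem _ one_mem_wordLen, LinearMap.mul'_apply, binomConv, smul_mul_smul_comm, one_mul]
  | mul i v hv x hx =>
    have h1 : scale V α ∘ₗ LinearMap.mulLeft ℚ (ι V v) =
        LinearMap.mulLeft ℚ (ι V v) ∘ₗ scale V (fun n => α (n + 1)) :=
      LinearMap.ext fun x => scale_ι_mul α v x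
    have h2 : scale V β ∘ₗ LinearMap.mulLeft ℚ (ι V v) =
        LinearMap.mulLeft ℚ (ι V v) ∘ₗ scale V (fun n => β (n + 1)) :=
      LinearMap.ext fun x => scale_ι_mul β v x
    have h3 : scale V α ∘ₗ (twist V i).toLinearMap = (twist V i).toLinearMap ∘ₗ scale V α :=
      LinearMap.ext fun x => scale_twist α i x
    have e1 := hx (fun n => α (n + 1)) β
    have e2 := hx α (fun n => β (n + 1))
    rw [scale_ι_mul]
    simp only [binomConv]
    rw [scale_add, mul_add, ← e1, ← e2]
    simp only [conv, LinearMap.comp_apply, comul_ι_mul hv, map_add, TensorProduct.map_map,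
      LinearMap.comp_id]
    rw [h1, h2, h3, mul'_map_ι_left, mul'_map_ι_right _ _ hv]

/-! ### The iterated reduced diagonal -/

/-- The scalar by which the product of the `m`-th iterated reduced diagonal acts on words of a
given length, the number of surjections onto a set with `m + 1` elements. -/
def surjCount : ℕ → ℕ → ℚ
  | 0 => fun n => if n = 0 then 0 else 1
  | m + 1 => binomConv (surjCount m) (fun n => if n = 0 then 0 else 1)

theorem surjCount_nonneg (m n : ℕ) : 0 ≤ surjCount m n := by
  induction m generalizing n with
  | zero => simp only [surjCount]; split_ifs <;> norm_num
  | succ m ih => exact binomConv_nonneg ih (fun n => by split_ifs <;> norm_num) n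

theorem surjCount_pos (m n : ℕ) (h : m < n) : 0 < surjCount m n := by
  induction m generalizing n with
  | zero => simp only [surjCount]; rw [if_neg (by omega)]; norm_num
  | succ m ih =>
    obtain ⟨n, rfl⟩ : ∃ k, n = k + 1 := ⟨n - 1, by omega⟩
    -- One positive summand is enough: n letters to the first m + 1 factors and a single letter to
    -- the last.
    exact binomConv_pos (surjCount_nonneg m) (fun n => by split_ifs <;> norm_num) n 1
      (ih n (by omega)) (by simp)

theorem iterComul_toCoaugKer (m : ℕ) (x : Lam V) :
    iterComul V m (toCoaugKer V x) = iterComul V m x := by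
  cases m with
  | zero => simp [iterComul, toCoaugKer_idem]
  | succ m => simp [iterComul, reducedComul, toCoaugKer_idem]

/-- Multiplied out, the iterated reduced diagonal is a convolution power of the projection to the
coaugmentation kernel, hence a scaling. Its nonzero scalars are what detects words of length greater
than m. -/
theorem lift_iterComul (m : ℕ) :
    (TensorAlgebra.lift ℚ LinearMap.id : TensorAlgebra ℚ (Lam V) →ₐ[ℚ] Lam V).toLinearMap ∘ₗ
      iterComul V m = scale V (surjCount m) := by
  induction m with
  | zero =>
    rw [surjCount, ← toCoaugKer_eq_scale]
    ext x
    simp [iterComul]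
  | succ m ih =>
    rw [surjCount, ← conv_scale, ← ih, ← toCoaugKer_eq_scale, conv, iterComul, reducedComul_eq]
    ext x
    simp only [LinearMap.comp_apply]
    generalize comul V x = y
    induction y using TensorProduct.induction_on with
    | zero => simp
    | add a b ha hb => simp only [map_add, ha, hb]
    | tmul a b => simp [iterComul_toCoaugKer]

theorem twist_mem_wordLen (i : ℤ) {n : ℕ} {x : Lam V} (hx : x ∈ wordLen V n) :
    twist V i x ∈ wordLen V n := map_mem_wordLen _ _ hx

theorem comul_mem_span {n : ℕ} {x : Lam V} (hx : x ∈ wordLen V n) :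
    comul V x ∈ Submodule.span ℚ {z | ∃ a b : ℕ, a + b = n ∧ ∃ y ∈ wordLen V a,
      ∃ y' ∈ wordLen V b, z = y ⊗ₜ[ℚ] y'} := by
  refine wordLen_induction (P := fun n x => comul V x ∈ Submodule.span ℚ {z | ∃ a b : ℕ, a + b = n ∧
    ∃ y ∈ wordLen V a, ∃ y' ∈ wordLen V b, z = y ⊗ₜ[ℚ] y'}) (fun n x y hx hy => ?_)
    (fun n c x hx => ?_) ?_ (fun i v hv n x _ hx => ?_) hx
  · rw [map_add]; exact Submodule.add_mem _ hx hy
  · rw [map_smul]; exact Submodule.smul_mem _ _ hx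
  · exact Submodule.subset_span ⟨0, 0, rfl, 1, one_mem_wordLen, 1, one_mem_wordLen, comul_one⟩
  · rw [comul_ι_mul hv]
    generalize comul V x = z at hx
    induction hx using Submodule.span_induction with
    | zero => simp
    | add x y _ _ hx hy =>
      have := Submodule.add_mem _ hx hy
      simp only [map_add] at this ⊢
      convert this using 1
      abel
    | smul c x _ hx => rw [map_smul, map_smul, ← smul_add]; exact Submodule.smul_mem _ _ hx
    | mem x hx =>
      obtain ⟨a, b, rfl, y, hy, y', hy', rfl⟩ := hx
      refine Submodule.add_mem _ (Submodule.subset_span ?_) (Submodule.subset_span ?_)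
      · exact ⟨a + 1, b, by omega, _, ι_mul_mem_wordLen v hy, y', hy', rfl⟩
      · exact ⟨a, b + 1, by omega, _, twist_mem_wordLen i hy, _, ι_mul_mem_wordLen v hy', rfl⟩

variable (V) in
/-- The subalgebra of `T(ΛV)` generated by the words of length one. -/
noncomputable def tensorLetters : Subalgebra ℚ (TensorAlgebra ℚ (Lam V)) :=
  Algebra.adjoin ℚ (Set.range fun v => TensorAlgebra.ι ℚ (ι V v))

theorem wordLen_zero {x : Lam V} (hx : x ∈ wordLen V 0) : ∃ c : ℚ, x = c • 1 := by
  rw [wordLen, pow_zero, Submodule.mem_one] at hx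
  obtain ⟨c, rfl⟩ := hx
  exact ⟨c, Algebra.algebraMap_eq_smul_one c⟩

theorem wordLen_one {x : Lam V} (hx : x ∈ wordLen V 1) : ∃ v, ι V v = x := by
  rw [wordLen, pow_one] at hx
  exact hx

theorem toCoaugKer_of_mem_zero {x : Lam V} (hx : x ∈ wordLen V 0) : toCoaugKer V x = 0 := by
  obtain ⟨c, rfl⟩ := wordLen_zero hx
  rw [map_smul, toCoaugKer_one, smul_zero]

/-- All m + 1 tensor factors must have positive length. At most m letters are too few, and exactly m
+ 1 letters force every factor to be a single letter. The second fact later identifies the leading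
part of a coalgebra morphism. -/
theorem iterComul_of_mem (m : ℕ) :
    (∀ n ≤ m, ∀ x ∈ wordLen V n, iterComul V m x = 0) ∧
    ∀ x ∈ wordLen V (m + 1), iterComul V m x ∈ tensorLetters V := by
  induction m with
  | zero =>
    constructor
    · intro n hn x hx
      obtain rfl : n = 0 := by omega
      rw [iterComul, LinearMap.comp_apply, toCoaugKer_of_mem_zero hx, map_zero]
    · intro x hx
      obtain ⟨v, rfl⟩ := wordLen_one hx
      have := toCoaugKer_ι_mul v (1 : Lam V)
      rw [mul_one] at this
      rw [iterComul, LinearMap.comp_apply, this]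
      exact Algebra.subset_adjoin ⟨v, rfl⟩
  | succ m ih =>
    have key : ∀ y y' : Lam V, (LinearMap.mul' ℚ _ ∘ₗ TensorProduct.map (iterComul V m)
        (TensorAlgebra.ι ℚ) ∘ₗ TensorProduct.map (toCoaugKer V) (toCoaugKer V)) (y ⊗ₜ[ℚ] y') =
        iterComul V m y * TensorAlgebra.ι ℚ (toCoaugKer V y') := by
      intro y y'
      simp [iterComul_toCoaugKer]
    have e : iterComul V (m + 1) = (LinearMap.mul' ℚ _ ∘ₗ TensorProduct.map (iterComul V m)
        (TensorAlgebra.ι ℚ) ∘ₗ TensorProduct.map (toCoaugKer V) (toCoaugKer V)) ∘ₗ comul V := by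
      rw [iterComul, reducedComul_eq]; rfl
    rw [e]
    generalize (LinearMap.mul' ℚ _ ∘ₗ TensorProduct.map (iterComul V m)
        (TensorAlgebra.ι ℚ) ∘ₗ TensorProduct.map (toCoaugKer V) (toCoaugKer V)) = f at key
    constructor
    · intro n hn x hx
      rw [LinearMap.comp_apply, ← LinearMap.mem_ker]
      refine Submodule.span_le.2 ?_ (comul_mem_span hx)
      rintro _ ⟨a, b, rfl, y, hy, y', hy', rfl⟩
      rw [SetLike.mem_coe, LinearMap.mem_ker, key]
      by_cases hb : b = 0
      · subst hb
        rw [toCoaugKer_of_mem_zero hy', map_zero, mul_zero]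
      · rw [ih.1 a (by omega) y hy, zero_mul]
    · intro x hx
      rw [LinearMap.comp_apply, ← Subalgebra.mem_toSubmodule, ← Submodule.mem_comap]
      refine Submodule.span_le.2 ?_ (comul_mem_span hx)
      rintro _ ⟨a, b, hab, y, hy, y', hy', rfl⟩
      rw [SetLike.mem_coe, Submodule.mem_comap, key, Subalgebra.mem_toSubmodule]
      by_cases hb : b = 0
      · subst hb
        rw [toCoaugKer_of_mem_zero hy', map_zero, mul_zero]
        exact Subalgebra.zero_mem _
      · by_cases hb1 : b = 1
        · subst hb1
          obtain rfl : a = m + 1 := by omega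
          obtain ⟨v, rfl⟩ := wordLen_one hy'
          have := toCoaugKer_ι_mul v (1 : Lam V)
          rw [mul_one] at this
          rw [this]
          exact Subalgebra.mul_mem _ (ih.2 y hy) (Algebra.subset_adjoin ⟨v, rfl⟩)
        · rw [ih.1 a (by omega) y hy, zero_mul]
          exact Subalgebra.zero_mem _

/-! ### The filtration -/

/-- If Δᵖ x = 0, multiplying out gives 0 = `surjCount p n` times the length-n component, and this
scalar is positive for n > p. Conversely Δᵖ kills every component of length at most p. -/
theorem mem_filtration_natCast {p : ℕ} {x : Lam V} :
    x ∈ filtration V p ↔ ∀ n, p < n → lenProj V n x = 0 := by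
  rw [filtration, if_pos (by positivity), Int.toNat_natCast, LinearMap.mem_ker]
  constructor
  · intro h n hn
    have h2 := LinearMap.congr_fun (lift_iterComul (V := V) p) x
    rw [LinearMap.comp_apply, h, map_zero] at h2
    have h3 := lenProj_scale (surjCount p) n x
    rw [← h2, map_zero] at h3
    exact (smul_eq_zero.1 h3.symm).resolve_left (surjCount_pos p n hn).ne'
  · intro h
    obtain ⟨N, hN⟩ := exists_sum_lenProj x
    rw [hN N le_rfl, map_sum]
    refine Finset.sum_eq_zero fun n _ => ?_
    by_cases hn : n ≤ p
    · exact (iterComul_of_mem p).1 n hn _ (lenProj_mem n x)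
    · rw [h n (by omega), map_zero]

theorem mem_filtration {p : ℤ} {x : Lam V} :
    x ∈ filtration V p ↔ ∀ n : ℕ, p < n → lenProj V n x = 0 := by
  by_cases hp : 0 ≤ p
  · lift p to ℕ using hp
    rw [mem_filtration_natCast]
    simp
  · rw [filtration, if_neg hp, Submodule.mem_bot]
    constructor
    · rintro rfl n _; rw [map_zero]
    · intro h
      obtain ⟨N, hN⟩ := exists_sum_lenProj x
      rw [hN N le_rfl]
      exact Finset.sum_eq_zero fun n _ => h n (by omega)

theorem filtration_mono : Monotone (filtration V) := fun p q hpq x hx =>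
  mem_filtration.2 fun n hn => mem_filtration.1 hx n (by omega)

theorem wordLen_le_filtration {n : ℕ} {p : ℤ} (h : (n : ℤ) ≤ p) : wordLen V n ≤ filtration V p :=
  fun _ hx => mem_filtration.2 fun _ hm => lenProj_of_mem_ne (by omega) hx

theorem word_le_filtration (p : ℤ) : word V p ≤ filtration V p := by
  by_cases hp : 0 ≤ p
  · lift p to ℕ using hp
    rw [word_natCast]; exact wordLen_le_filtration le_rfl
  · rw [word_of_neg (by omega)]; exact bot_le

/-- Induction on elements of the filtration. -/
theorem filtration_le {p : ℤ} {S : Submodule ℚ (Lam V)}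
    (h : ∀ n : ℕ, (n : ℤ) ≤ p → wordLen V n ≤ S) : filtration V p ≤ S := by
  intro x hx
  obtain ⟨N, hN⟩ := exists_sum_lenProj x
  rw [hN N le_rfl]
  refine Submodule.sum_mem _ fun n _ => ?_
  by_cases hn : (n : ℤ) ≤ p
  · exact h n hn (lenProj_mem n x)
  · rw [mem_filtration.1 hx n (by omega)]; exact Submodule.zero_mem _

theorem filtration_eq_sup (p : ℤ) : filtration V p = word V p ⊔ filtration V (p - 1) := by
  apply le_antisymm
  · refine filtration_le fun n hn => ?_
    rcases hn.eq_or_lt with rfl | hn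
    · rw [← word_natCast]; exact le_sup_left
    · exact (wordLen_le_filtration (by omega)).trans le_sup_right
  · exact sup_le (word_le_filtration p) (filtration_mono (by omega))

theorem word_disjoint_filtration {p : ℤ} {x : Lam V} (hx : x ∈ word V p)
    (hx' : x ∈ filtration V (p - 1)) : x = 0 := by
  by_cases hp : 0 ≤ p
  · lift p to ℕ using hp
    rw [word_natCast] at hx
    rw [← lenProj_of_mem hx]
    exact mem_filtration.1 hx' p (by omega)
  · rw [word_of_neg (by omega)] at hx
    exact hx

end Lam
namespace Lam
variable {V W : GradedSpace.{u}}

/-! ### Coderivations -/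

/-- Homogeneity of degree `e` of a linear map `ΛV → V`. -/
def IsHom (f : Lam V →ₗ[ℚ] V) (e : ℤ) : Prop := ∀ n, ∀ x ∈ gr V n, f x ∈ V.gr (n + e)

/-- Precomposition with left multiplication by a letter. -/
noncomputable def contract (f : Lam V →ₗ[ℚ] V) (v : V) : Lam V →ₗ[ℚ] V :=
  f ∘ₗ LinearMap.mulLeft ℚ (ι V v)

theorem contract_apply (f : Lam V →ₗ[ℚ] V) (v : V) (x : Lam V) :
    contract f v x = f (ι V v * x) := rfl

theorem IsHom.contract {f : Lam V →ₗ[ℚ] V} {e : ℤ} (hf : IsHom f e) {i : ℤ} {v : V}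
    (hv : v ∈ V.gr i) : IsHom (contract f v) (e + i) := fun n x hx => by
  have := hf _ _ (ι_mul_mem_gr hv hx)
  rwa [show i + n + e = n + (e + i) by ring] at this

theorem coderivation_add (f g : Lam V →ₗ[ℚ] V) :
    coderivation (f + g) = coderivation f + coderivation g := by
  simp only [coderivation, LinearMap.comp_add, LinearMap.add_comp, TensorProduct.map_add_left]

theorem coderivation_smul (c : ℚ) (f : Lam V →ₗ[ℚ] V) :
    coderivation (c • f) = c • coderivation f := by
  simp only [coderivation, LinearMap.comp_smul, LinearMap.smul_comp, TensorProduct.map_smul_left]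

theorem coderivation_sub (f g : Lam V →ₗ[ℚ] V) :
    coderivation (f - g) = coderivation f - coderivation g := by
  rw [sub_eq_add_neg, coderivation_add, ← neg_one_smul ℚ g, coderivation_smul,
    neg_one_smul ℚ (coderivation g), sub_eq_add_neg]

theorem coderivation_zero : coderivation (0 : Lam V →ₗ[ℚ] V) = 0 := by
  rw [← zero_smul ℚ (0 : Lam V →ₗ[ℚ] V), coderivation_smul, zero_smul]

theorem coderivation_one (f : Lam V →ₗ[ℚ] V) : coderivation f 1 = ι V (f 1) := by
  simp [coderivation, comul_one]

/-- For |x| = n the twist gives (-1)^(in) and commuting f(x) past v gives (-1)^((n+e)i); only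
(-1)^(ei) survives, independently of n. -/
theorem map_twist_of_isHom {f : Lam V →ₗ[ℚ] V} {e : ℤ} (hf : IsHom f e) {i : ℤ} {v : V}
    (hv : v ∈ V.gr i) (x : Lam V) :
    ι V (f (twist V i x)) * ι V v = (-1 : ℚ) ^ (e * i) • (ι V v * ι V (f x)) := by
  induction x using hom_induction with
  | add x y hx hy => simp only [map_add, add_mul, mul_add, smul_add, hx, hy]
  | hom n x hx =>
    rw [twist_of_mem i hx, map_smul, map_smul, smul_mul_assoc, ι_mul_ι (hf n x hx) hv, smul_smul,
      add_mul, negOne_zpow_add, ← mul_assoc, mul_comm i n, negOne_zpow_mul_self, one_mul]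

/-- The letter v is either consumed by f or left outside, where D_f passes it with a Koszul sign.
The contraction of f has the new degree e + i, so inductions based on this rule must let f and its
degree vary. -/
theorem coderivation_ι_mul {f : Lam V →ₗ[ℚ] V} {e : ℤ} (hf : IsHom f e) {i : ℤ} {v : V}
    (hv : v ∈ V.gr i) (x : Lam V) :
    coderivation f (ι V v * x) =
      coderivation (contract f v) x + (-1 : ℚ) ^ (e * i) • (ι V v * coderivation f x) := by
  simp only [coderivation, LinearMap.comp_apply, comul_ι_mul hv, map_add]
  generalize comul V x = y
  induction y using TensorProduct.induction_on with
  | zero => simp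
  | add a b ha hb =>
    have := congrArg₂ (· + ·) ha hb
    simp only [map_add, mul_add, smul_add] at this ⊢
    rw [add_add_add_comm, this]
    abel
  | tmul a b =>
    simp only [TensorProduct.map_tmul, LinearMap.mul'_apply, LinearMap.comp_apply,
      AlgHom.toLinearMap_apply, LinearMap.id_apply, LinearMap.mulLeft_apply, contract_apply]
    rw [← mul_assoc _ (ι V v) b, map_twist_of_isHom hf hv, smul_mul_assoc, mul_assoc]

theorem coderivation_mem_gr {f : Lam V →ₗ[ℚ] V} {e : ℤ} (hf : IsHom f e) {n : ℤ} {x : Lam V}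
    (hx : x ∈ gr V n) : coderivation f x ∈ gr V (n + e) := by
  refine gr_induction (P := fun n x => ∀ (e : ℤ) (f : Lam V →ₗ[ℚ] V), IsHom f e →
    coderivation f x ∈ gr V (n + e)) (fun n e f _ => ?_) (fun n x y hx hy e f hf => ?_)
    (fun n c x hx e f hf => ?_) (fun e f hf => ?_) (fun i v hv n x _ hx e f hf => ?_) hx e f hf
  · rw [map_zero]; exact Submodule.zero_mem _
  · rw [map_add]; exact Submodule.add_mem _ (hx e f hf) (hy e f hf)
  · rw [map_smul]; exact Submodule.smul_mem _ _ (hx e f hf)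
  · rw [coderivation_one]
    exact ι_mem_gr (hf 0 1 (SetLike.GradedOne.one_mem))
  · rw [coderivation_ι_mul hf hv]
    refine Submodule.add_mem _ ?_ (Submodule.smul_mem _ _ ?_)
    · have := hx _ _ (hf.contract hv)
      rwa [show n + (e + i) = i + n + e by ring] at this
    · have := ι_mul_mem_gr hv (hx _ _ hf)
      rwa [← add_assoc] at this

/-- The graded commutator of coderivations is a coderivation. -/
theorem coderivation_commutator {f g : Lam V →ₗ[ℚ] V} {a b : ℤ} (hf : IsHom f a) (hg : IsHom g b)
    (x : Lam V) :
    coderivation f (coderivation g x) - (-1 : ℚ) ^ (a * b) • coderivation g (coderivation f x) =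
      coderivation (f ∘ₗ coderivation g - (-1 : ℚ) ^ (a * b) • g ∘ₗ coderivation f) x := by
  have hk : ∀ {f g : Lam V →ₗ[ℚ] V} {a b : ℤ}, IsHom f a → IsHom g b →
      IsHom (f ∘ₗ coderivation g - (-1 : ℚ) ^ (a * b) • g ∘ₗ coderivation f) (a + b) := by
    intro f g a b hf hg n x hx
    have h1 := hf _ _ (coderivation_mem_gr hg hx)
    have h2 := hg _ _ (coderivation_mem_gr hf hx)
    rw [show n + b + a = n + (a + b) by ring] at h1
    rw [show n + a + b = n + (a + b) by ring] at h2
    exact Submodule.sub_mem _ h1 (Submodule.smul_mem _ _ h2)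
  induction x using word_induction generalizing f g a b with
  | add x y hx hy =>
    simp only [map_add, smul_add]
    rw [← hx hf hg, ← hy hf hg]
    abel
  | smul c x hx =>
    simp only [map_smul]
    rw [← hx hf hg, smul_sub, smul_comm]
  | one =>
    have hf1 : f 1 ∈ V.gr a := by simpa using hf 0 1 (SetLike.GradedOne.one_mem)
    have hg1 : g 1 ∈ V.gr b := by simpa using hg 0 1 (SetLike.GradedOne.one_mem)
    have e1 := coderivation_ι_mul hf hg1 1
    have e2 := coderivation_ι_mul hg hf1 1
    rw [mul_one, coderivation_one, coderivation_one, contract_apply, mul_one] at e1 e2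
    rw [coderivation_one, coderivation_one, coderivation_one, e1, e2, ι_mul_ι hg1 hf1,
      mul_comm b a]
    simp only [LinearMap.sub_apply, LinearMap.smul_apply, LinearMap.comp_apply, coderivation_one,
      map_sub, map_smul, smul_add, smul_smul, negOne_zpow_mul_self, one_smul]
    abel
  | mul i v hv x hx =>
    have e1 := hx hf (hg.contract hv)
    have e2 := hx (hf.contract hv) hg
    have e3 := hx hf hg
    -- Contracting the corestriction of a commutator gives a sum of two commutators in which one of
    -- f, g has been contracted. The induction hypothesis applies to both, as it was generalized
    -- over f, g and their degrees.
    have hc : contract (f ∘ₗ coderivation g - (-1 : ℚ) ^ (a * b) • g ∘ₗ coderivation f) v =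
        (f ∘ₗ coderivation (contract g v) -
          (-1 : ℚ) ^ (a * (b + i)) • contract g v ∘ₗ coderivation f) +
        (-1 : ℚ) ^ (b * i) • (contract f v ∘ₗ coderivation g -
          (-1 : ℚ) ^ ((a + i) * b) • g ∘ₗ coderivation (contract f v)) := by
      ext y
      simp only [contract_apply, LinearMap.sub_apply, LinearMap.smul_apply, LinearMap.add_apply,
        LinearMap.comp_apply, coderivation_ι_mul hf hv, coderivation_ι_mul hg hv, map_add, map_smul]
      rw [mul_add, add_mul, negOne_zpow_add, negOne_zpow_add, mul_comm i b]
      have h := negOne_zpow_mul_self (b * i)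
      generalize (-1 : ℚ) ^ (b * i) = s at h ⊢
      simp only [smul_sub, smul_smul, smul_add]
      rw [show s * ((-1 : ℚ) ^ (a * b) * s) = (-1 : ℚ) ^ (a * b) by rw [mul_left_comm, h, mul_one]]
      abel
    rw [coderivation_ι_mul (hk hf hg) hv, hc, coderivation_add, coderivation_smul,
      LinearMap.add_apply, LinearMap.smul_apply, ← e1, ← e2, ← e3]
    simp only [coderivation_ι_mul hf hv, coderivation_ι_mul hg hv, map_add, map_smul]
    rw [mul_add, add_mul, add_mul, negOne_zpow_add, negOne_zpow_add, negOne_zpow_add, mul_comm i b]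
    have h := negOne_zpow_mul_self (b * i)
    generalize (-1 : ℚ) ^ (b * i) = s at h ⊢
    generalize (-1 : ℚ) ^ (a * i) = s'
    generalize (-1 : ℚ) ^ (a * b) = t
    simp only [smul_sub, smul_smul, smul_add, mul_sub, mul_smul_comm]
    rw [show s * (t * s) = t by rw [mul_left_comm, h, mul_one], mul_comm s' s, mul_comm t s',
      mul_right_comm s s' t, mul_comm s t, mul_assoc t s s']
    abel

/-- An odd coderivation `D_f` has square zero if `f ∘ D_f = 0`. -/
theorem coderivation_sq {f : Lam V →ₗ[ℚ] V} (hf : IsHom f (-1)) (h : f ∘ₗ coderivation f = 0) :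
    coderivation f ∘ₗ coderivation f = 0 := by
  ext x
  -- In degree -1 the graded commutator of D_f with itself is 2 D_f², and 2 is invertible.
  have e := coderivation_commutator hf hf x
  rw [h, smul_zero, sub_zero, coderivation_zero] at e
  norm_num at e
  rw [← two_smul ℚ] at e
  exact (smul_eq_zero.1 e).resolve_left (by norm_num)

/-! ### Word length -/

theorem coderivation_mem_of_wordLen {f : Lam V →ₗ[ℚ] V} {n : ℕ} {S : Submodule ℚ (Lam V)}
    (h : ∀ a b : ℕ, a + b = n → ∀ x ∈ wordLen V a, ∀ y ∈ wordLen V b, ι V (f x) * y ∈ S)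
    {x : Lam V} (hx : x ∈ wordLen V n) : coderivation f x ∈ S := by
  rw [coderivation, LinearMap.comp_apply, LinearMap.comp_apply, ← Submodule.mem_comap,
    ← Submodule.mem_comap]
  refine Submodule.span_le.2 ?_ (comul_mem_span hx)
  rintro _ ⟨a, b, hab, y, hy, y', hy', rfl⟩
  exact h a b hab y hy y' hy'

/-- If `f` vanishes on words with fewer than `m` letters, then `D_f` lowers the filtration by
`m - 1`. -/
theorem coderivation_filtration {f : Lam V →ₗ[ℚ] V} {m : ℕ}
    (hf : ∀ a < m, ∀ x ∈ wordLen V a, f x = 0) {p : ℤ} {x : Lam V} (hx : x ∈ filtration V p) :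
    coderivation f x ∈ filtration V (p - m + 1) := by
  have : filtration V p ≤ (filtration V (p - m + 1)).comap (coderivation f) := by
    refine filtration_le fun n hn x hx => ?_
    refine coderivation_mem_of_wordLen (fun a b hab x hx y hy => ?_) hx
    by_cases ha : a < m
    · rw [hf a ha x hx, map_zero, zero_mul]; exact Submodule.zero_mem _
    · exact wordLen_le_filtration (by push_cast; omega) (ι_mul_mem_wordLen (f x) hy)
  exact this hx

/-- If `f` vanishes on words with other than `m` letters, then `D_f` lowers the word length by
`m - 1`. -/
theorem coderivation_word {f : Lam V →ₗ[ℚ] V} {m : ℕ}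
    (hf : ∀ a, a ≠ m → ∀ x ∈ wordLen V a, f x = 0) {p : ℤ} {x : Lam V} (hx : x ∈ word V p) :
    coderivation f x ∈ word V (p - (m - 1)) := by
  by_cases hp : 0 ≤ p
  · lift p to ℕ using hp
    rw [word_natCast] at hx
    refine coderivation_mem_of_wordLen (fun a b hab x hx y hy => ?_) hx
    by_cases ha : a = m
    · subst ha
      rw [show (p : ℤ) - (a - 1) = ((b + 1 : ℕ) : ℤ) by push_cast; omega, word_natCast]
      exact ι_mul_mem_wordLen (f x) hy
    · rw [hf a ha x hx, map_zero, zero_mul]; exact Submodule.zero_mem _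
  · rw [word_of_neg (by omega), Submodule.mem_bot] at hx
    rw [hx, map_zero]; exact Submodule.zero_mem _

/-! ### Maps given on words -/

theorem wordLen_ofFn {n : ℕ} {S : Submodule ℚ (Lam V)}
    (h : ∀ (d : Fin n → ℤ) (x : Fin n → V), (∀ i, x i ∈ V.gr (d i)) →
      (List.ofFn fun i => ι V (x i)).prod ∈ S) : wordLen V n ≤ S := by
  intro x hx
  -- Quantifying over S allows the inductive step to replace S by its preimage under multiplication
  -- by the first letter.
  refine wordLen_induction (P := fun n x => ∀ S : Submodule ℚ (Lam V),
    (∀ (d : Fin n → ℤ) (x : Fin n → V), (∀ i, x i ∈ V.gr (d i)) →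
      (List.ofFn fun i => ι V (x i)).prod ∈ S) → x ∈ S) (fun n x y hx hy S h => ?_)
    (fun n c x hx S h => ?_) (fun S h => ?_) (fun i v hv n x _ hx S h => ?_) hx S h
  · exact Submodule.add_mem _ (hx S h) (hy S h)
  · exact Submodule.smul_mem _ _ (hx S h)
  · simpa using h (fun i => i.elim0) (fun i => i.elim0) (fun i => i.elim0)
  · refine hx (S.comap (LinearMap.mulLeft ℚ (ι V v))) fun d x hx => ?_
    have := h (Fin.cons i d) (Fin.cons v x) (fun j => by
      induction j using Fin.cases with
      | zero => exact hv
      | succ j => exact hx j)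
    rw [List.ofFn_succ, List.prod_cons] at this
    exact this

theorem descend_eq_on_wordLen {M : Type*} [AddCommGroup M] [Module ℚ M]
    {m m' : ∀ k : ℕ, MultilinearMap ℚ (fun _ : Fin k => V) M} (hm) (hm') {n : ℕ} (h : m n = m' n)
    {x : Lam V} (hx : x ∈ wordLen V n) : descend m hm x = descend m' hm' x := by
  have : wordLen V n ≤ LinearMap.eqLocus (descend m hm) (descend m' hm') :=
    wordLen_ofFn fun d x _ => by
      rw [LinearMap.mem_eqLocus, descend_prod, descend_prod, h]
  exact this hx

theorem descend_eq_zero_on_wordLen {M : Type*} [AddCommGroup M] [Module ℚ M]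
    {m : ∀ k : ℕ, MultilinearMap ℚ (fun _ : Fin k => V) M} (hm) {n : ℕ} (h : m n = 0)
    {x : Lam V} (hx : x ∈ wordLen V n) : descend m hm x = 0 := by
  have : wordLen V n ≤ LinearMap.ker (descend m hm) :=
    wordLen_ofFn fun d x _ => by
      rw [LinearMap.mem_ker, descend_prod, h]; rfl
  exact this hx

theorem descend_isHom {m : ∀ k : ℕ, MultilinearMap ℚ (fun _ : Fin k => V) V} (hm) {e : ℤ}
    (h : ∀ (k : ℕ) (d : Fin k → ℤ) (x : Fin k → V), (∀ i, x i ∈ V.gr (d i)) →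
      m k x ∈ V.gr (∑ i, d i + e)) : IsHom (descend m hm) e := by
  intro n x hx
  have : gr V n ≤ (V.gr (n + e)).comap (descend m hm) := by
    refine Submodule.span_le.2 ?_
    rintro _ ⟨l, rfl, rfl⟩
    have h1 := h l.length (fun i => (l.get i).1) (fun i => ((l.get i).2 : V))
      (fun i => (l.get i).2.2)
    have h2 : (l.map fun a => ι V (a.2 : V)) = List.ofFn fun i => ι V ((l.get i).2 : V) := by
      conv_lhs => rw [← List.ofFn_get l]
      rw [List.map_ofFn]; rfl
    have h3 : (l.map Sigma.fst).sum = ∑ i, (l.get i).1 := by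
      conv_lhs => rw [← List.ofFn_get l]
      rw [List.map_ofFn, List.sum_ofFn]; rfl
    rw [SetLike.mem_coe, Submodule.mem_comap, h2, descend_prod, h3]
    exact h1
  exact this hx

theorem proj_one : proj V 1 = 0 :=
  descend_eq_zero_on_wordLen _ rfl one_mem_wordLen

theorem proj_ι (v : V) : proj V (ι V v) = v := by
  have := descend_prod (idFamily V) (idFamily_gradedSymm V) (fun _ : Fin 1 => v)
  simpa [proj, idFamily] using this

theorem proj_of_mem_ne {n : ℕ} (h : n ≠ 1) {x : Lam V} (hx : x ∈ wordLen V n) : proj V x = 0 := by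
  refine descend_eq_zero_on_wordLen _ ?_ hx
  match n with
  | 0 => rfl
  | 1 => exact absurd rfl h
  | _ + 2 => rfl

theorem ι_proj (x : Lam V) : ι V (proj V x) = lenProj V 1 x := by
  induction x using wordLen_span with
  | add x y hx hy => simp only [map_add, hx, hy]
  | hom n x hx =>
    by_cases h : n = 1
    · subst h
      obtain ⟨v, rfl⟩ := wordLen_one hx
      rw [proj_ι, lenProj_of_mem hx]
    · rw [proj_of_mem_ne h hx, lenProj_of_mem_ne h hx, map_zero]

theorem proj_ι_mul (v : V) (x : Lam V) : proj V (ι V v * x) = counit V x • v := by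
  induction x using wordLen_span with
  | add x y hx hy => simp only [mul_add, map_add, hx, hy, add_smul]
  | hom n x hx =>
    cases n with
    | zero =>
      obtain ⟨c, rfl⟩ := wordLen_zero hx
      simp [proj_ι]
    | succ n =>
      rw [proj_of_mem_ne (by omega) (ι_mul_mem_wordLen v hx)]
      have h1 := toCoaugKer_eq_scale (V := V)
      have h2 : toCoaugKer V x = x := by rw [h1, scale_of_mem _ hx]; simp
      have h3 : counit V (toCoaugKer V x) = 0 := by rw [toCoaugKer_apply]; simp
      rw [h2] at h3
      rw [h3, zero_smul]

theorem proj_mem_gr (n : ℤ) (x : Lam V) (hx : x ∈ gr V n) : proj V x ∈ V.gr n := by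
  have : IsHom (proj V) 0 := descend_isHom _ fun k d x hx => by
    match k with
    | 0 => exact Submodule.zero_mem _
    | 1 => simpa [idFamily] using hx 0
    | _ + 2 => exact Submodule.zero_mem _
  simpa using this n x hx

/-- The factor left outside f must be a scalar, so only the term f(x) ⊗ 1 survives the projection.
Thus f is recovered from D_f as its corestriction. -/
theorem proj_coderivation (f : Lam V →ₗ[ℚ] V) (x : Lam V) : proj V (coderivation f x) = f x := by
  have h := counit_comul_right x
  have h2 : ∀ y : Lam V ⊗[ℚ] Lam V, proj V (LinearMap.mul' ℚ (Lam V)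
      (TensorProduct.map (ι V ∘ₗ f) LinearMap.id y)) = f (TensorProduct.rid ℚ _
        (TensorProduct.map LinearMap.id (counit V).toLinearMap y)) := by
    intro y
    induction y using TensorProduct.induction_on with
    | zero => simp
    | add a b ha hb => simp only [map_add, ha, hb]
    | tmul a b => simp [proj_ι_mul]
  rw [coderivation, LinearMap.comp_apply, LinearMap.comp_apply, h2, h]
  simp

end Lam

/-! ### Recursion for shuffles -/

/-- The permutation of `Fin (n + 1)` which takes the value `0` at `p` and is given by `τ` on the
other positions. -/
def insertZero {n : ℕ} (p : Fin (n + 1)) (τ : Equiv.Perm (Fin n)) : Equiv.Perm (Fin (n + 1)) :=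
  (finSuccEquiv' p).trans ((Equiv.optionCongr τ).trans (finSuccEquiv n).symm)

variable {n : ℕ}

@[simp] theorem insertZero_self (p : Fin (n + 1)) (τ : Equiv.Perm (Fin n)) :
    insertZero p τ p = 0 := by simp [insertZero]

@[simp] theorem insertZero_succAbove (p : Fin (n + 1)) (τ : Equiv.Perm (Fin n)) (j : Fin n) :
    insertZero p τ (p.succAbove j) = (τ j).succ := by simp [insertZero]

/-- The position p is recovered as the preimage of 0 and τ from the remaining values; surjectivity
follows from (n + 1) · n! = (n + 1)!. -/
theorem insertZero_bijective :
    Function.Bijective fun q : Fin (n + 1) × Equiv.Perm (Fin n) => insertZero q.1 q.2 := by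
  rw [Fintype.bijective_iff_injective_and_card]
  constructor
  · rintro ⟨p, τ⟩ ⟨p', τ'⟩ h
    have h0 : insertZero p τ = insertZero p' τ' := h
    obtain rfl : p = p' := by
      apply (insertZero p τ).injective
      rw [insertZero_self, h0, insertZero_self]
    have : τ = τ' := by
      ext j
      have := DFunLike.congr_fun h0 (p.succAbove j)
      simpa [Fin.ext_iff] using this
    rw [this]
  · simp [Fintype.card_perm, Nat.factorial_succ]

theorem sum_perm_succ {M : Type*} [AddCommMonoid M] (G : Equiv.Perm (Fin (n + 1)) → M) :
    ∑ σ, G σ = ∑ p, ∑ τ, G (insertZero p τ) := by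
  rw [← Fintype.sum_prod_type']
  exact (Function.Bijective.sum_comp insertZero_bijective G).symm

theorem val_succAbove (p : Fin (n + 1)) (j : Fin n) :
    (p.succAbove j : ℕ) = if (j : ℕ) < p then (j : ℕ) else j + 1 := by
  rw [Fin.succAbove]
  simp only [Fin.lt_def, Fin.val_castSucc]
  split_ifs <;> simp

/-- The least value must head one of the two increasing blocks: it sits at position 0 if the first
block is nonempty, or at position i. -/
theorem isShuffle_insertZero (i : ℕ) (p : Fin (n + 1)) (τ : Equiv.Perm (Fin n)) :
    IsShuffle i (insertZero p τ) ↔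
      ((p : ℕ) = 0 ∧ 1 ≤ i ∧ IsShuffle (i - 1) τ) ∨ ((p : ℕ) = i ∧ IsShuffle i τ) := by
  constructor
  · intro h
    have hp : ((p : ℕ) = 0 ∧ 1 ≤ i) ∨ (p : ℕ) = i := by
      by_contra hc
      have hp := p.2
      rcases lt_or_ge i (p : ℕ) with hip | hip
      · have := h ⟨i, by omega⟩ p (Fin.lt_def.2 hip) (Or.inr le_rfl)
        rw [insertZero_self] at this
        exact absurd this (Fin.not_lt_zero _)
      · have := h ⟨0, by omega⟩ p (Fin.lt_def.2 (by simp only; omega)) (Or.inl (by omega))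
        rw [insertZero_self] at this
        exact absurd this (Fin.not_lt_zero _)
    have key : ∀ a b : Fin n, a < b → ((p.succAbove b : ℕ) < i ∨ i ≤ (p.succAbove a : ℕ)) →
        τ a < τ b := by
      intro a b hab hi
      have := h (p.succAbove a) (p.succAbove b) (Fin.succAbove_lt_succAbove_iff.2 hab) hi
      rwa [insertZero_succAbove, insertZero_succAbove, Fin.succ_lt_succ_iff] at this
    rcases hp with ⟨hp, hi⟩ | hp
    · refine Or.inl ⟨hp, hi, fun a b hab hi' => key a b hab ?_⟩
      rw [val_succAbove, val_succAbove, hp]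
      simp only [Nat.not_lt_zero, if_false]
      omega
    · refine Or.inr ⟨hp, fun a b hab hi' => key a b hab ?_⟩
      rw [val_succAbove, val_succAbove, hp]
      split_ifs <;> omega
  · intro h a b hab hi
    rw [Fin.lt_def] at hab
    rcases Fin.eq_self_or_eq_succAbove p a with rfl | ⟨a, rfl⟩
    · rw [insertZero_self]
      rcases Fin.eq_self_or_eq_succAbove a b with rfl | ⟨b, rfl⟩
      · omega
      · rw [insertZero_succAbove]; exact Fin.succ_pos _
    · rcases Fin.eq_self_or_eq_succAbove p b with rfl | ⟨b, rfl⟩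
      · rcases h with ⟨hp, _, _⟩ | ⟨hp, _⟩ <;> omega
      · rw [insertZero_succAbove, insertZero_succAbove, Fin.succ_lt_succ_iff]
        have hab' : a < b := Fin.succAbove_lt_succAbove_iff.1 (Fin.lt_def.2 hab)
        rw [val_succAbove, val_succAbove] at hi
        rcases h with ⟨hp, hi', hτ⟩ | ⟨hp, hτ⟩
        · refine hτ a b hab' ?_
          rw [hp] at hi
          simp only [Nat.not_lt_zero, if_false] at hi
          omega
        · refine hτ a b hab' ?_
          rw [Fin.lt_def] at hab'
          split_ifs at hi <;> omega

/-- The two summands correspond to the first letter entering the first or the second block, matching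
the two terms of `coderivation_ι_mul`. The side conditions say that the block in question is
nonempty. -/
theorem sum_shuffle_succ {M : Type*} [AddCommMonoid M] (i : ℕ)
    (G : Equiv.Perm (Fin (n + 1)) → M) :
    ∑ σ with IsShuffle i σ, G σ =
      (if 1 ≤ i then ∑ τ with IsShuffle (i - 1) τ, G (insertZero 0 τ) else 0) +
      if h : i < n + 1 then ∑ τ with IsShuffle i τ, G (insertZero ⟨i, h⟩ τ) else 0 := by
  have key : ∀ (p : Fin (n + 1)) (τ : Equiv.Perm (Fin n)),
      (if IsShuffle i (insertZero p τ) then G (insertZero p τ) else 0) =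
      (if (p : ℕ) = 0 then if 1 ≤ i then if IsShuffle (i - 1) τ then G (insertZero p τ) else 0
        else 0 else 0) +
      (if (p : ℕ) = i then if IsShuffle i τ then G (insertZero p τ) else 0 else 0) := by
    intro p τ
    have := isShuffle_insertZero i p τ
    by_cases h1 : (p : ℕ) = 0
    · by_cases h2 : (p : ℕ) = i
      · have : ¬ 1 ≤ i := by omega
        simp_all
      · by_cases h3 : 1 ≤ i <;> simp_all
    · by_cases h2 : (p : ℕ) = i <;> simp_all
  rw [Finset.sum_filter, sum_perm_succ]
  simp only [key, Finset.sum_add_distrib]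
  congr 1
  · rw [Finset.sum_eq_single 0]
    · by_cases h : 1 ≤ i <;> simp [h, Finset.sum_filter]
    · intro p _ hp
      have : (p : ℕ) ≠ 0 := fun h => hp (Fin.ext h)
      simp [this]
    · simp
  · split_ifs with h
    · rw [Finset.sum_eq_single ⟨i, h⟩]
      · simp [Finset.sum_filter]
      · intro p _ hp
        have : (p : ℕ) ≠ i := fun h' => hp (Fin.ext h')
        simp [this]
      · simp
    · refine Finset.sum_eq_zero fun p _ => ?_
      have : (p : ℕ) ≠ i := by have := p.2; omega
      simp [this]

/-- Since 0 is the least value, it forms an inversion with exactly the letters placed before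
position p. -/
theorem koszulSign_insertZero (d : Fin (n + 1) → ℤ) (p : Fin (n + 1)) (τ : Equiv.Perm (Fin n)) :
    koszulSign d (insertZero p τ) =
      (∏ j : Fin n, if (j : ℕ) < p then (-1 : ℚ) ^ (d (τ j).succ * d 0) else 1) *
        koszulSign (fun j => d j.succ) τ := by
  unfold koszulSign
  rw [Fin.prod_univ_succAbove _ p]
  have h1 : (∏ b, if p < b ∧ insertZero p τ b < insertZero p τ p then
      (-1 : ℚ) ^ (d (insertZero p τ p) * d (insertZero p τ b)) else 1) = 1 := by
    refine Finset.prod_eq_one fun b _ => ?_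
    rw [insertZero_self, if_neg (fun h => Fin.not_lt_zero _ h.2)]
  rw [h1, one_mul, ← Finset.prod_mul_distrib]
  refine Finset.prod_congr rfl fun a _ => ?_
  rw [Fin.prod_univ_succAbove _ p]
  simp only [insertZero_self, insertZero_succAbove, Fin.succ_pos, and_true,
    Fin.succAbove_lt_succAbove_iff, Fin.succ_lt_succ_iff, Fin.succAbove_lt_iff_castSucc_lt]
  simp only [Fin.lt_def, Fin.val_castSucc]

/-! ### Coderivations in terms of shuffles -/

theorem ofFn_insertZero {α : Type*} (x : Fin (n + 1) → α) (p : Fin (n + 1))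
    (τ : Equiv.Perm (Fin n)) :
    (List.ofFn fun j => x (insertZero p τ j)).take p =
      (List.ofFn fun j => x (τ j).succ).take p ∧
    (List.ofFn fun j => x (insertZero p τ j)).drop p =
      x 0 :: (List.ofFn fun j => x (τ j).succ).drop p := by
  have hp := p.2
  have hlt : ∀ (j : ℕ) (hj : j < p), insertZero p τ ⟨j, by omega⟩ = (τ ⟨j, by omega⟩).succ := by
    intro j hj
    rw [← insertZero_succAbove p]
    congr 1
    exact Fin.ext (by rw [val_succAbove]; simp [hj])
  have hge : ∀ (j : ℕ) (hj : p ≤ j) (hn : j < n),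
      insertZero p τ ⟨j + 1, by omega⟩ = (τ ⟨j, hn⟩).succ := by
    intro j hj hn
    rw [← insertZero_succAbove p]
    congr 1
    exact Fin.ext (by rw [val_succAbove]; simp [hj])
  constructor
  · apply List.ext_getElem
    · simp; omega
    · intro j h1 h2
      simp only [List.length_take, List.length_ofFn] at h1
      simp only [List.getElem_take, List.getElem_ofFn]
      rw [hlt j (by omega)]
  · apply List.ext_getElem
    · simp; omega
    · intro j h1 h2
      simp only [List.length_drop, List.length_ofFn] at h1
      cases j with
      | zero =>
        simp only [List.getElem_drop, List.getElem_ofFn, List.getElem_cons_zero, Nat.add_zero,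
          Fin.eta, insertZero_self]
      | succ j =>
        simp only [List.getElem_drop, List.getElem_ofFn, List.getElem_cons_succ, ← Nat.add_assoc]
        rw [hge _ (by omega)]

namespace Lam

variable {V : GradedSpace.{u}}

theorem take_mem_gr (d : Fin n → ℤ) (x : Fin n → V) (hx : ∀ i, x i ∈ V.gr (d i)) (i : ℕ) :
    ((List.ofFn fun j => ι V (x j)).take i).prod ∈ gr V (∑ j : Fin n, if (j : ℕ) < i then d j else 0) := by
  induction n generalizing i with
  | zero => simpa using SetLike.GradedOne.one_mem (A := gr V)
  | succ n ih =>
    cases i with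
    | zero => simpa using SetLike.GradedOne.one_mem (A := gr V)
    | succ i =>
      rw [List.ofFn_succ, List.take_succ_cons, List.prod_cons, Fin.sum_univ_succ]
      simpa using ι_mul_mem_gr (hx 0) (ih (fun j => d j.succ) _ (fun j => hx j.succ) i)

/-- The term of a shuffle in the expansion of a coderivation on a word. -/
noncomputable def shuffleTerm (f : Lam V →ₗ[ℚ] V) (x : Fin n → V) (i : ℕ)
    (σ : Equiv.Perm (Fin n)) : Lam V :=
  ι V (f ((List.ofFn fun j => ι V (x (σ j))).take i).prod) *
    ((List.ofFn fun j => ι V (x (σ j))).drop i).prod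

theorem shuffleTerm_insertZero_zero (f : Lam V →ₗ[ℚ] V) (x : Fin (n + 1) → V) (i : ℕ)
    (τ : Equiv.Perm (Fin n)) :
    shuffleTerm f x (i + 1) (insertZero 0 τ) =
      shuffleTerm (contract f (x 0)) (fun j => x j.succ) i τ := by
  have h : (List.ofFn fun j => ι V (x (insertZero 0 τ j))) =
      ι V (x 0) :: List.ofFn fun j => ι V (x (τ j).succ) :=
    (ofFn_insertZero (fun j => ι V (x j)) 0 τ).2
  rw [shuffleTerm, h, List.take_succ_cons, List.drop_succ_cons, List.prod_cons]
  rfl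

/-- Here x 0 heads the second block and must move left past f(first block), of degree e plus that of
the block. The block's part of this sign cancels against the inversions created by inserting 0,
leaving (-1)^(e · d 0). -/
theorem shuffleTerm_insertZero_self {f : Lam V →ₗ[ℚ] V} {e : ℤ} (hf : IsHom f e)
    (d : Fin (n + 1) → ℤ) (x : Fin (n + 1) → V) (hx : ∀ i, x i ∈ V.gr (d i)) (p : Fin (n + 1))
    (τ : Equiv.Perm (Fin n)) :
    koszulSign d (insertZero p τ) • shuffleTerm f x p (insertZero p τ) =
      (-1 : ℚ) ^ (e * d 0) • (ι V (x 0) *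
        (koszulSign (fun j => d j.succ) τ • shuffleTerm f (fun j => x j.succ) p τ)) := by
  obtain ⟨h1, h2⟩ := ofFn_insertZero (fun j => ι V (x j)) p τ
  have h3 := take_mem_gr (fun j => d (τ j).succ) (fun j => x (τ j).succ) (fun j => hx _) p
  have h4 : (∏ j : Fin n, if (j : ℕ) < p then (-1 : ℚ) ^ (d (τ j).succ * d 0) else 1) =
      (-1 : ℚ) ^ ((∑ j : Fin n, if (j : ℕ) < p then d (τ j).succ else 0) * d 0) := by
    have : ∀ s : Finset (Fin n),
        (∏ j ∈ s, if (j : ℕ) < p then (-1 : ℚ) ^ (d (τ j).succ * d 0) else 1) =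
        (-1 : ℚ) ^ ((∑ j ∈ s, if (j : ℕ) < p then d (τ j).succ else 0) * d 0) := by
      intro s
      induction s using Finset.induction_on with
      | empty => simp
      | insert a s ha ih =>
        rw [Finset.prod_insert ha, Finset.sum_insert ha, ih, add_mul, negOne_zpow_add]
        congr 1
        split_ifs <;> simp
    exact this _
  rw [koszulSign_insertZero, h4, shuffleTerm, h1, h2, List.prod_cons, ← mul_assoc,
    ι_mul_ι (hf _ _ h3) (hx 0), smul_mul_assoc, mul_assoc, mul_smul_comm, smul_smul, smul_smul,
    add_mul, negOne_zpow_add]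
  have h5 := negOne_zpow_mul_self
    ((∑ j : Fin n, if (j : ℕ) < p then d (τ j).succ else 0) * d 0)
  generalize (-1 : ℚ) ^ ((∑ j : Fin n, if (j : ℕ) < p then d (τ j).succ else 0) * d 0) = s at h5
  rw [show s * koszulSign (fun j => d j.succ) τ * (s * (-1 : ℚ) ^ (e * d 0)) =
    (s * s) * ((-1 : ℚ) ^ (e * d 0) * koszulSign (fun j => d j.succ) τ) by ring, h5, one_mul]
  rfl

/-- Both sides obey the same recursion on the first letter: contraction for the first block, passing
over for the second. This is the bridge from the coalgebra description to the shuffle sums of the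
Jacobi identities. -/
theorem coderivation_ofFn {f : Lam V →ₗ[ℚ] V} {e : ℤ} (hf : IsHom f e) (d : Fin n → ℤ)
    (x : Fin n → V) (hx : ∀ i, x i ∈ V.gr (d i)) :
    coderivation f (List.ofFn fun i => ι V (x i)).prod =
      ∑ i ∈ Finset.range (n + 1), ∑ σ with IsShuffle i σ, koszulSign d σ • shuffleTerm f x i σ := by
  induction n generalizing f e with
  | zero =>
    have : ∀ σ : Equiv.Perm (Fin 0), IsShuffle 0 σ := fun σ a => a.elim0
    simp [coderivation_one, Finset.filter_true_of_mem, this, koszulSign, shuffleTerm]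
  | succ n ih =>
    rw [List.ofFn_succ, List.prod_cons, coderivation_ι_mul hf (hx 0),
      ih (hf.contract (hx 0)) (fun j => d j.succ) (fun j => x j.succ) (fun j => hx j.succ),
      ih hf (fun j => d j.succ) (fun j => x j.succ) (fun j => hx j.succ)]
    simp only [sum_shuffle_succ, Finset.sum_add_distrib]
    congr 1
    -- The first block contains the letter only when it has at least one place, hence the shift from
    -- i to i + 1. In the other half, the term i = n + 1 drops out because the second block is
    -- empty.
    · rw [Finset.sum_range_succ' _ (n + 1)]
      simp [shuffleTerm_insertZero_zero, koszulSign_insertZero]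
    · rw [Finset.sum_range_succ _ (n + 1), dif_neg (lt_irrefl _), add_zero, Finset.mul_sum,
        Finset.smul_sum]
      refine Finset.sum_congr rfl fun i hi => ?_
      rw [dif_pos (Finset.mem_range.1 hi), Finset.mul_sum, Finset.smul_sum]
      refine Finset.sum_congr rfl fun τ _ => ?_
      exact (shuffleTerm_insertZero_self hf d x hx ⟨i, Finset.mem_range.1 hi⟩ τ).symm

end Lam

/-! ### Comparison of signs -/

theorem sgn_eq_prod (σ : Equiv.Perm (Fin n)) :
    sgn σ = ∏ a, ∏ b, if a < b ∧ σ b < σ a then (-1 : ℚ) else 1 := by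
  rw [sgn, Equiv.Perm.sign_eq_prod_prod_Ioi]
  push_cast
  refine Finset.prod_congr rfl fun a _ => ?_
  rw [← Finset.prod_subset (Finset.subset_univ (Finset.Ioi a))]
  · refine Finset.prod_congr rfl fun b hb => ?_
    have hab := Finset.mem_Ioi.1 hb
    have hne : σ a ≠ σ b := fun h => hab.ne (σ.injective h)
    rcases hne.lt_or_gt with h | h
    · rw [if_pos h, if_neg (fun h' => absurd h'.2 h.asymm)]; simp
    · rw [if_neg h.asymm, if_pos ⟨hab, h⟩]; simp
  · intro b _ hb
    rw [if_neg (fun h => hb (Finset.mem_Ioi.2 h.1))]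

/-- For each a there are σ a indices b with σ b < σ a, and a indices b < a. Those in both sets
contribute u² = 1; the rest are exactly the inversions involving a. So modulo squares, u (σ a)
occurs a + σ a times. -/
theorem prod_inversions (u : Fin n → ℚ) (hu : ∀ a, u a * u a = 1) (σ : Equiv.Perm (Fin n)) :
    (∏ a, ∏ b, if a < b ∧ σ b < σ a then u (σ a) * u (σ b) else 1) =
      ∏ a, u (σ a) ^ ((a : ℕ) + σ a) := by
  have h1 : (∏ a, ∏ b, if a < b ∧ σ b < σ a then u (σ a) * u (σ b) else 1) =
      (∏ a, ∏ b, if a < b ∧ σ b < σ a then u (σ a) else 1) *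
        ∏ a, ∏ b, if b < a ∧ σ a < σ b then u (σ a) else 1 := by
    rw [Finset.prod_comm (f := fun a b => if b < a ∧ σ a < σ b then u (σ a) else 1),
      ← Finset.prod_mul_distrib]
    refine Finset.prod_congr rfl fun a _ => ?_
    rw [← Finset.prod_mul_distrib]
    refine Finset.prod_congr rfl fun b _ => ?_
    split_ifs <;> simp
  rw [h1, ← Finset.prod_mul_distrib]
  refine Finset.prod_congr rfl fun a _ => ?_
  have h2 : (∏ b, if σ b < σ a then u (σ a) else 1) = u (σ a) ^ (σ a : ℕ) := by
    rw [Equiv.prod_comp σ (fun b => if b < σ a then u (σ a) else 1), Finset.prod_ite]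
    rw [Finset.prod_const, Finset.prod_const_one, mul_one, Finset.filter_gt_eq_Iio, Fin.card_Iio]
  have h3 : (∏ b, if b < a then u (σ a) else 1) = u (σ a) ^ (a : ℕ) := by
    rw [Finset.prod_ite]
    rw [Finset.prod_const, Finset.prod_const_one, mul_one, Finset.filter_gt_eq_Iio, Fin.card_Iio]
  rw [pow_add, ← h2, ← h3, ← Finset.prod_mul_distrib, ← Finset.prod_mul_distrib]
  refine Finset.prod_congr rfl fun b _ => ?_
  rcases lt_trichotomy a b with hab | rfl | hab
  · simp [hab, hab.asymm]
  · simp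
  · have hne : σ a ≠ σ b := fun h => hab.ne' (σ.injective h)
    rcases hne.lt_or_gt with h | h
    · simp [hab, hab.asymm, h, h.asymm]
    · simp [hab, hab.asymm, h, h.asymm, hu]

/-- Décalage: lowering all degrees by one changes each inversion by -1, which collects to the
signature, and by the signs of its two letters, which collect by `prod_inversions`. The latter are
the discrepancy between the signs of (s⁻¹)^{⊗n} before and after permuting. -/
theorem koszulSign_suspend (d : Fin n → ℤ) (σ : Equiv.Perm (Fin n)) :
    koszulSign d σ * ∏ a, ((-1 : ℚ) ^ d (σ a)) ^ (n - 1 - (a : ℕ)) =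
      koszulSign (fun a => d a - 1) σ * sgn σ * ∏ a, ((-1 : ℚ) ^ d a) ^ (n - 1 - (a : ℕ)) := by
  have hu : ∀ a, (-1 : ℚ) ^ d a * (-1 : ℚ) ^ d a = 1 := fun a => negOne_zpow_mul_self _
  have h1 : koszulSign d σ = koszulSign (fun a => d a - 1) σ * sgn σ *
      ∏ a, ((-1 : ℚ) ^ d (σ a)) ^ ((a : ℕ) + σ a) := by
    rw [← prod_inversions (fun a => (-1 : ℚ) ^ d a) hu, sgn_eq_prod, koszulSign, koszulSign,
      ← Finset.prod_mul_distrib, ← Finset.prod_mul_distrib]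
    refine Finset.prod_congr rfl fun a _ => ?_
    rw [← Finset.prod_mul_distrib, ← Finset.prod_mul_distrib]
    refine Finset.prod_congr rfl fun b _ => ?_
    split_ifs
    · have h1 : d (σ a) * d (σ b) =
        (d (σ a) - 1) * (d (σ b) - 1) + (d (σ a) + d (σ b)) + -1 := by ring
      rw [h1, negOne_zpow_add, negOne_zpow_add, negOne_zpow_add]
      norm_num
    · simp
  rw [h1, mul_assoc _ _ (∏ a, ((-1 : ℚ) ^ d (σ a)) ^ (n - 1 - (a : ℕ))), ← Finset.prod_mul_distrib]
  congr 1
  rw [← Equiv.prod_comp σ fun a => ((-1 : ℚ) ^ d a) ^ (n - 1 - (a : ℕ))]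
  refine Finset.prod_congr rfl fun a _ => ?_
  have ha := a.2
  have hb := (σ a).2
  have h2 : ∀ k : ℕ, ((-1 : ℚ) ^ d (σ a)) ^ (2 * k) = 1 := fun k => by
    rw [pow_mul, pow_two, hu, one_pow]
  rw [← pow_add, show (a : ℕ) + σ a + (n - 1 - a) = 2 * (σ a : ℕ) + (n - 1 - σ a) by omega,
    pow_add, h2, one_mul]


theorem prod_fin_split {M : Type*} [CommMonoid M] {m r n : ℕ} (h : m + r = n) (g : Fin n → M) :
    ∏ a, g a = (∏ a : Fin m, g (Fin.castLE (by omega) a)) *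
      ∏ b : Fin r, g ⟨m + b, by omega⟩ := by
  subst h
  rw [Fin.prod_univ_add]
  rfl

theorem take_ofFn {α : Type*} {m n : ℕ} (h : m ≤ n) (g : Fin n → α) :
    (List.ofFn g).take m = List.ofFn fun a : Fin m => g (Fin.castLE h a) := by
  apply List.ext_getElem
  · simp [h]
  · intro j h1 h2
    simp

theorem drop_ofFn {α : Type*} {m n : ℕ} (h : m ≤ n) (g : Fin n → α) :
    (List.ofFn g).drop m = List.ofFn fun b : Fin (n - m) => g ⟨m + b, by omega⟩ := by
  apply List.ext_getElem
  · simp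
  · intro j h1 h2
    simp

/-- The triangular exponent of m + r differs from the sum of those of m and r by mr. This matches
the normalizations of an inner bracket with m inputs and an outer one with r + 1 inputs to the sign
in the Jacobi identity. -/
theorem negOne_triangle (m r : ℕ) :
    (-1 : ℚ) ^ (m * (m - 1) / 2) * (-1) ^ ((r + 1) * (r + 1 - 1) / 2) * (-1) ^ r =
      (-1) ^ ((m + r) * (m + r - 1) / 2) * (-1) ^ (m * r) := by
  have key : (m + r) * (m + r - 1) / 2 = m * (m - 1) / 2 + r * (r - 1) / 2 + m * r := by
    induction r with
    | zero => simp
    | succ r ih =>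
      rw [← add_assoc, Nat.triangle_succ (m + r), Nat.triangle_succ r, ih]
      ring
  rw [key, Nat.triangle_succ]
  simp only [pow_add]
  have h : ∀ k : ℕ, (-1 : ℚ) ^ k * (-1) ^ k = 1 := fun k => by rw [← mul_pow]; simp
  rw [mul_assoc _ ((-1 : ℚ) ^ (m * r)), h, mul_one, mul_assoc, mul_assoc, h, mul_one]

/-! ### From the Jacobi identities to the filtered complex of Quillen chains -/

namespace LInfinityStructure

variable {V : GradedSpace.{u}} (L : LInfinityStructure V)

/-- The linear map `ΛsL → sL` with components `hₖ`. -/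
noncomputable def hTotal : Lam V.susp →ₗ[ℚ] V.susp := Lam.descend L.h L.h_gradedSymm

theorem h_mem {k : ℕ} (d : Fin k → ℤ) (x : Fin k → V.susp) (hx : ∀ i, x i ∈ V.susp.gr (d i)) :
    L.h k x ∈ V.susp.gr (∑ i, d i + -1) := by
  rw [L.h_apply d x hx]
  refine Submodule.smul_mem _ _ (Submodule.smul_mem _ _ ?_)
  have := L.degree k (fun i => d i - 1) (fun i => V.s.symm (x i)) hx
  rw [Finset.sum_sub_distrib] at this
  simp only [Finset.sum_const, Finset.card_univ, Fintype.card_fin, nsmul_eq_mul, mul_one] at this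
  rw [show ∑ i, d i - (k : ℤ) + k - 2 = ∑ i, d i + -1 - 1 by ring] at this
  exact this

theorem hTotal_isHom : Lam.IsHom L.hTotal (-1) :=
  Lam.descend_isHom _ fun _ d x hx => L.h_mem d x hx

theorem h_zero : L.h 0 = 0 := by
  unfold h
  rw [L.ℓ_zero]
  ext x
  simp

/-- The point is that the prefactor on the right depends neither on m nor on σ, so that summing
gives a multiple of the Jacobi expression. -/
theorem hTotal_shuffleTerm {n m : ℕ} (hm : m ≤ n) (d : Fin n → ℤ) (x : Fin n → V.susp)
    (hx : ∀ i, x i ∈ V.susp.gr (d i)) (σ : Equiv.Perm (Fin n)) :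
    koszulSign d σ • L.hTotal (Lam.shuffleTerm L.hTotal x m σ) =
      ((-1 : ℚ) ^ (n * (n - 1) / 2) * ∏ a, ((-1 : ℚ) ^ d a) ^ (n - 1 - (a : ℕ))) • V.s
        ((koszulSign (fun a => d a - 1) σ * sgn σ * (-1 : ℚ) ^ (m * (n - m))) •
          L.ℓ (n - m + 1) (Fin.cons (L.ℓ m fun a => V.s.symm (x (σ (Fin.castLE hm a))))
            (fun b : Fin (n - m) => V.s.symm (x (σ ⟨m + b, by omega⟩))) :
              Fin (n - m + 1) → V)) := by
  let z : V.susp := L.h m fun a : Fin m => x (σ (Fin.castLE hm a))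
  let w : Fin (n - m) → V.susp := fun b => x (σ ⟨m + b, by omega⟩)
  have hz : z ∈ V.susp.gr (∑ a : Fin m, d (σ (Fin.castLE hm a)) + -1) :=
    L.h_mem _ _ fun a => hx _
  have e1 : L.hTotal (Lam.shuffleTerm L.hTotal x m σ) =
      L.h (n - m + 1) (Fin.cons z w : Fin (n - m + 1) → V.susp) := by
    have h1 : L.hTotal ((List.ofFn fun j => Lam.ι V.susp (x (σ j))).take m).prod = z := by
      rw [take_ofFn hm]
      exact Lam.descend_prod _ _ _
    rw [Lam.shuffleTerm, h1, drop_ofFn hm]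
    have := Lam.descend_prod L.h L.h_gradedSymm (Fin.cons z w : Fin (n - m + 1) → V.susp)
    rw [List.ofFn_succ, List.prod_cons] at this
    exact this
  have e2 : (fun i => V.s.symm ((Fin.cons z w : Fin (n - m + 1) → V.susp) i)) =
      (Fin.cons (((-1 : ℚ) ^ (m * (m - 1) / 2) *
        ∏ a : Fin m, ((-1 : ℚ) ^ d (σ (Fin.castLE hm a))) ^ (m - 1 - (a : ℕ))) •
          L.ℓ m fun a => V.s.symm (x (σ (Fin.castLE hm a)))) (fun b => V.s.symm (w b)) :
            Fin (n - m + 1) → V) := by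
    funext i
    refine Fin.cases ?_ (fun b => ?_) i
    · rw [Fin.cons_zero, Fin.cons_zero]
      change V.s.symm (L.h m _) = _
      rw [L.h_apply (fun a => d (σ (Fin.castLE hm a))) _ fun a => hx _, map_smul, map_smul,
        LinearEquiv.symm_apply_apply, smul_smul]
    · rw [Fin.cons_succ, Fin.cons_succ]
  have e3 : ∏ a : Fin n, ((-1 : ℚ) ^ d (σ a)) ^ (n - 1 - (a : ℕ)) =
      (∏ a : Fin m, ((-1 : ℚ) ^ d (σ (Fin.castLE hm a))) ^ (n - 1 - (a : ℕ))) *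
      ∏ b : Fin (n - m), ((-1 : ℚ) ^ d (σ ⟨m + b, by omega⟩)) ^ (n - 1 - (m + (b : ℕ))) :=
    prod_fin_split (show m + (n - m) = n by omega) _
  -- The inner output has degree Σ d - 1 and precedes n - m further inputs. The Σ d part of its sign
  -- raises the exponents m - 1 - a to n - 1 - a; the -1 part is the factor (-1)^(n-m) in `e8`.
  have e4 : (∏ a : Fin m, ((-1 : ℚ) ^ d (σ (Fin.castLE hm a))) ^ (m - 1 - (a : ℕ))) *
      ((-1 : ℚ) ^ (∑ a : Fin m, d (σ (Fin.castLE hm a)))) ^ (n - m) =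
      ∏ a : Fin m, ((-1 : ℚ) ^ d (σ (Fin.castLE hm a))) ^ (n - 1 - (a : ℕ)) := by
    have h1 : ∀ s : Finset (Fin m), (-1 : ℚ) ^ (∑ a ∈ s, d (σ (Fin.castLE hm a))) =
        ∏ a ∈ s, (-1 : ℚ) ^ d (σ (Fin.castLE hm a)) := by
      intro s
      induction s using Finset.induction_on with
      | empty => simp
      | insert a s ha ih => rw [Finset.sum_insert ha, Finset.prod_insert ha, negOne_zpow_add, ih]
    rw [h1, ← Finset.prod_pow, ← Finset.prod_mul_distrib]
    refine Finset.prod_congr rfl fun a _ => ?_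
    have := a.2
    rw [← pow_add]
    congr 1
    omega
  have hd : ∀ i, (Fin.cons z w : Fin (n - m + 1) → V.susp) i ∈ V.susp.gr
      ((Fin.cons (∑ a : Fin m, d (σ (Fin.castLE hm a)) + -1)
        (fun b : Fin (n - m) => d (σ ⟨m + b, by omega⟩)) : Fin (n - m + 1) → ℤ) i) := by
    intro i
    refine Fin.cases ?_ (fun b => ?_) i
    · exact hz
    · exact hx _
  have e5 := koszulSign_suspend d σ
  have e6 := negOne_triangle m (n - m)
  rw [Nat.add_sub_cancel' hm] at e6
  rw [e1, L.h_apply _ _ hd, e2, MultilinearMap.cons_smul, Fin.prod_univ_succ]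
  simp only [Fin.cons_zero, Fin.cons_succ, Fin.val_zero, Fin.val_succ, map_smul, smul_smul]
  congr 1
  have e7 : ∏ b : Fin (n - m), ((-1 : ℚ) ^ d (σ ⟨m + b, by omega⟩)) ^ (n - m + 1 - 1 - ((b : ℕ) + 1)) =
      ∏ b : Fin (n - m), ((-1 : ℚ) ^ d (σ ⟨m + b, by omega⟩)) ^ (n - 1 - (m + (b : ℕ))) :=
    Finset.prod_congr rfl fun b _ => by congr 1; omega
  have e8 : ((-1 : ℚ) ^ (∑ a : Fin m, d (σ (Fin.castLE hm a)) + -1)) ^ (n - m + 1 - 1 - 0) =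
      ((-1 : ℚ) ^ (∑ a : Fin m, d (σ (Fin.castLE hm a)))) ^ (n - m) * (-1) ^ (n - m) := by
    rw [negOne_zpow_add, mul_pow]
    norm_num
  rw [e7, e8]
  rw [e3, ← e4] at e5
  linear_combination ((-1 : ℚ) ^ (m * (m - 1) / 2) * (-1) ^ ((n - m + 1) * (n - m + 1 - 1) / 2) *
    (-1) ^ (n - m)) * e5 + koszulSign (fun a => d a - 1) σ * sgn σ *
      (∏ a, ((-1 : ℚ) ^ d a) ^ (n - 1 - (a : ℕ))) * e6

theorem hTotal_δ : L.hTotal ∘ₗ L.δ = 0 := by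
  ext x
  induction x using Lam.wordLen_span with
  | add x y hx hy => rw [map_add, hx, hy, map_add]
  | hom n x hx =>
    have : Lam.wordLen V.susp n ≤ LinearMap.ker (L.hTotal ∘ₗ L.δ) := by
      refine Lam.wordLen_ofFn fun d x hx => ?_
      have h0 : L.hTotal 1 = 0 :=
        Lam.descend_eq_zero_on_wordLen _ L.h_zero Lam.one_mem_wordLen
      have h1 := Lam.coderivation_ofFn L.hTotal_isHom d x hx
      change L.hTotal (Lam.coderivation L.hTotal _) = 0
      -- The shuffle sum starts with an empty inner block and the Jacobi sum with one input. The
      -- extra term is zero since there is no bracket without inputs.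
      rw [h1, Finset.sum_range_succ', map_add, map_sum]
      have h2 : L.hTotal (∑ σ with IsShuffle 0 σ,
          koszulSign d σ • Lam.shuffleTerm L.hTotal x 0 σ) = 0 := by
        rw [map_sum]
        refine Finset.sum_eq_zero fun σ _ => ?_
        simp [Lam.shuffleTerm, h0]
      rw [h2, add_zero]
      simp only [map_sum, map_smul]
      rw [Finset.sum_range]
      rcases Nat.eq_zero_or_pos n with rfl | hn
      · simp
      have h3 := L.jacobi n hn (fun a => d a - 1) (fun a => V.s.symm (x a)) hx
      have h4 := congrArg (fun y => ((-1 : ℚ) ^ (n * (n - 1) / 2) *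
        ∏ a, ((-1 : ℚ) ^ d a) ^ (n - 1 - (a : ℕ))) • V.s y) h3
      simp only [map_zero, smul_zero, map_sum, Finset.smul_sum] at h4
      rw [← h4]
      refine Finset.sum_congr rfl fun i _ => Finset.sum_congr rfl fun σ _ => ?_
      exact L.hTotal_shuffleTerm i.isLt d x hx σ
    exact this hx

theorem δ_sq : L.δ ∘ₗ L.δ = 0 := Lam.coderivation_sq L.hTotal_isHom L.hTotal_δ

theorem hTotal_of_lt {k : ℕ} (hk : ∀ j < k, L.ℓ j = 0) (a : ℕ) (ha : a < k) (x : Lam V.susp)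
    (hx : x ∈ Lam.wordLen V.susp a) : L.hTotal x = 0 := by
  refine Lam.descend_eq_zero_on_wordLen _ ?_ hx
  unfold h
  rw [hk a ha]
  ext x
  simp

/-- If `ℓⱼ = 0` for `j < k`, then `δ` lowers the filtration by `k - 1`. -/
theorem δ_mem_filtration {k : ℕ} (hk : ∀ j < k, L.ℓ j = 0) {p : ℤ} {x : Lam V.susp}
    (hx : x ∈ Lam.filtration V.susp p) : L.δ x ∈ Lam.filtration V.susp (p - k + 1) :=
  Lam.coderivation_filtration (L.hTotal_of_lt hk) hx

theorem isFilteredComplex : IsFilteredComplex L.δ (Lam.filtration V.susp) where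
  sq_zero := L.δ_sq
  mono := Lam.filtration_mono
  map_le p := by
    rintro _ ⟨x, hx, rfl⟩
    have := L.δ_mem_filtration (k := 1) (fun j hj => by
      obtain rfl : j = 0 := by omega
      exact L.ℓ_zero) hx
    rwa [Nat.cast_one, sub_add_cancel] at this

/-- The component `hₖ` of `h`, as a linear map on `ΛsL`. -/
noncomputable def hPart (k : ℕ) : Lam V.susp →ₗ[ℚ] V.susp :=
  Lam.descend (fun j => if j = k then L.h j else 0) (Lam.gradedSymm_single L.h L.h_gradedSymm k)

theorem hPart_of_ne {k a : ℕ} (h : a ≠ k) {x : Lam V.susp} (hx : x ∈ Lam.wordLen V.susp a) :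
    L.hPart k x = 0 :=
  Lam.descend_eq_zero_on_wordLen _ (if_neg h) hx

theorem hPart_self {k : ℕ} {x : Lam V.susp} (hx : x ∈ Lam.wordLen V.susp k) :
    L.hPart k x = L.hTotal x :=
  Lam.descend_eq_on_wordLen _ _ (if_pos rfl) hx

theorem δPart_mem_word (k : ℕ) {p : ℤ} {x : Lam V.susp} (hx : x ∈ Lam.word V.susp p) :
    L.δPart k x ∈ Lam.word V.susp (p - (k - 1)) :=
  Lam.coderivation_word (fun _ ha _ hx => L.hPart_of_ne ha hx) hx

/-- The corestriction h - h_k vanishes on words with fewer than k + 1 letters, so its coderivation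
lowers the filtration by k, one more than δ_k does. -/
theorem δ_sub_δPart_mem {k : ℕ} (hk : ∀ j < k, L.ℓ j = 0) {p : ℤ} {x : Lam V.susp}
    (hx : x ∈ Lam.filtration V.susp p) :
    L.δ x - L.δPart k x ∈ Lam.filtration V.susp (p - k) := by
  have h : L.δ x - L.δPart k x = Lam.coderivation (L.hTotal - L.hPart k) x := by
    rw [Lam.coderivation_sub]; rfl
  rw [h]
  have := Lam.coderivation_filtration (f := L.hTotal - L.hPart k) (m := k + 1) (p := p)
    (fun a ha x hx => by
      rw [LinearMap.sub_apply]
      by_cases hak : a = k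
      · subst hak
        rw [L.hPart_self hx, sub_self]
      · rw [L.hPart_of_ne hak hx, L.hTotal_of_lt hk a (by omega) x hx, sub_zero]) hx
  rwa [show p - ((k + 1 : ℕ) : ℤ) + 1 = p - k by push_cast; ring] at this

end LInfinityStructure

/-! ### Early pages and the vanishing of differentials -/

section Pages

variable {C : Type u} [AddCommGroup C] [Module ℚ C] {δ : C →ₗ[ℚ] C} {F : ℤ → Submodule ℚ C}

theorem cyc_eq_of_lowering (hδ : IsFilteredComplex δ F) {m : ℤ}
    (h : ∀ p, ∀ x ∈ F p, δ x ∈ F (p - m)) {r : ℤ} (hr : r ≤ m) (p : ℤ) : cyc δ F r p = F p :=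
  inf_eq_left.2 fun x hx => hδ.mono (by omega) (h p x hx)

/-- For r ≤ m the cycle term is already all of F_{p-1}, and the boundaries from F_{p+r-1} land in
F_{p+r-1-m}, which it contains. -/
theorem den_eq_of_lowering (hδ : IsFilteredComplex δ F) {m : ℤ}
    (h : ∀ p, ∀ x ∈ F p, δ x ∈ F (p - m)) {r : ℤ} (hr : r ≤ m) (p : ℤ) :
    den δ F r p = F (p - 1) := by
  rw [den, cyc_eq_of_lowering hδ h (by omega)]
  refine sup_eq_left.2 ?_
  rintro _ ⟨-, x, hx, rfl⟩
  exact hδ.mono (by omega) (h _ x hx)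

theorem pageMk_eq_iff {r p : ℤ} (x y : cyc δ F r p) :
    pageMk δ F r p x = pageMk δ F r p y ↔ (x - y : C) ∈ den δ F r p :=
  Submodule.Quotient.eq _

theorem pageMk_surjective (r p : ℤ) : Function.Surjective (pageMk δ F r p) :=
  Submodule.mkQ_surjective _

theorem pageD_pageMk (hδ : IsFilteredComplex δ F) (r p : ℤ) (x : C) (hx : x ∈ cyc δ F r p) :
    pageD hδ r p (pageMk δ F r p ⟨x, hx⟩) =
      pageMk δ F r (p - r) ⟨δ x, map_cyc hδ r p x hx⟩ := rfl

theorem pageD_eq_zero_iff (hδ : IsFilteredComplex δ F) (r p : ℤ) :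
    pageD hδ r p = 0 ↔ ∀ x ∈ cyc δ F r p, δ x ∈ den δ F r (p - r) := by
  have h0 : ∀ x (hx : x ∈ cyc δ F r p), pageD hδ r p (pageMk δ F r p ⟨x, hx⟩) = 0 ↔
      δ x ∈ den δ F r (p - r) := by
    intro x hx
    rw [pageD_pageMk, ← map_zero (pageMk δ F r (p - r)), pageMk_eq_iff]
    simp
  constructor
  · intro h x hx
    rw [← h0 x hx, h]; rfl
  · intro h
    refine LinearMap.ext fun y => ?_
    obtain ⟨⟨x, hx⟩, rfl⟩ := pageMk_surjective r p y
    exact (h0 x hx).2 (h x hx)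

/-- If `δ` lowers the filtration by `m` then `E^m` is the associated graded of the filtration,
and `d^m` is the leading part of `δ`. -/
theorem exists_page_equiv (hδ : IsFilteredComplex δ F) {m : ℤ}
    (h : ∀ p, ∀ x ∈ F p, δ x ∈ F (p - m)) (G : ℤ → Submodule ℚ C)
    (hsup : ∀ p, F p = G p ⊔ F (p - 1)) (hdisj : ∀ p, ∀ x ∈ G p, x ∈ F (p - 1) → x = 0)
    (δ' : C →ₗ[ℚ] C) (hG : ∀ p, ∀ x ∈ G p, δ' x ∈ G (p - m))
    (hδ' : ∀ p, ∀ x ∈ F p, δ x - δ' x ∈ F (p - m - 1)) :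
    ∃ φ : ∀ p : ℤ, G p ≃ₗ[ℚ] Page δ F m p,
      (∀ (p : ℤ) (x : G p), ∃ hx : (x : C) ∈ cyc δ F m p, φ p x = pageMk δ F m p ⟨x, hx⟩) ∧
      ∀ (p : ℤ) (x : G p), ∃ hy : δ' x ∈ G (p - m),
        pageD hδ m p (φ p x) = φ (p - m) ⟨δ' x, hy⟩ := by
  have hle : ∀ p, G p ≤ F p := fun p => by rw [hsup p]; exact le_sup_left
  have hc : ∀ p, G p ≤ cyc δ F m p := fun p => by
    rw [cyc_eq_of_lowering hδ h le_rfl]; exact hle p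
  have hbij : ∀ p, Function.Bijective (pageMk δ F m p ∘ₗ Submodule.inclusion (hc p)) := by
    intro p
    constructor
    · rw [← LinearMap.ker_eq_bot, LinearMap.ker_eq_bot']
      intro x hx
      rw [LinearMap.comp_apply, ← map_zero (pageMk δ F m p), pageMk_eq_iff,
        den_eq_of_lowering hδ h le_rfl] at hx
      refine Subtype.ext (hdisj p x x.2 ?_)
      simpa using hx
    · intro y
      obtain ⟨⟨x, hx⟩, rfl⟩ := pageMk_surjective m p y
      have hx' : x ∈ G p ⊔ F (p - 1) := by rw [← hsup]; exact hx.1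
      obtain ⟨g, hg, f, hf, rfl⟩ := Submodule.mem_sup.1 hx'
      refine ⟨⟨g, hg⟩, ?_⟩
      rw [LinearMap.comp_apply, pageMk_eq_iff, den_eq_of_lowering hδ h le_rfl]
      simpa using Submodule.neg_mem _ hf
  refine ⟨fun p => LinearEquiv.ofBijective _ (hbij p), fun p x => ⟨hc p x.2, rfl⟩,
    fun p x => ⟨hG p x x.2, ?_⟩⟩
  change pageD hδ m p (pageMk δ F m p ⟨x, hc p x.2⟩) =
    pageMk δ F m (p - m) ⟨δ' x, hc _ (hG p x x.2)⟩
  rw [pageD_pageMk, pageMk_eq_iff, den_eq_of_lowering hδ h le_rfl]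
  exact hδ' p x (hle p x.2)

/-- An element-wise form of `dʳ = 0`. -/
def ExtendsCycles (δ : C →ₗ[ℚ] C) (F : ℤ → Submodule ℚ C) (r p : ℤ) : Prop :=
  ∀ x ∈ F p, δ x ∈ F (p - r) → ∃ w ∈ F (p - 1), δ (x - w) ∈ F (p - r - 1)

/-- Being zero in E^r_{p-r} means δx = y + δw with w in F_{p-1} and y in F_{p-r-1}, so y = δ(x - w).
That y is a cycle costs nothing because δ² = 0. This quotient-free form is what gets transported
along quasi-isomorphisms. -/
theorem pageD_eq_zero_iff_extendsCycles (hδ : IsFilteredComplex δ F) (r p : ℤ) :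
    pageD hδ r p = 0 ↔ ExtendsCycles δ F r p := by
  rw [pageD_eq_zero_iff]
  constructor
  · intro h x hx hx'
    obtain ⟨y, ⟨hy, -⟩, z, ⟨-, w, hw, rfl⟩, e⟩ := Submodule.mem_sup.1 (h x ⟨hx, hx'⟩)
    refine ⟨w, ?_, ?_⟩
    · have : w ∈ F (p - r + (r - 1)) := hw
      rwa [show p - r + (r - 1) = p - 1 by ring] at this
    · rw [map_sub, ← e, add_sub_cancel_right]; exact hy
  · rintro h x ⟨hx, hx'⟩
    obtain ⟨w, hw, hxw⟩ := h x hx hx'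
    rw [← sub_add_cancel (δ x) (δ w), ← map_sub]
    have hsq : ∀ y, δ (δ y) = 0 := fun y => LinearMap.congr_fun hδ.sq_zero y
    refine Submodule.add_mem_sup ⟨hxw, ?_⟩ ⟨?_, w, ?_, rfl⟩
    · change δ (δ (x - w)) ∈ F _
      rw [hsq]; exact Submodule.zero_mem _
    · have : δ w = δ x - δ (x - w) := by rw [map_sub, sub_sub_cancel]
      rw [this]
      exact Submodule.sub_mem _ hx' (hδ.mono (by omega) hxw)
    · rw [show p - r + (r - 1) = p - 1 by ring]; exact hw

end Pages

/-! ### Invariance of the collapse -/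

section Comparison

variable {C C' : Type u} [AddCommGroup C] [Module ℚ C] [AddCommGroup C'] [Module ℚ C']
  {δ : C →ₗ[ℚ] C} {F : ℤ → Submodule ℚ C} {δ' : C' →ₗ[ℚ] C'} {F' : ℤ → Submodule ℚ C'}

/-- `f` induces an injection on the homology of `F_p / F_q`. -/
def InjBetween (δ : C →ₗ[ℚ] C) (F : ℤ → Submodule ℚ C) (δ' : C' →ₗ[ℚ] C')
    (F' : ℤ → Submodule ℚ C') (f : C →ₗ[ℚ] C') (p q : ℤ) : Prop :=
  ∀ x ∈ F p, δ x ∈ F q → ∀ w ∈ F' p, f x - δ' w ∈ F' q → ∃ z ∈ F p, x - δ z ∈ F q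

/-- `f` induces a surjection on the homology of `F_p / F_q`. -/
def SurjBetween (δ : C →ₗ[ℚ] C) (F : ℤ → Submodule ℚ C) (δ' : C' →ₗ[ℚ] C')
    (F' : ℤ → Submodule ℚ C') (f : C →ₗ[ℚ] C') (p q : ℤ) : Prop :=
  ∀ x' ∈ F' p, δ' x' ∈ F' q → ∃ x ∈ F p, δ x ∈ F q ∧ ∃ w ∈ F' p, f x - x' - δ' w ∈ F' q

variable {f : C →ₗ[ℚ] C'}

/-- The five lemma for 0 → F_{p-1}/F_q → F_p/F_q → F_p/F_{p-1} → 0, carried out on elements. The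
induction runs over all p at once because the subcomplex starts at p - 1. -/
theorem quasiIso_between (hδ : IsFilteredComplex δ F) (hδ' : IsFilteredComplex δ' F')
    (hf : ∀ x, δ' (f x) = f (δ x)) (hF : ∀ p, ∀ x ∈ F p, f x ∈ F' p)
    (hinj : ∀ p, InjBetween δ F δ' F' f p (p - 1)) (hsurj : ∀ p, SurjBetween δ F δ' F' f p (p - 1))
    (p : ℤ) (n : ℕ) : InjBetween δ F δ' F' f p (p - n) ∧ SurjBetween δ F δ' F' f p (p - n) := by
  have sq : ∀ x, δ (δ x) = 0 := fun x => LinearMap.congr_fun hδ.sq_zero x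
  have sq' : ∀ x, δ' (δ' x) = 0 := fun x => LinearMap.congr_fun hδ'.sq_zero x
  induction n generalizing p with
  | zero =>
    rw [Nat.cast_zero, sub_zero]
    constructor
    · intro x hx _ _ _ _
      exact ⟨0, Submodule.zero_mem _, by simpa using hx⟩
    · intro x' hx' _
      exact ⟨0, Submodule.zero_mem _, by simp, 0, Submodule.zero_mem _, by simpa using hx'⟩
  | succ n ih =>
    obtain ⟨ihi, ihs⟩ := ih (p - 1)
    have hq : p - 1 - (n : ℤ) = p - ((n + 1 : ℕ) : ℤ) := by push_cast; ring
    rw [hq] at ihi ihs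
    have hle : p - ((n + 1 : ℕ) : ℤ) ≤ p - 1 := by push_cast; omega
    generalize p - ((n + 1 : ℕ) : ℤ) = q at *
    constructor
    · intro x hx hdx w hw hxw
      obtain ⟨z, hz, hxz⟩ := hinj p x hx (hδ.mono hle hdx) w hw (hδ'.mono hle hxw)
      have h1 : δ' (w - f z) ∈ F' (p - 1) := by
        have : δ' (w - f z) = f (x - δ z) - (f x - δ' w) := by
          rw [map_sub, map_sub, hf]; abel
        rw [this]
        exact Submodule.sub_mem _ (hF _ _ hxz) (hδ'.mono hle hxw)
      -- The choice of z ignores w, and w - f z is only a relative cycle of F'_p/F'_{p-1}. Lifting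
      -- it to u and using z + u moves the remaining bounding element into F'_{p-1}, where the
      -- induction hypothesis applies.
      obtain ⟨u, hu, hdu, e, he, hc⟩ := hsurj p (w - f z) (Submodule.sub_mem _ hw (hF _ _ hz)) h1
      have h2 : x - δ z - δ u ∈ F (p - 1) := Submodule.sub_mem _ hxz hdu
      obtain ⟨v, hv, hvx⟩ := ihi _ h2 (by simpa [sq] using hdx)
        (-(f u - (w - f z) - δ' e)) (Submodule.neg_mem _ hc) (by
          have : f (x - δ z - δ u) - δ' (-(f u - (w - f z) - δ' e)) = f x - δ' w := by
            simp only [map_sub, map_neg, sq', hf]; abel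
          rw [this]; exact hxw)
      refine ⟨z + u + v, ?_, ?_⟩
      · exact Submodule.add_mem _ (Submodule.add_mem _ hz hu) (hδ.mono (by omega) hv)
      · rwa [map_add, map_add, ← sub_sub, ← sub_sub]
    · intro x' hx' hdx'
      obtain ⟨x, hx, hdx, w, hw, hc⟩ := hsurj p x' hx' (hδ'.mono hle hdx')
      have h1 : f (δ x) - δ' (f x - x' - δ' w) ∈ F' q := by
        have : f (δ x) - δ' (f x - x' - δ' w) = δ' x' := by
          simp only [map_sub, sq', hf]; abel
        rw [this]; exact hdx'
      -- The obstruction δx is a cycle in F_{p-1} whose image bounds modulo F'_q, so some z in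
      -- F_{p-1} makes x - z a cycle modulo F_q. The error left in F'_{p-1} is then lifted by `ihs`.
      obtain ⟨z, hz, hxz⟩ := ihi (δ x) hdx (by rw [sq]; exact Submodule.zero_mem _) _ hc h1
      have h2 : δ' (f (x - z) - x' - δ' w) ∈ F' q := by
        have : δ' (f (x - z) - x' - δ' w) = f (δ x - δ z) - δ' x' := by
          simp only [map_sub, sq', hf]; abel
        rw [this]
        exact Submodule.sub_mem _ (hF _ _ hxz) hdx'
      have h3 : f (x - z) - x' - δ' w ∈ F' (p - 1) := by
        have : f (x - z) - x' - δ' w = f x - x' - δ' w - f z := by rw [map_sub]; abel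
        rw [this]
        exact Submodule.sub_mem _ hc (hF _ _ hz)
      obtain ⟨y, hy, hdy, v, hv, hc'⟩ := ihs _ h3 h2
      refine ⟨x - z - y, ?_, ?_, w - v, ?_, ?_⟩
      · exact Submodule.sub_mem _ (Submodule.sub_mem _ hx (hδ.mono (by omega) hz))
          (hδ.mono (by omega) hy)
      · rw [map_sub, map_sub]; exact Submodule.sub_mem _ hxz hdy
      · exact Submodule.sub_mem _ hw (hδ'.mono (by omega) hv)
      · have : f (x - z - y) - x' - δ' (w - v) = -(f y - (f (x - z) - x' - δ' w) - δ' v) := by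
          simp only [map_sub]; abel
        rw [this]
        exact Submodule.neg_mem _ hc'

/-- A filtered chain map which is an isomorphism on `E¹` preserves and reflects the vanishing of
`dʳ` for `r ≥ 1`. -/
theorem extendsCycles_iff (hδ : IsFilteredComplex δ F) (hδ' : IsFilteredComplex δ' F')
    (hf : ∀ x, δ' (f x) = f (δ x)) (hF : ∀ p, ∀ x ∈ F p, f x ∈ F' p)
    (hinj : ∀ p, InjBetween δ F δ' F' f p (p - 1)) (hsurj : ∀ p, SurjBetween δ F δ' F' f p (p - 1))
    {r : ℤ} (hr : 1 ≤ r) (p : ℤ) : ExtendsCycles δ F r p ↔ ExtendsCycles δ' F' r p := by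
  have sq : ∀ x, δ (δ x) = 0 := fun x => LinearMap.congr_fun hδ.sq_zero x
  have sq' : ∀ x, δ' (δ' x) = 0 := fun x => LinearMap.congr_fun hδ'.sq_zero x
  obtain ⟨n, rfl⟩ := Int.eq_ofNat_of_zero_le (by omega : 0 ≤ r)
  have Q := quasiIso_between hδ hδ' hf hF hinj hsurj
  constructor
  · intro h x' hx' hdx'
    obtain ⟨x, hx, hdx, w, hw, hc⟩ := (Q p n).2 x' hx' hdx'
    obtain ⟨u, hu, hxu⟩ := h x hx hdx
    -- Up to the boundary δ'w, x' differs from f x by an element of F'_{p-n}, hence of F'_{p-1} as n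
    -- ≥ 1, so this error can be absorbed into the correction.
    refine ⟨f u - (f x - x' - δ' w), ?_, ?_⟩
    · exact Submodule.sub_mem _ (hF _ _ hu) (hδ'.mono (by omega) hc)
    · have : δ' (x' - (f u - (f x - x' - δ' w))) = f (δ (x - u)) := by
        simp only [map_sub, sq', hf]; abel
      rw [this]
      exact hF _ _ hxu
  · intro h x hx hdx
    obtain ⟨w', hw', hc⟩ := h (f x) (hF _ _ hx) (by rw [hf]; exact hF _ _ hdx)
    -- The cycle δx lies in F_{p-1}, and w' bounds its image modulo F'_{p-n-1}. Injectivity on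
    -- F_{p-1}/F_{p-n-1} turns w' into a correction of x.
    have hi := (Q (p - 1) n).1
    rw [show p - 1 - (n : ℤ) = p - n - 1 by ring] at hi
    obtain ⟨z, hz, hxz⟩ := hi (δ x) (hδ.mono (by omega) hdx)
      (by rw [sq]; exact Submodule.zero_mem _) w' hw' (by rwa [← hf, ← map_sub])
    exact ⟨z, hz, by rwa [map_sub]⟩

end Comparison

namespace LInfinityAlgebra

theorem isFilteredComplex (L : LInfinityAlgebra.{u}) : IsFilteredComplex L.δ L.F :=
  L.str.isFilteredComplex

/-- If only `ℓ₂` is nonzero, the Quillen spectral sequence collapses at `E²`. -/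
theorem extendsCycles_of_binary (L : LInfinityAlgebra.{u}) (h : ∀ k : ℕ, k ≠ 2 → L.str.ℓ k = 0)
    {r : ℤ} (hr : 2 ≤ r) (p : ℤ) : ExtendsCycles L.δ L.F r p := by
  intro x hx hdx
  have hx' : x ∈ Lam.word L.space.susp p ⊔ L.F (p - 1) := by
    rw [← Lam.filtration_eq_sup]; exact hx
  obtain ⟨g, hg, y, hy, rfl⟩ := Submodule.mem_sup.1 hx'
  -- Subtracting all lower terms leaves the leading word g; δg has pure length p - 1 yet lies in
  -- F_{p-2}, so it vanishes.
  refine ⟨y, hy, ?_⟩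
  rw [add_sub_cancel_right]
  have hne : ∀ a, a ≠ 2 → ∀ x ∈ Lam.wordLen L.space.susp a, L.str.hTotal x = 0 := by
    intro a ha x hx
    refine Lam.descend_eq_zero_on_wordLen _ ?_ hx
    unfold LInfinityStructure.h
    rw [h a ha]
    ext x
    simp
  have h1 : L.δ g ∈ Lam.word L.space.susp (p - 1) := by
    have := Lam.coderivation_word (m := 2) hne hg
    rwa [show p - (((2 : ℕ) : ℤ) - 1) = p - 1 by norm_num] at this
  have h2 : ∀ q : ℤ, ∀ x ∈ L.F q, L.δ x ∈ L.F (q - 1) := by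
    intro q x hx
    have := Lam.coderivation_filtration (m := 2) (fun a ha x hx => hne a (by omega) x hx) hx
    rwa [show q - ((2 : ℕ) : ℤ) + 1 = q - 1 by push_cast; ring] at this
  have h3 : L.δ g ∈ L.F (p - 1 - 1) := by
    have h4 := L.isFilteredComplex.mono (show p - r ≤ p - 1 - 1 by omega) hdx
    rw [map_add] at h4
    have := Submodule.sub_mem _ h4 (h2 _ _ hy)
    rwa [add_sub_cancel_right] at this
  rw [Lam.word_disjoint_filtration h1 h3]
  exact Submodule.zero_mem _

end LInfinityAlgebra

/-! ### Graded generalized inverses and contractions -/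

namespace GradedSpace

variable {V W : GradedSpace.{u}}

/-- Linear maps of degree `e`. -/
def IsHom (a : V →ₗ[ℚ] W) (e : ℤ) : Prop := ∀ n, ∀ v ∈ V.gr n, a v ∈ W.gr (n + e)

theorem IsHom.proj_comm {a : V →ₗ[ℚ] W} {e : ℤ} (ha : IsHom a e) (n : ℤ) (x : V) :
    a (V.proj n x) = W.proj (n + e) (a x) := by
  induction x using V.hom_induction with
  | zero => simp
  | add x y hx hy => simp [hx, hy]
  | hom i x hx =>
    by_cases h : i = n
    · subst h
      rw [proj_of_mem V hx, proj_of_mem W (ha _ _ hx)]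
    · rw [proj_of_mem_ne V hx h, proj_of_mem_ne W (ha _ _ hx) (by omega), map_zero]

theorem IsHom.comp {U : GradedSpace.{u}} {a : V →ₗ[ℚ] W} {b : U →ₗ[ℚ] V} {e e' : ℤ}
    (ha : IsHom a e) (hb : IsHom b e') : IsHom (a ∘ₗ b) (e + e') := fun n v hv => by
  have := ha _ _ (hb n v hv)
  rwa [show n + e' + e = n + (e + e') by ring] at this

theorem IsHom.add {a b : V →ₗ[ℚ] W} {e : ℤ} (ha : IsHom a e) (hb : IsHom b e) :
    IsHom (a + b) e := fun n v hv => Submodule.add_mem _ (ha n v hv) (hb n v hv)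

theorem IsHom.sub {a b : V →ₗ[ℚ] W} {e : ℤ} (ha : IsHom a e) (hb : IsHom b e) :
    IsHom (a - b) e := fun n v hv => Submodule.sub_mem _ (ha n v hv) (hb n v hv)

theorem isHom_id : IsHom (LinearMap.id : V →ₗ[ℚ] V) 0 := fun n v hv => by rwa [add_zero]

/-- A homogeneous linear map has a homogeneous generalized inverse. -/
theorem IsHom.exists_generalized_inverse {a : V →ₗ[ℚ] W} {e : ℤ} (ha : IsHom a e) :
    ∃ b : W →ₗ[ℚ] V, IsHom b (-e) ∧ ∀ v, a (b (a v)) = a v := by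
  obtain ⟨g, hg⟩ := a.rangeRestrict.exists_rightInverse_of_surjective a.range_rangeRestrict
  obtain ⟨b₀, hb₀⟩ := LinearMap.exists_extend g
  have h0 : ∀ v, a (b₀ (a v)) = a v := fun v => by
    have h1 : b₀ (a v) = g (a.rangeRestrict v) := by rw [← hb₀]; rfl
    rw [h1]
    exact congrArg Subtype.val (LinearMap.congr_fun hg (a.rangeRestrict v))
  -- The inverse `b₀` ignores degrees. Keeping only its component of degree n - e on W_n does no
  -- harm, because a intertwines the projections onto degrees.
  let b : W →ₗ[ℚ] V := DirectSum.toModule ℚ ℤ V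
      (fun n => V.proj (n + -e) ∘ₗ b₀ ∘ₗ (W.gr n).subtype) ∘ₗ
    (DirectSum.decomposeLinearEquiv W.gr).toLinearMap
  have hb : ∀ n, ∀ w ∈ W.gr n, b w = V.proj (n + -e) (b₀ w) := by
    intro n w hw
    lift w to W.gr n using hw
    simp only [b, LinearMap.comp_apply, LinearEquiv.coe_coe, DirectSum.decomposeLinearEquiv_apply,
      DirectSum.decompose_coe]
    rw [← DirectSum.lof_eq_of ℚ, DirectSum.toModule_lof]
    rfl
  refine ⟨b, fun n w hw => ?_, fun v => ?_⟩
  · rw [hb n w hw]; exact V.proj_mem _ _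
  · induction v using V.hom_induction with
    | zero => simp
    | add x y hx hy => simp only [map_add, hx, hy]
    | hom n v hv =>
      rw [hb _ _ (ha n v hv), ha.proj_comm, h0, add_assoc, neg_add_cancel, add_zero,
        proj_of_mem W (ha n v hv)]

/-- A contraction of a graded complex onto its homology: a homotopy `h` with `dhd = d` and
`h² = 0`. -/
theorem IsHom.exists_contraction {d : V →ₗ[ℚ] V} (hd : IsHom d (-1)) (hdd : ∀ v, d (d v) = 0) :
    ∃ h : V →ₗ[ℚ] V, IsHom h 1 ∧ (∀ v, d (h (d v)) = d v) ∧ ∀ v, h (h v) = 0 := by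
  obtain ⟨b, hb, hbd⟩ := hd.exists_generalized_inverse
  rw [neg_neg] at hb
  -- The factor bdb is a generalized inverse of d, and (1 - bd)bdb = 0 because dbd = d; the last
  -- factor therefore forces the square to vanish.
  refine ⟨b ∘ₗ d ∘ₗ b ∘ₗ (LinearMap.id - b ∘ₗ d), ?_, fun v => ?_, fun v => ?_⟩
  · exact hb.comp (hd.comp (hb.comp (isHom_id.sub (hb.comp hd))))
  · simp [hdd, hbd]
  · simp only [LinearMap.comp_apply, LinearMap.sub_apply, LinearMap.id_apply, map_sub, hbd, sub_self,
      map_zero]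

end GradedSpace

namespace Lam

variable {V W : GradedSpace.{u}}

open GradedSpace (IsHom)

/-! ### Derivations of `ΛV` -/

/-- The extension of a linear endomorphism of `V` to `ΛV` as a derivation. -/
noncomputable def derivation (a : V →ₗ[ℚ] V) : Lam V →ₗ[ℚ] Lam V := coderivation (a ∘ₗ proj V)

theorem isHom_comp_proj {a : V →ₗ[ℚ] V} {e : ℤ} (ha : GradedSpace.IsHom a e) :
    Lam.IsHom (a ∘ₗ proj V) e := fun n x hx => ha n _ (proj_mem_gr n x hx)

theorem derivation_one (a : V →ₗ[ℚ] V) : derivation a 1 = 0 := by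
  rw [derivation, coderivation_one, LinearMap.comp_apply, proj_one, map_zero, map_zero]

theorem coderivation_counit (w : V) (x : Lam V) :
    coderivation (LinearMap.toSpanSingleton ℚ V w ∘ₗ (counit V).toLinearMap) x = ι V w * x := by
  have h : ∀ y : Lam V ⊗[ℚ] Lam V, LinearMap.mul' ℚ (Lam V) (TensorProduct.map
      (ι V ∘ₗ LinearMap.toSpanSingleton ℚ V w ∘ₗ (counit V).toLinearMap) LinearMap.id y) =
      ι V w * TensorProduct.lid ℚ _
        (TensorProduct.map (counit V).toLinearMap LinearMap.id y) := by
    intro y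
    induction y using TensorProduct.induction_on with
    | zero => simp
    | add a b ha hb => simp only [map_add, mul_add, ha, hb]
    | tmul a b => simp
  rw [coderivation, LinearMap.comp_apply, LinearMap.comp_apply, h, counit_comul_left]
  simp

/-- Contracting aπ by v gives x ↦ ε(x) a(v), whose coderivation is left multiplication by a(v). So
the coderivation extending aπ is also a derivation. -/
theorem derivation_ι_mul {a : V →ₗ[ℚ] V} {e : ℤ} (ha : GradedSpace.IsHom a e) {i : ℤ} {v : V}
    (hv : v ∈ V.gr i) (x : Lam V) :
    derivation a (ι V v * x) = ι V (a v) * x + (-1 : ℚ) ^ (e * i) • (ι V v * derivation a x) := by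
  have hc : contract (a ∘ₗ proj V) v =
      LinearMap.toSpanSingleton ℚ V (a v) ∘ₗ (counit V).toLinearMap := by
    ext x
    simp [contract_apply, proj_ι_mul]
  rw [derivation, coderivation_ι_mul (isHom_comp_proj ha) hv, hc, coderivation_counit]

theorem derivation_mem_wordLen (a : V →ₗ[ℚ] V) {n : ℕ} {x : Lam V} (hx : x ∈ wordLen V n) :
    derivation a x ∈ wordLen V n := by
  have := coderivation_word (f := a ∘ₗ proj V) (m := 1) (p := n)
    (fun k hk x hx => by rw [LinearMap.comp_apply, proj_of_mem_ne hk hx, map_zero])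
    (by rwa [word_natCast])
  rw [Nat.cast_one, sub_self, sub_zero, word_natCast] at this
  exact this

theorem lenProj_comm {f : Lam V →ₗ[ℚ] Lam W} (hf : ∀ n, ∀ x ∈ wordLen V n, f x ∈ wordLen W n)
    (n : ℕ) (x : Lam V) : lenProj W n (f x) = f (lenProj V n x) := by
  induction x using wordLen_span with
  | add x y hx hy => simp only [map_add, hx, hy]
  | hom m x hx =>
    by_cases h : m = n
    · subst h
      rw [lenProj_of_mem hx, lenProj_of_mem (hf _ _ hx)]
    · rw [lenProj_of_mem_ne h hx, lenProj_of_mem_ne h (hf _ _ hx), map_zero]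

theorem derivation_sq {d : V →ₗ[ℚ] V} (hd : GradedSpace.IsHom d (-1)) (hdd : ∀ v, d (d v) = 0)
    (x : Lam V) : derivation d (derivation d x) = 0 := by
  refine LinearMap.congr_fun (coderivation_sq (isHom_comp_proj hd) ?_) x
  ext y
  simp [proj_coderivation, hdd]

/-- Both maps are odd, so the graded commutator is the anticommutator. It is a coderivation,
determined by its corestriction, which is (dh + hd)π by `proj_coderivation`. -/
theorem derivation_anticommutator {d h : V →ₗ[ℚ] V} (hd : GradedSpace.IsHom d (-1))
    (hh : GradedSpace.IsHom h 1) (x : Lam V) :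
    derivation d (derivation h x) + derivation h (derivation d x) =
      derivation (d ∘ₗ h + h ∘ₗ d) x := by
  have := coderivation_commutator (isHom_comp_proj hd) (isHom_comp_proj hh) x
  have e : (d ∘ₗ proj V) ∘ₗ coderivation (h ∘ₗ proj V) -
      (-1 : ℚ) ^ (-1 * 1 : ℤ) • (h ∘ₗ proj V) ∘ₗ coderivation (d ∘ₗ proj V) =
      (d ∘ₗ h + h ∘ₗ d) ∘ₗ proj V := by
    ext y
    simp [proj_coderivation]
  rw [e] at this
  simpa [derivation] using this

theorem map_derivation {φ : V →ₗ[ℚ] W} (hφ) {d : V →ₗ[ℚ] V} {d' : W →ₗ[ℚ] W} {e : ℤ}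
    (hd : GradedSpace.IsHom d e) (hd' : GradedSpace.IsHom d' e)
    (h : ∀ v, d' (φ v) = φ (d v)) (x : Lam V) :
    derivation d' (map φ hφ x) = map φ hφ (derivation d x) := by
  induction x using word_induction with
  | add x y hx hy => simp only [map_add, hx, hy]
  | smul c x hx => simp only [map_smul, hx]
  | one => simp [derivation_one]
  | mul i v hv x hx =>
    rw [map_mul, map_ι, derivation_ι_mul hd' (hφ i v hv), derivation_ι_mul hd hv, hx]
    simp [map_ι, h]

/-! ### Homotopy invariance -/

/-- For a contraction `h` of `(V, d)` with associated projection `e = 1 - dh - hd` onto the homology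
of `V`, the map `Λe` is homotopic to the identity on cycles. -/
theorem sub_map_mem_range {d h e : V →ₗ[ℚ] V} (hd : GradedSpace.IsHom d (-1))
    (hh : GradedSpace.IsHom h 1) (hdd : ∀ v, d (d v) = 0) (hdhd : ∀ v, d (h (d v)) = d v)
    (hhh : ∀ v, h (h v) = 0) (he : e = LinearMap.id - (d ∘ₗ h + h ∘ₗ d))
    (hedeg : ∀ n, ∀ v ∈ V.gr n, e v ∈ V.gr n) {x : Lam V} (hx : derivation d x = 0) :
    ∃ y, x - map e hedeg x = derivation d y := by
  let q := d ∘ₗ h + h ∘ₗ d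
  have hq : GradedSpace.IsHom q 0 := by
    simpa using (hd.comp hh).add (hh.comp hd)
  have hqq : ∀ v, q (q v) = q v := fun v => by simp [q, hdd, hdhd, hhh]
  have heq : ∀ v, e (q v) = 0 := fun v => by
    rw [he]; exact sub_eq_zero.2 (hqq v).symm
  have hqe : ∀ v, q (e v) = 0 := fun v => by
    rw [he]; change q (v - q v) = 0; rw [map_sub, hqq, sub_self]
  have hee : ∀ v, e (e v) = e v := fun v => by
    have : e (e v) = e v - q (e v) := by rw [he]; rfl
    rw [this, hqe, sub_zero]
  have hsplit : ∀ v, v = e v + q v := fun v => by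
    rw [he]; exact (sub_add_cancel v (q v)).symm
  let N : Module.End ℚ (Lam V) := derivation q
  have hN : ∀ {i : ℤ} {v : V}, v ∈ V.gr i → ∀ x, N (ι V v * x) = ι V (q v) * x + ι V v * N x := by
    intro i v hv x
    have := derivation_ι_mul hq hv x
    simpa using this
  have hac : ∀ y, derivation d (derivation h y) + derivation h (derivation d y) = N y :=
    derivation_anticommutator hd hh
  -- Splitting every letter as e v + q v, P n contains the words with exactly n letters from the
  -- image of q. There N acts as n, and Λe is the identity for n = 0 and zero otherwise.
  let P : ℕ → Submodule ℚ (Lam V) := fun n =>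
    LinearMap.ker (N - (n : ℚ) • LinearMap.id) ⊓
      LinearMap.ker ((map e hedeg).toLinearMap - (if n = 0 then 1 else 0 : ℚ) • LinearMap.id)
  have hP : ∀ n y, y ∈ P n ↔ N y = (n : ℚ) • y ∧
      map e hedeg y = (if n = 0 then 1 else 0 : ℚ) • y := by
    intro n y
    simp only [P, Submodule.mem_inf, LinearMap.mem_ker, LinearMap.sub_apply, LinearMap.smul_apply,
      LinearMap.id_apply, sub_eq_zero, AlgHom.toLinearMap_apply]
  have htop : ∀ y, y ∈ ⨆ n, P n := by
    intro y
    induction y using word_induction with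
    | add x y hx hy => exact Submodule.add_mem _ hx hy
    | smul c x hx => exact Submodule.smul_mem _ _ hx
    | one =>
      refine Submodule.mem_iSup_of_mem 0 ((hP 0 1).2 ⟨?_, ?_⟩)
      · simp [N, derivation_one]
      · simp
    | mul i v hv x hx =>
      have hev : e v ∈ V.gr i := hedeg i v hv
      have hqv : q v ∈ V.gr i := by simpa using hq i v hv
      have : ⨆ n, P n ≤ (⨆ n, P n).comap (LinearMap.mulLeft ℚ (ι V v)) := by
        refine iSup_le fun n y hy => ?_
        obtain ⟨hy1, hy2⟩ := (hP n y).1 hy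
        rw [Submodule.mem_comap, LinearMap.mulLeft_apply, hsplit v, map_add, add_mul]
        refine Submodule.add_mem _ (Submodule.mem_iSup_of_mem n ((hP n _).2 ⟨?_, ?_⟩))
          (Submodule.mem_iSup_of_mem (n + 1) ((hP (n + 1) _).2 ⟨?_, ?_⟩))
        · rw [hN hev, hqe, map_zero, zero_mul, zero_add, hy1, mul_smul_comm]
        · rw [map_mul, map_ι, hee, hy2, mul_smul_comm]
        · rw [hN hqv, hqq, hy1, mul_smul_comm]
          push_cast
          rw [add_smul, one_smul, add_comm]
        · rw [map_mul, map_ι, heq, map_zero, zero_mul]; simp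
      exact this hx
  obtain ⟨c, hc, hcx⟩ := (Submodule.mem_iSup_iff_exists_finsupp _ _).1 (htop x)
  -- N commutes with the differential, so the differentials of the components lie in distinct
  -- eigenspaces of N; as their sum is 0, each vanishes.
  have hcyc : ∀ n ∈ c.support, derivation d (c n) = 0 := by
    have hind := (Module.End.eigenspaces_iSupIndep N).comp (Nat.cast_injective (R := ℚ))
    have hmem : ∀ n : ℕ, derivation d (c n) ∈ N.eigenspace (n : ℚ) := by
      intro n
      rw [Module.End.mem_eigenspace_iff, ← hac, derivation_sq hd hdd, map_zero, add_zero]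
      have h1 := hac (c n)
      rw [((hP n _).1 (hc n)).1] at h1
      rw [← map_smul, ← h1, map_add, derivation_sq hd hdd, zero_add]
    have hsum : ∑ n ∈ c.support, derivation d (c n) = 0 := by
      rw [← map_sum, show ∑ n ∈ c.support, c n = x from hcx, hx]
    exact iSupIndep_iff_finsetSum_eq_zero_imp_eq_zero _ |>.1 hind c.support _
      (fun n _ => hmem n) hsum
  have hmem : ∀ n ∈ c.support, c n - map e hedeg (c n) ∈ LinearMap.range (derivation d) := by
    intro n hn
    obtain ⟨h1, h2⟩ := (hP n _).1 (hc n)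
    rw [h2]
    by_cases h0 : n = 0
    · rw [if_pos h0, one_smul, sub_self]; exact Submodule.zero_mem _
    · rw [if_neg h0, zero_smul, sub_zero]
      -- On cycles of weight n the anticommutator gives d(h c) = n c; division by n > 0 requires
      -- characteristic zero.
      refine ⟨(n : ℚ)⁻¹ • derivation h (c n), ?_⟩
      have h3 := hac (c n)
      rw [hcyc n hn, map_zero, add_zero, h1] at h3
      rw [map_smul, h3, smul_smul, inv_mul_cancel₀ (Nat.cast_ne_zero.2 h0), one_smul]
  have hx' : x = ∑ n ∈ c.support, c n := hcx.symm
  obtain ⟨y, hy⟩ : x - map e hedeg x ∈ LinearMap.range (derivation d) := by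
    rw [hx', map_sum, ← Finset.sum_sub_distrib]
    exact Submodule.sum_mem _ hmem
  exact ⟨y, hy.symm⟩

/-- `Λφ` is a quasi-isomorphism if `φ` is. -/
theorem map_quasiIso {φ : V →ₗ[ℚ] W} (hφ : ∀ n, ∀ v ∈ V.gr n, φ v ∈ W.gr n)
    {d : V →ₗ[ℚ] V} {d' : W →ₗ[ℚ] W}
    (hd : GradedSpace.IsHom d (-1)) (hd' : GradedSpace.IsHom d' (-1)) (hdd : ∀ v, d (d v) = 0)
    (hdd' : ∀ v, d' (d' v) = 0) (hc : ∀ v, d' (φ v) = φ (d v))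
    (hinj : ∀ x, d x = 0 → (∃ y', d' y' = φ x) → ∃ y, d y = x)
    (hsurj : ∀ x', d' x' = 0 → ∃ x, d x = 0 ∧ ∃ y', φ x - x' = d' y') :
    (∀ x, derivation d x = 0 → ∀ w, map φ hφ x = derivation d' w → ∃ z, x = derivation d z) ∧
    ∀ x', derivation d' x' = 0 →
      ∃ x, derivation d x = 0 ∧ ∃ w, map φ hφ x - x' = derivation d' w := by
  obtain ⟨h, hh, hdhd, hhh⟩ := hd.exists_contraction hdd
  obtain ⟨h', hh', hdhd', hhh'⟩ := hd'.exists_contraction hdd'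
  obtain ⟨e, he⟩ : ∃ e, e = LinearMap.id - (d ∘ₗ h + h ∘ₗ d) := ⟨_, rfl⟩
  obtain ⟨e', he'⟩ : ∃ e', e' = LinearMap.id - (d' ∘ₗ h' + h' ∘ₗ d') := ⟨_, rfl⟩
  have heh : GradedSpace.IsHom e 0 := by
    rw [he]; simpa using GradedSpace.isHom_id.sub ((hd.comp hh).add (hh.comp hd))
  have heh' : GradedSpace.IsHom e' 0 := by
    rw [he']; simpa using GradedSpace.isHom_id.sub ((hd'.comp hh').add (hh'.comp hd'))
  have hev : ∀ v, e v = v - (d (h v) + h (d v)) := fun v => by rw [he]; rfl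
  have hev' : ∀ v, e' v = v - (d' (h' v) + h' (d' v)) := fun v => by rw [he']; rfl
  have hde : ∀ v, d (e v) = 0 := fun v => by simp [hev, hdd, hdhd]
  have hed : ∀ v, e (d v) = 0 := fun v => by simp [hev, hdd, hdhd]
  have hee : ∀ v, e (e v) = e v := fun v => by rw [hev (e v), hde, hev v]; simp [hdhd, hhh]
  have hde' : ∀ v, d' (e' v) = 0 := fun v => by simp [hev', hdd', hdhd']
  have hed' : ∀ v, e' (d' v) = 0 := fun v => by simp [hev', hdd', hdhd']
  have hee' : ∀ v, e' (e' v) = e' v := fun v => by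
    rw [hev' (e' v), hde', hev' v]; simp [hdhd', hhh']
  have hφ0 : GradedSpace.IsHom φ 0 := fun n v hv => by rw [add_zero]; exact hφ n v hv
  -- The images of e and e' represent the homologies, and e'φe is φ on homology. Cutting its
  -- generalized inverse down to e b e' gives a chain map ψ of degree 0 that inverts φ there
  -- (`hleft`, `hright`).
  obtain ⟨b, hb, hba⟩ := (heh'.comp (hφ0.comp heh)).exists_generalized_inverse
  simp only [LinearMap.comp_apply] at hba
  have hψ0 : GradedSpace.IsHom (e ∘ₗ b ∘ₗ e') 0 := by simpa using heh.comp (hb.comp heh')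
  have hψ : ∀ n, ∀ w ∈ W.gr n, (e ∘ₗ b ∘ₗ e') w ∈ V.gr n := fun n w hw => by
    simpa using hψ0 n w hw
  have hedeg : ∀ n, ∀ v ∈ V.gr n, e v ∈ V.gr n := fun n v hv => by simpa using heh n v hv
  have hedeg' : ∀ n, ∀ v ∈ W.gr n, e' v ∈ W.gr n := fun n v hv => by simpa using heh' n v hv
  have hker : ∀ v, e' (φ (e v)) = 0 → e v = 0 := by
    intro v hv
    have h1 : d' (h' (φ (e v))) = φ (e v) := by
      rw [hev', hc, hde, map_zero, map_zero, add_zero, sub_eq_zero] at hv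
      exact hv.symm
    obtain ⟨y, hy⟩ := hinj (e v) (hde v) ⟨_, h1⟩
    rw [← hee, ← hy, hed]
  have hleft : ∀ v, (e ∘ₗ b ∘ₗ e') (φ (e v)) = e v := by
    intro v
    simp only [LinearMap.comp_apply]
    rw [← sub_eq_zero, ← map_sub]
    apply hker
    rw [map_sub, map_sub, map_sub, hba, sub_self]
  have hright : ∀ w, e' (φ ((e ∘ₗ b ∘ₗ e') w)) = e' w := by
    intro w
    obtain ⟨x, hx, y', hy'⟩ := hsurj (e' w) (hde' w)
    have h1 : e' (φ (e x)) = e' w := by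
      have : φ x = e' w + d' y' := by rw [← hy', add_sub_cancel]
      rw [hev, hx, map_zero, add_zero, map_sub, ← hc, map_sub, hed', sub_zero, this, map_add, hed',
        add_zero, hee']
    simp only [LinearMap.comp_apply]
    rw [← h1, hba]
  have hψc : ∀ w, d ((e ∘ₗ b ∘ₗ e') w) = (e ∘ₗ b ∘ₗ e') (d' w) := fun w => by
    simp [hde, hed']
  generalize e ∘ₗ b ∘ₗ e' = ψ at *
  have hcont := fun {x} => sub_map_mem_range (x := x) hd hh hdd hdhd hhh he hedeg
  have hcont' := fun {x} => sub_map_mem_range (x := x) hd' hh' hdd' hdhd' hhh' he' hedeg'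
  constructor
  · intro x hx w hw
    obtain ⟨y, hy⟩ := hcont hx
    -- Modulo boundaries x is Λe x = ΛψΛφΛe x, hence ΛψΛφ x, which is a boundary since Λφ x is.
    have h1 : map e hedeg x = map ψ hψ (map φ hφ (map e hedeg x)) := by
      have hcomp : ∀ n, ∀ v ∈ V.gr n, (φ ∘ₗ e) v ∈ W.gr n := fun n v hv => hφ n _ (hedeg n v hv)
      have hcomp' : ∀ n, ∀ v ∈ V.gr n, (ψ ∘ₗ φ ∘ₗ e) v ∈ V.gr n :=
        fun n v hv => hψ n _ (hcomp n v hv)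
      rw [map_comp_apply φ hφ e hedeg hcomp, map_comp_apply ψ hψ (φ ∘ₗ e) hcomp hcomp']
      congr 2
      exact LinearMap.ext fun v => (hleft v).symm
    have h2 : map e hedeg x = x - derivation d y := by rw [← hy, sub_sub_cancel]
    refine ⟨y + (map ψ hψ w - map ψ hψ (map φ hφ y)), ?_⟩
    rw [map_add, map_sub, map_derivation hψ hd' hd hψc, map_derivation hψ hd' hd hψc,
      map_derivation hφ hd hd' hc, ← hw, ← map_sub, ← map_sub, ← h2, ← h1, ← hy, sub_add_cancel]
  · intro x' hx'
    have h0 : derivation d (map ψ hψ x') = 0 := by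
      rw [map_derivation hψ hd' hd hψc, hx', map_zero]
    refine ⟨map ψ hψ x', h0, ?_⟩
    have h1 : derivation d' (map φ hφ (map ψ hψ x')) = 0 := by
      rw [map_derivation hφ hd hd' hc, h0, map_zero]
    obtain ⟨y, hy⟩ := hcont' h1
    obtain ⟨y', hy'⟩ := hcont' hx'
    have h2 : map e' hedeg' (map φ hφ (map ψ hψ x')) = map e' hedeg' x' := by
      have hcomp : ∀ n, ∀ v ∈ W.gr n, (φ ∘ₗ ψ) v ∈ W.gr n := fun n v hv => hφ n _ (hψ n v hv)
      have hcomp' : ∀ n, ∀ v ∈ W.gr n, (e' ∘ₗ φ ∘ₗ ψ) v ∈ W.gr n :=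
        fun n v hv => hedeg' n _ (hcomp n v hv)
      rw [map_comp_apply φ hφ ψ hψ hcomp, map_comp_apply e' hedeg' (φ ∘ₗ ψ) hcomp hcomp']
      congr 2
      exact LinearMap.ext fun v => hright v
    refine ⟨y - y', ?_⟩
    rw [map_sub, ← hy, ← hy', h2, sub_sub_sub_cancel_right]

end Lam

/-! ### The linear part δ₁ of the differential -/

namespace LInfinityStructure

variable {V : GradedSpace.{u}} (L : LInfinityStructure V)

/-- The suspension `h₁ = s ∘ ℓ₁ ∘ s⁻¹` of the differential. -/
noncomputable def sDiff : V.susp →ₗ[ℚ] V.susp :=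
  V.s.toLinearMap ∘ₗ L.diff ∘ₗ V.s.symm.toLinearMap

theorem sDiff_isHom : GradedSpace.IsHom L.sDiff (-1) := fun n x hx => by
  have := L.diff_mem _ (V.s.symm x) hx
  rw [show n - 1 - 1 = n + -1 - 1 by ring] at this
  exact this

theorem h_one (v : V.susp) : L.h 1 (fun _ => v) = L.sDiff v := by
  unfold h
  simp only [smul_apply, LinearMap.compMultilinearMap_apply, MultilinearMap.compLinearMap_apply]
  simp [sDiff, diff_apply]

theorem hTotal_ι (v : V.susp) : L.hTotal (Lam.ι V.susp v) = L.sDiff v := by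
  have := Lam.descend_prod L.h L.h_gradedSymm (fun _ : Fin 1 => v)
  rw [h_one, List.ofFn_succ, List.ofFn_zero, List.prod_singleton] at this
  exact this

theorem δPart_one : L.δPart 1 = Lam.derivation L.sDiff := by
  have : L.hPart 1 = L.sDiff ∘ₗ Lam.proj V.susp := by
    ext x
    induction x using Lam.wordLen_span with
    | add x y hx hy => rw [map_add, map_add, hx, hy]
    | hom n x hx =>
      by_cases hn : n = 1
      · subst hn
        rw [L.hPart_self hx]
        obtain ⟨v, rfl⟩ := Lam.wordLen_one hx
        rw [L.hTotal_ι, LinearMap.comp_apply, Lam.proj_ι]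
      · rw [L.hPart_of_ne hn hx, LinearMap.comp_apply, Lam.proj_of_mem_ne hn hx, map_zero]
  rw [Lam.derivation, ← this]
  rfl

theorem hTotal_one : L.hTotal 1 = 0 :=
  Lam.descend_eq_zero_on_wordLen _ L.h_zero Lam.one_mem_wordLen

/-- On a single letter δ is h₁, so hδ = 0 evaluated there is the claim. -/
theorem sDiff_sDiff (v : V.susp) : L.sDiff (L.sDiff v) = 0 := by
  induction v using V.susp.hom_induction with
  | zero => simp
  | add x y hx hy => rw [map_add, map_add, hx, hy, add_zero]
  | hom i v hv =>
    have h1 := LinearMap.congr_fun L.hTotal_δ (Lam.ι V.susp v)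
    have h2 := Lam.coderivation_ι_mul L.hTotal_isHom hv 1
    rw [mul_one, Lam.coderivation_one, Lam.coderivation_one, Lam.contract_apply, mul_one,
      hTotal_one, map_zero, mul_zero, smul_zero, add_zero, hTotal_ι] at h2
    change L.hTotal (Lam.coderivation L.hTotal _) = 0 at h1
    rwa [h2, hTotal_ι] at h1

end LInfinityStructure

/-! ### Coalgebra morphisms and their leading parts -/

namespace Lam

variable {V W : GradedSpace.{u}}

theorem sub_lenProj_mem {n : ℕ} {x : Lam V} (hx : x ∈ filtration V n) :
    x - lenProj V n x ∈ filtration V (n - 1) := by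
  rw [mem_filtration] at hx ⊢
  intro m hm
  rw [map_sub]
  by_cases h : m = n
  · subst h
    rw [lenProj_of_mem (lenProj_mem m x), sub_self]
  · rw [hx m (by omega), lenProj_of_mem_ne (fun h' => h h'.symm) (lenProj_mem n x), sub_zero]

theorem lenProj_mem_filtration (n : ℕ) (x : Lam V) : lenProj V n x ∈ filtration V n :=
  wordLen_le_filtration le_rfl (lenProj_mem n x)

/-- The data of a morphism of coaugmented coalgebras. -/
structure IsCoalgHom (f : Lam V →ₗ[ℚ] Lam W) : Prop where
  map_one : f 1 = 1
  counit_comp : (counit W).toLinearMap ∘ₗ f = (counit V).toLinearMap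
  comul_comp : comul W ∘ₗ f = TensorProduct.map f f ∘ₗ comul V

namespace IsCoalgHom

variable {f : Lam V →ₗ[ℚ] Lam W}

theorem toCoaugKer_apply (hf : IsCoalgHom f) (x : Lam V) : toCoaugKer W (f x) = f (toCoaugKer V x) := by
  have := LinearMap.congr_fun hf.counit_comp x
  simp only [LinearMap.comp_apply, AlgHom.toLinearMap_apply] at this
  rw [Lam.toCoaugKer_apply, Lam.toCoaugKer_apply, this, map_sub, map_smul, hf.map_one]

theorem iterComul_apply (hf : IsCoalgHom f) (m : ℕ) (x : Lam V) :
    iterComul W m (f x) = TensorAlgebra.lift ℚ (TensorAlgebra.ι ℚ ∘ₗ f) (iterComul V m x) := by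
  induction m generalizing x with
  | zero => simp [iterComul, hf.toCoaugKer_apply]
  | succ m ih =>
    have h1 := LinearMap.congr_fun hf.comul_comp x
    simp only [LinearMap.comp_apply] at h1
    simp only [iterComul, reducedComul_eq, LinearMap.comp_apply, h1]
    generalize comul V x = y
    induction y using TensorProduct.induction_on with
    | zero => simp
    | add a b ha hb => simp only [map_add, ha, hb]
    | tmul a b => simp [hf.toCoaugKer_apply, ih]

/-- F is defined through the iterated reduced diagonals, which coalgebra morphisms respect. -/
theorem map_filtration (hf : IsCoalgHom f) (p : ℤ) (x : Lam V) (hx : x ∈ filtration V p) : f x ∈ filtration W p := by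
  unfold filtration at hx ⊢
  split_ifs at hx ⊢ with h
  · rw [LinearMap.mem_ker] at hx ⊢
    rw [hf.iterComul_apply, hx, map_zero]
  · rw [Submodule.mem_bot] at hx ⊢
    rw [hx, map_zero]

/-- A letter has filtration 1, so its image is a letter plus a constant, and compatibility with the
counit kills the constant. -/
theorem apply_ι (hf : IsCoalgHom f) (v : V) : f (ι V v) = ι W (proj W (f (ι V v))) := by
  have h1 := hf.map_filtration 1 (ι V v)
    (wordLen_le_filtration (n := 1) (by simp) (ι_mem_wordLen v))
  have h2 := sub_lenProj_mem (n := 1) (by simpa using h1)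
  have h3 := sub_lenProj_mem (n := 0) (by simpa using h2)
  have h4 : f (ι V v) - lenProj W 1 (f (ι V v)) ∈ wordLen W 0 := by
    have h5 := mem_filtration.1 h3
    have h6 : f (ι V v) - lenProj W 1 (f (ι V v)) =
      lenProj W 0 (f (ι V v) - lenProj W 1 (f (ι V v))) := by
      obtain ⟨N, hN⟩ := exists_sum_lenProj (f (ι V v) - lenProj W 1 (f (ι V v)) -
        lenProj W 0 (f (ι V v) - lenProj W 1 (f (ι V v))))
      rw [← sub_eq_zero, hN N le_rfl]
      exact Finset.sum_eq_zero fun n _ => h5 n (by simp; omega)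
    rw [h6]
    exact lenProj_mem _ _
  obtain ⟨c, hc⟩ := wordLen_zero h4
  have h5 := congrArg (counit W) hc
  have h6 := LinearMap.congr_fun hf.counit_comp (ι V v)
  have h7 := counit_ι_mul v (1 : Lam V)
  have h8 := counit_ι_mul (proj W (f (ι V v))) (1 : Lam W)
  rw [mul_one] at h7 h8
  simp only [LinearMap.comp_apply, AlgHom.toLinearMap_apply, h7] at h6
  rw [map_sub, h6, ← ι_proj, h8, map_smul, _root_.map_one] at h5
  have hc0 : c = 0 := by simpa using h5.symm
  rw [hc0, zero_smul, sub_eq_zero, ← ι_proj] at hc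
  exact hc

/-- The leading part of a morphism of coalgebras is induced by its linear part. -/
theorem lenProj_apply (hf : IsCoalgHom f) (hφ : ∀ n, ∀ v ∈ V.gr n, (proj W ∘ₗ f ∘ₗ ι V) v ∈ W.gr n) {n : ℕ}
    {x : Lam V} (hx : x ∈ wordLen V n) :
    lenProj W n (f x) = map (proj W ∘ₗ f ∘ₗ ι V) hφ x := by
  cases n with
  | zero =>
    obtain ⟨c, rfl⟩ := wordLen_zero hx
    rw [map_smul, hf.map_one, map_smul, map_smul, lenProj_of_mem one_mem_wordLen, _root_.map_one]
  | succ m =>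
    have h1 := (iterComul_of_mem m).2 x hx
    -- The m-th diagonal of a word of length m + 1 involves only letters, on which f is its linear
    -- part. Multiplying out yields the same nonzero scalar on both sides in length m + 1, which is
    -- then cancelled.
    have h2 : ∀ y ∈ tensorLetters V,
        TensorAlgebra.lift ℚ LinearMap.id (TensorAlgebra.lift ℚ (TensorAlgebra.ι ℚ ∘ₗ f) y) =
        map (proj W ∘ₗ f ∘ₗ ι V) hφ (TensorAlgebra.lift ℚ LinearMap.id y) := by
      intro y hy
      induction hy using Algebra.adjoin_induction with
      | mem y hy =>
        obtain ⟨v, rfl⟩ := hy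
        simp only [TensorAlgebra.lift_ι_apply, LinearMap.comp_apply, LinearMap.id_apply, map_ι]
        exact hf.apply_ι v
      | algebraMap r => simp
      | add a b _ _ ha hb => simp only [map_add, ha, hb]
      | mul a b _ _ ha hb => simp only [map_mul, ha, hb]
    have h3 := h2 _ h1
    rw [← hf.iterComul_apply] at h3
    have h4 := LinearMap.congr_fun (lift_iterComul (V := V) m) x
    have h5 := LinearMap.congr_fun (lift_iterComul (V := W) m) (f x)
    simp only [LinearMap.comp_apply, AlgHom.toLinearMap_apply] at h4 h5
    rw [h5, h4, scale_of_mem _ hx, map_smul] at h3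
    have h6 := congrArg (lenProj W (m + 1)) h3
    rw [lenProj_scale, map_smul, lenProj_of_mem (map_mem_wordLen _ _ hx)] at h6
    exact smul_right_injective _ (surjCount_pos m (m + 1) (by omega)).ne' h6

end IsCoalgHom

end Lam

/-! ### L∞ quasi-isomorphisms on the first page -/

namespace LInfinityAlgebra

namespace Hom

variable {L L' : LInfinityAlgebra.{u}} (f : Hom L L')

theorem isCoalgHom : Lam.IsCoalgHom f.toLinearMap := ⟨f.map_one, f.counit_comp, f.comul_comp⟩

/-- The suspension `π ∘ f ∘ ι` of the linear part of an `L∞` morphism. -/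
noncomputable def sLinearPart : L.space.susp →ₗ[ℚ] L'.space.susp :=
  Lam.proj L'.space.susp ∘ₗ f.toLinearMap ∘ₗ Lam.ι L.space.susp

theorem sLinearPart_mem (n : ℤ) (v : L.space.susp) (hv : v ∈ L.space.susp.gr n) :
    f.sLinearPart v ∈ L'.space.susp.gr n :=
  Lam.proj_mem_gr n _ (f.map_gr n _ (Lam.ι_mem_gr hv))

theorem quasiIso_lam (hf : f.IsQuasiIso) :
    (∀ x, L.str.δPart 1 x = 0 → ∀ w, Lam.map f.sLinearPart f.sLinearPart_mem x = L'.str.δPart 1 w →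
      ∃ z, x = L.str.δPart 1 z) ∧
    ∀ x', L'.str.δPart 1 x' = 0 → ∃ x, L.str.δPart 1 x = 0 ∧
      ∃ w, Lam.map f.sLinearPart f.sLinearPart_mem x - x' = L'.str.δPart 1 w := by
  rw [L.str.δPart_one, L'.str.δPart_one]
  obtain ⟨h1, h2, h3⟩ := hf
  exact Lam.map_quasiIso f.sLinearPart_mem L.str.sDiff_isHom L'.str.sDiff_isHom
    L.str.sDiff_sDiff L'.str.sDiff_sDiff h1 h2 h3

end Hom

theorem δ_sub_δPart_one_mem (L : LInfinityAlgebra.{u}) {p : ℤ} {x : L.Chains} (hx : x ∈ L.F p) :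
    L.δ x - L.str.δPart 1 x ∈ L.F (p - 1) :=
  L.str.δ_sub_δPart_mem (k := 1) (fun j hj => by
    obtain rfl : j = 0 := by omega
    exact L.str.ℓ_zero) hx

theorem δ_mem (L : LInfinityAlgebra.{u}) {p : ℤ} {x : L.Chains} (hx : x ∈ L.F p) : L.δ x ∈ L.F p :=
  L.isFilteredComplex.map_le p ⟨x, hx, rfl⟩

theorem lenProj_δPart_one (L : LInfinityAlgebra.{u}) (n : ℕ) (x : L.Chains) :
    Lam.lenProj L.space.susp n (L.str.δPart 1 x) =
      L.str.δPart 1 (Lam.lenProj L.space.susp n x) := by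
  rw [L.str.δPart_one]
  exact Lam.lenProj_comm (fun n x hx => Lam.derivation_mem_wordLen _ hx) n x

/-- The leading part of `δ` on `F_n` is `δ₁`. -/
theorem lenProj_δ (L : LInfinityAlgebra.{u}) {n : ℕ} {x : L.Chains} (hx : x ∈ L.F n) :
    Lam.lenProj L.space.susp n (L.δ x) = L.str.δPart 1 (Lam.lenProj L.space.susp n x) := by
  have h := Lam.mem_filtration.1 (L.δ_sub_δPart_one_mem hx) n (by omega)
  rwa [map_sub, lenProj_δPart_one, sub_eq_zero] at h

theorem mem_F_pred_iff (L : LInfinityAlgebra.{u}) {n : ℕ} {x : L.Chains} (hx : x ∈ L.F n) :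
    x ∈ L.F (n - 1) ↔ Lam.lenProj L.space.susp n x = 0 := by
  constructor
  · intro h; exact Lam.mem_filtration.1 h n (by omega)
  · intro h
    have := Lam.sub_lenProj_mem hx
    rwa [h, sub_zero] at this

theorem eq_zero_of_mem_F_neg (L : LInfinityAlgebra.{u}) {p : ℤ} (hp : p < 0) {x : L.Chains}
    (hx : x ∈ L.F p) : x = 0 := by
  have : L.F p = ⊥ := if_neg (by omega)
  rwa [this] at hx

namespace Hom

variable {L L' : LInfinityAlgebra.{u}} (f : Hom L L')

theorem mem_F (p : ℤ) (x : L.Chains) (hx : x ∈ L.F p) : f.toLinearMap x ∈ L'.F p :=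
  f.isCoalgHom.map_filtration p x hx

theorem lenProj_apply {n : ℕ} {x : L.Chains} (hx : x ∈ L.F n) :
    Lam.lenProj L'.space.susp n (f.toLinearMap x) =
      Lam.map f.sLinearPart f.sLinearPart_mem (Lam.lenProj L.space.susp n x) := by
  have h := Lam.mem_filtration.1 (f.mem_F _ _ (Lam.sub_lenProj_mem hx)) n (by omega)
  rw [map_sub, map_sub, sub_eq_zero] at h
  rw [h]
  exact f.isCoalgHom.lenProj_apply f.sLinearPart_mem (Lam.lenProj_mem n x)

/-- Taking length-p components identifies F_p/F_{p-1} with (Λ^p, δ₁) and f with Λ of its linear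
part, which reduces the claim to `quasiIso_lam`. -/
theorem injBetween (hf : f.IsQuasiIso) (p : ℤ) :
    InjBetween L.δ L.F L'.δ L'.F f.toLinearMap p (p - 1) := by
  intro x hx hdx w hw hxw
  by_cases hp : 0 ≤ p
  · lift p to ℕ using hp
    rw [L.mem_F_pred_iff (L.δ_mem hx), L.lenProj_δ hx] at hdx
    rw [L'.mem_F_pred_iff (Submodule.sub_mem _ (f.mem_F _ _ hx) (L'.δ_mem hw)), map_sub,
      f.lenProj_apply hx, L'.lenProj_δ hw, sub_eq_zero] at hxw
    obtain ⟨z, hz⟩ := (f.quasiIso_lam hf).1 _ hdx _ hxw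
    have hzm := Lam.lenProj_mem_filtration p z
    -- The preimage z may have components of any length; since δ₁ preserves length, the one of
    -- length p suffices.
    refine ⟨Lam.lenProj L.space.susp p z, hzm, ?_⟩
    rw [L.mem_F_pred_iff (Submodule.sub_mem _ hx (L.δ_mem hzm)), map_sub, L.lenProj_δ hzm,
      Lam.lenProj_of_mem (Lam.lenProj_mem p z), ← L.lenProj_δPart_one, ← hz,
      Lam.lenProj_of_mem (Lam.lenProj_mem p x), sub_self]
  · rw [L.eq_zero_of_mem_F_neg (by omega) hx]
    exact ⟨0, Submodule.zero_mem _, by simp⟩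

theorem surjBetween (hf : f.IsQuasiIso) (p : ℤ) :
    SurjBetween L.δ L.F L'.δ L'.F f.toLinearMap p (p - 1) := by
  intro x' hx' hdx'
  by_cases hp : 0 ≤ p
  · lift p to ℕ using hp
    rw [L'.mem_F_pred_iff (L'.δ_mem hx'), L'.lenProj_δ hx'] at hdx'
    obtain ⟨x, hx, w, hw⟩ := (f.quasiIso_lam hf).2 _ hdx'
    have hxm := Lam.lenProj_mem_filtration p x
    have hwm := Lam.lenProj_mem_filtration p w
    refine ⟨Lam.lenProj L.space.susp p x, hxm, ?_, Lam.lenProj L'.space.susp p w, hwm, ?_⟩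
    · rw [L.mem_F_pred_iff (L.δ_mem hxm), L.lenProj_δ hxm,
        Lam.lenProj_of_mem (Lam.lenProj_mem p x), ← L.lenProj_δPart_one, hx, map_zero]
    · have h1 := congrArg (Lam.lenProj L'.space.susp p) hw
      have h2 : Lam.lenProj L'.space.susp p (Lam.map f.sLinearPart f.sLinearPart_mem x) =
          Lam.map f.sLinearPart f.sLinearPart_mem (Lam.lenProj L.space.susp p x) :=
        Lam.lenProj_comm (f := (Lam.map f.sLinearPart f.sLinearPart_mem).toLinearMap)
          (fun n x hx => Lam.map_mem_wordLen _ f.sLinearPart_mem hx) p x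
      rw [map_sub, h2, L'.lenProj_δPart_one, Lam.lenProj_of_mem (Lam.lenProj_mem p x')] at h1
      rw [L'.mem_F_pred_iff (Submodule.sub_mem _ (Submodule.sub_mem _ (f.mem_F _ _ hxm) hx')
        (L'.δ_mem hwm)), map_sub, map_sub, f.lenProj_apply hxm, L'.lenProj_δ hwm,
        Lam.lenProj_of_mem (Lam.lenProj_mem p x), Lam.lenProj_of_mem (Lam.lenProj_mem p w), h1,
        sub_self]
  · rw [L'.eq_zero_of_mem_F_neg (by omega) hx']
    exact ⟨0, Submodule.zero_mem _, by simp, 0, Submodule.zero_mem _, by simp⟩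

end Hom

/-- Weakly equivalent `L∞` algebras have the same `r` with `dʳ = 0`, for `r ≥ 1`. -/
theorem WeaklyEquivalent.extendsCycles_iff {L L' : LInfinityAlgebra.{u}}
    (h : WeaklyEquivalent L L') {r : ℤ} (hr : 1 ≤ r) (p : ℤ) :
    ExtendsCycles L.δ L.F r p ↔ ExtendsCycles L'.δ L'.F r p := by
  induction h with
  | rel L L' h =>
    obtain ⟨f, hf⟩ := h
    exact Quillen.extendsCycles_iff L.isFilteredComplex L'.isFilteredComplex
      (fun x => LinearMap.congr_fun f.δ_comp x) f.mem_F (f.injBetween hf) (f.surjBetween hf) hr p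
  | refl => exact Iff.rfl
  | symm _ _ _ ih => exact ih.symm
  | trans _ _ _ _ _ ih ih' => exact ih.trans ih'

theorem IsFormal.collapsesAt {L : LInfinityAlgebra.{u}} (h : L.IsFormal) :
    CollapsesAt L.isFilteredComplex 2 := by
  obtain ⟨M, hM, -, hLM⟩ := h
  intro r hr p
  rw [pageD_eq_zero_iff_extendsCycles, hLM.extendsCycles_iff (by omega) p]
  exact extendsCycles_of_binary ⟨_, M⟩ hM hr p

end LInfinityAlgebra

end Quillen

/-! ### The proposition -/

open Quillen in
theorem proposition2p1 (L : LInfinityAlgebra.{u}) :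
    ∃ hC : IsFilteredComplex L.δ L.F,
      -- A formal `L∞` algebra concentrated in non-negative degrees: collapse at `E²`.
      (L.Nonneg → L.IsFormal → CollapsesAt hC 2) ∧
      -- If `ℓⱼ = 0` for `j < k`, then `E⁰ = ⋯ = E^{k-1} ≅ ΛsL` and `d^{k-1}` is `δₖ`.
      (∀ k : ℕ, 1 ≤ k → (∀ j < k, L.str.ℓ j = 0) →
        (∀ r : ℤ, 0 ≤ r → r ≤ (k : ℤ) - 1 → ∀ p : ℤ,
          cyc L.δ L.F r p = cyc L.δ L.F 0 p ∧ den L.δ L.F r p = den L.δ L.F 0 p) ∧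
        (∀ r : ℤ, 0 ≤ r → r < (k : ℤ) - 1 → ∀ p : ℤ, pageD hC r p = 0) ∧
        ∃ φ : ∀ p : ℤ, Lam.word L.space.susp p ≃ₗ[ℚ] Page L.δ L.F ((k : ℤ) - 1) p,
          (∀ (p : ℤ) (x : Lam.word L.space.susp p),
            ∃ hx : (x : L.Chains) ∈ cyc L.δ L.F ((k : ℤ) - 1) p,
              φ p x = pageMk L.δ L.F ((k : ℤ) - 1) p ⟨x, hx⟩) ∧
          (∀ (p : ℤ) (x : Lam.word L.space.susp p),
            ∃ hy : L.str.δPart k x ∈ Lam.word L.space.susp (p - ((k : ℤ) - 1)),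
              pageD hC ((k : ℤ) - 1) p (φ p x) =
                φ (p - ((k : ℤ) - 1)) ⟨L.str.δPart k x, hy⟩)) := by
  refine ⟨L.isFilteredComplex, fun _ h => h.collapsesAt, fun k hk hℓ => ?_⟩
  have hlow : ∀ p, ∀ x ∈ L.F p, L.δ x ∈ L.F (p - ((k : ℤ) - 1)) := by
    intro p x hx
    have := L.str.δ_mem_filtration hℓ hx
    rwa [show p - (k : ℤ) + 1 = p - ((k : ℤ) - 1) by ring] at this
  refine ⟨fun r hr hrk p => ⟨?_, ?_⟩, fun r hr hrk p => ?_, ?_⟩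
  · rw [cyc_eq_of_lowering L.isFilteredComplex hlow hrk,
      cyc_eq_of_lowering L.isFilteredComplex hlow (by omega)]
  · rw [den_eq_of_lowering L.isFilteredComplex hlow hrk,
      den_eq_of_lowering L.isFilteredComplex hlow (by omega)]
  · rw [pageD_eq_zero_iff]
    intro x hx
    -- For r < k - 1 the image of δ lies in F_{p-k+1}, hence in F_{p-r-1}, the denominator of the
    -- target page.
    rw [den_eq_of_lowering L.isFilteredComplex hlow hrk.le]
    exact L.isFilteredComplex.mono (by omega) (hlow p x hx.1)
  · exact exists_page_equiv L.isFilteredComplex hlow (Lam.word L.space.susp)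
      Lam.filtration_eq_sup (fun p x hx hx' => Lam.word_disjoint_filtration hx hx')
      (L.str.δPart k) (fun p x hx => L.str.δPart_mem_word k hx) (fun p x hx => by
        have := L.str.δ_sub_δPart_mem hℓ hx
        rwa [show p - (k : ℤ) = p - ((k : ℤ) - 1) - 1 by ring] at this)
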